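/- Let $X$ be a complex manifold of dimension $n\ge 2$, let $\omega$ be a Kähler form on $X$, let $0<\theta_0<\pi$, and let $\alpha$ be a $(1,1)$-current on $X$ which near every point has an upper semicontinuous local potential. Conventions. A $(1,1)$-form or current is identified in holomorphic coordinates with its coefficient matrix, $i\sum g_{jk}\,dz_j\wedge d\bar z_k\leftrightarrow (g_{jk})$. An upper semicontinuous local potential on an open set $O$ of a coordinate chart of a current $T$ is a locally integrable, upper semicontinuous $\varphi:O\to[-\infty,\infty)$ with $i\partial\bar\partial\varphi=T$ on $O$ in the sense of distributions, normalized by $\varphi(x)=\operatorname{ess\,limsup}_{y\to x}\varphi(y)$ for all $x\in O$ (automatic for quasi-plurisubharmonic functions). For a positive definite Hermitian matrix $G$ and a Hermitian matrix $A$ let $$P_G(A)=-\min_{1\le k\le n}\cot\Big(\sum_{j\ne k}\operatorname{arccot}\lambda_j\Big),$$ where $\lambda_1,\dots,\lambda_n$ are the eigenvalues of $G^{-1}A$ and $\operatorname{arccot}:\mathbb R\to(0,\pi)$. For an upper semicontinuous $\varphi$ on an open set $O\subset\mathbb C^n$ and a function $G$ on $O$ with values in positive definite Hermitian matrices, $P_G(i\partial\bar\partial\varphi)\le_v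 c$ on $O$ means: for every $x\in O$ and every real $C^2$ function $q$ on a neighbourhood $U$ of $x$ with $q\ge\varphi$ on $U$ and $q(x)=\varphi(x)$, one has $P_{G(x)}\big((i\partial\bar\partial q)(x)\big)\le c$. Finally, $P_\omega(\alpha)\le_v c$ means that $P_\omega(i\partial\bar\partial\varphi)\le_v c$ on $O$ for every open subset $O$ of every holomorphic chart and every upper semicontinuous local potential $\varphi$ of $\alpha$ on $O$. Let $\rho:\mathbb C^n\to[0,\infty)$ be a smooth function with $\rho(w)=0$ for $|w|>1$ and $\int\rho=1$. For a function $\varphi$ on $O$ and $\delta>0$ put $\varphi^\delta(z)=\int_{\mathbb C^n}\varphi(z-\delta w)\rho(w)\,dw$ for $z\in O_\delta=\{z\in O: d(z,\partial O)>\delta\}$. Then the following are equivalent. (a) $P_\omega(\alpha)\le_v-\cot\theta_0$. (b) For every $\varepsilon>0$ there is $r>0$ such that for every open subset $O$ of a holomorphic chart, every Kähler form $\omega_0$ with constant coefficients on $O$ with $-r\,\omega\le\omega_0-\omega\le r\,\omega$ on $O$, every upper semicontinuous local potential $\varphi_\varepsilon$ of $\alpha+\varepsilon\omega$ on $O$ and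 every $\delta>0$, $$P_{\omega_0}(i\partial\bar\partial\varphi_\varepsilon^\delta)\le_v-\cot\theta_0\quad\text{on } O_\delta .$$ -/

import Mathlib

open MeasureTheory Topology
open scoped Manifold ContDiff Distributions ComplexOrder

noncomputable section

namespace DHYM

/-- Complex Euclidean space `ℂⁿ`, with its Lebesgue measure `volume`. -/
abbrev Cn (n : ℕ) : Type := EuclideanSpace ℂ (Fin n)

/-! ### Wirtinger derivatives -/

/-- `∂f/∂z_j = (∂f/∂x_j - i ∂f/∂y_j) / 2`. -/
def dz {n : ℕ} (j : Fin n) (f : Cn n → ℂ) (z : Cn n) : ℂ :=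
  (fderiv ℝ f z (EuclideanSpace.single j 1)
    - Complex.I * fderiv ℝ f z (EuclideanSpace.single j Complex.I)) / 2

/-- `∂f/∂z̄_j = (∂f/∂x_j + i ∂f/∂y_j) / 2`. -/
def dzbar {n : ℕ} (j : Fin n) (f : Cn n → ℂ) (z : Cn n) : ℂ :=
  (fderiv ℝ f z (EuclideanSpace.single j 1)
    + Complex.I * fderiv ℝ f z (EuclideanSpace.single j Complex.I)) / 2

/-- The coefficient matrix `(∂²q/∂z_j∂z̄_k)` of the form
`i∂∂̄q = i ∑ (∂²q/∂z_j∂z̄_k) dz_j ∧ dz̄_k`. -/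
def levi {n : ℕ} (q : Cn n → ℝ) (z : Cn n) : Matrix (Fin n) (Fin n) ℂ :=
  Matrix.of fun j k => dz j (dzbar k fun y => (q y : ℂ)) z

/-! ### The operator `P` -/

/-- The inverse cotangent with values in `(0, π)`. -/
def arccot (t : ℝ) : ℝ := Real.pi / 2 - Real.arctan t

/-- The eigenvalues of `G⁻¹A`, with multiplicity; for `G` positive definite Hermitian and `A`
Hermitian they are all real, and there are `n` of them. -/
def eigs {n : ℕ} (G A : Matrix (Fin n) (Fin n) ℂ) : Multiset ℝ :=
  (G⁻¹ * A).charpoly.roots.map Complex.re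

/-- `P_G(A) = - min_k cot (∑_{j ≠ k} arccot λ_j)`, where `λ_1, …, λ_n` are the eigenvalues of
`G⁻¹A`; the infimum below is over a finite set, nonempty for `n ≥ 1`. -/
def opP {n : ℕ} (G A : Matrix (Fin n) (Fin n) ℂ) : ℝ :=
  - sInf ((fun t => Real.cot ((((eigs G A).erase t).map arccot).sum)) '' {t | t ∈ eigs G A})

/-! ### Viscosity subsolutions on open subsets of `ℂⁿ` -/

/-- `q` is an upper test of `φ` at `x`: it is `C²` on a neighbourhood `U` of `x`, `q ≥ φ` on `U`,
and `q(x) = φ(x)`. -/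
def IsUpperTest {n : ℕ} (φ : Cn n → EReal) (x : Cn n) (q : Cn n → ℝ) : Prop :=
  (q x : EReal) = φ x ∧
    ∃ U : Set (Cn n), IsOpen U ∧ x ∈ U ∧ ContDiffOn ℝ 2 q U ∧ ∀ y ∈ U, φ y ≤ (q y : EReal)

/-- `P_G(i∂∂̄φ) ≤_v c` on the open set `O`, for a matrix-valued function `G`. -/
def IsViscositySubsolution {n : ℕ} (G : Cn n → Matrix (Fin n) (Fin n) ℂ) (c : ℝ)
    (φ : Cn n → EReal) (O : Set (Cn n)) : Prop :=
  UpperSemicontinuousOn φ O ∧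
    ∀ x ∈ O, ∀ q : Cn n → ℝ, IsUpperTest φ x q → opP (G x) (levi q x) ≤ c

/-! ### Forms and currents of bidegree `(1,1)` on a complex manifold

They are given by their coefficients `(g_{jk})`, standing for `i ∑ g_{jk} dz_j ∧ dz̄_k`, in all
holomorphic charts, subject to the transformation law of tensors. -/

section Manifold

variable {n : ℕ} {X : Type*} [TopologicalSpace X] [ChartedSpace (Cn n) X]

/-- The holomorphic charts of `X`. -/
def holCharts (n : ℕ) (X : Type*) [TopologicalSpace X] [ChartedSpace (Cn n) X] :
    Set (OpenPartialHomeomorph X (Cn n)) :=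
  IsManifold.maximalAtlas 𝓘(ℂ, Cn n) ω X

/-- The target of a chart as a bundled open set. -/
def tgt (e : OpenPartialHomeomorph X (Cn n)) : TopologicalSpace.Opens (Cn n) :=
  ⟨e.target, e.open_target⟩

/-- The complex Jacobian matrix `(∂F_j/∂z_a)_{j,a}` at `z` of the change of coordinates
`F = e' ∘ e⁻¹`. -/
def jac (e e' : OpenPartialHomeomorph X (Cn n)) (z : Cn n) : Matrix (Fin n) (Fin n) ℂ :=
  Matrix.of fun j a => (fderiv ℂ (fun y => e' (e.symm y)) z (EuclideanSpace.single a 1)) j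

/-- A Kähler form: a smooth, positive definite, closed real `(1,1)`-form
`i ∑ g_{jk} dz_j ∧ dz̄_k`. -/
structure KahlerForm (n : ℕ) (X : Type*) [TopologicalSpace X] [ChartedSpace (Cn n) X] where
  /-- The coefficients `g_{jk}` in a chart, as functions on the target of the chart. -/
  coeff : OpenPartialHomeomorph X (Cn n) → Cn n → Matrix (Fin n) (Fin n) ℂ
  /-- Change of coordinates: `g_{ab} = ∑ (∂F_j/∂z_a) conj(∂F_k/∂z_b) (g'_{jk} ∘ F)`. -/
  transform : ∀ e ∈ holCharts n X, ∀ e' ∈ holCharts n X, ∀ z ∈ (e.symm.trans e').source, ∀ a b,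
    coeff e z a b =
      ∑ j, ∑ k, jac e e' z j a * star (jac e e' z k b) * coeff e' (e' (e.symm z)) j k
  smooth : ∀ e ∈ holCharts n X, ∀ j k, ContDiffOn ℝ ∞ (fun z => coeff e z j k) e.target
  posDef : ∀ e ∈ holCharts n X, ∀ z ∈ e.target, (coeff e z).PosDef
  /-- Closedness: `∂g_{jk}/∂z_l = ∂g_{lk}/∂z_j`. As `g` is Hermitian, the conjugate relations
  follow. -/
  closed : ∀ e ∈ holCharts n X, ∀ z ∈ e.target, ∀ l j k,
    dz l (fun y => coeff e y j k) z = dz j (fun y => coeff e y l k) z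

/-- A current of bidegree `(1,1)`: a form `i ∑ T_{jk} dz_j ∧ dz̄_k` with distribution
coefficients. -/
structure Current (n : ℕ) (X : Type*) [TopologicalSpace X] [ChartedSpace (Cn n) X] where
  /-- The coefficients `T_{jk}` in a chart, as distributions on the target of the chart. -/
  coeff : (e : OpenPartialHomeomorph X (Cn n)) → Fin n → Fin n → 𝓓'(tgt e, ℂ)
  /-- Change of coordinates: `T_{ab} = ∑ (∂F_j/∂z_a) conj(∂F_k/∂z_b) F^*T'_{jk}` on the overlap.
  Testing `(∂F_j/∂z_a) conj(∂F_k/∂z_b) F^*T'_{jk}` with `η` amounts to testing `T'_{jk}` with the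
  function `ζ_{jk} + i ξ_{jk}` for which `(ζ_{jk} + i ξ_{jk}) ∘ F` multiplied by the real Jacobian
  determinant `|det(∂F)|²` is `η (∂F_j/∂z_a) conj(∂F_k/∂z_b)`. -/
  transform : ∀ e ∈ holCharts n X, ∀ e' ∈ holCharts n X, ∀ (a b : Fin n)
    (η : 𝓓(tgt e, ℝ)) (ζ ξ : Fin n → Fin n → 𝓓(tgt e', ℝ)),
    tsupport η ⊆ (e.symm.trans e').source →
    (∀ j k, tsupport (ζ j k) ⊆ (e'.symm.trans e).source) →
    (∀ j k, tsupport (ξ j k) ⊆ (e'.symm.trans e).source) →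
    (∀ j k, ∀ z ∈ (e.symm.trans e').source,
      ((ζ j k (e' (e.symm z)) : ℂ) + Complex.I * (ξ j k (e' (e.symm z)) : ℂ))
          * (Complex.normSq (jac e e' z).det : ℂ)
        = (η z : ℂ) * jac e e' z j a * star (jac e e' z k b)) →
    coeff e a b η =
      ∑ j, ∑ k, (coeff e' j k (ζ j k) + Complex.I * coeff e' j k (ξ j k))

/-- The coefficients, in the chart `e`, of the current `α + ε ω`, evaluated on test functions. -/
def addKahler (α : Current n X) (ε : ℝ) (κ : KahlerForm n X)
    (e : OpenPartialHomeomorph X (Cn n)) (j k : Fin n) (η : 𝓓(tgt e, ℝ)) : ℂ :=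
  α.coeff e j k η + (ε : ℂ) * ∫ z, κ.coeff e z j k * (η z : ℂ)

/-- `φ` is an upper semicontinuous local potential, on the open subset `O` of the target of `e`,
of the current with coefficients `T` in the chart `e`: a locally integrable upper semicontinuous
function with values in `[-∞, ∞)` such that `i∂∂̄φ = T` on `O` in the sense of distributions.

The field `normalized` says that `φ` is at each point at most (hence, by semicontinuity, equal to)
its essential upper limit there. It fixes the values of `φ` on null sets, to which the
distribution `i∂∂̄φ` is insensitive, and it is automatic for (quasi-)plurisubharmonic functions. -/
structure IsUscPotential (e : OpenPartialHomeomorph X (Cn n))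
    (T : Fin n → Fin n → 𝓓(tgt e, ℝ) → ℂ) (O : Set (Cn n)) (φ : Cn n → EReal) : Prop where
  isOpen : IsOpen O
  subset : O ⊆ e.target
  usc : UpperSemicontinuousOn φ O
  ne_top : ∀ x ∈ O, φ x ≠ ⊤
  ae_ne_bot : ∀ᵐ x ∂(volume.restrict O), φ x ≠ ⊥
  locallyIntegrable : LocallyIntegrableOn (fun x => (φ x).toReal) O volume
  normalized : ∀ x ∈ O, ∀ c : EReal, c < φ x → ∀ U ∈ 𝓝 x, 0 < volume {y ∈ U | c < φ y}
  potential : ∀ (j k : Fin n) (η : 𝓓(tgt e, ℝ)), tsupport η ⊆ O →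
    T j k η = ∫ z, ((φ z).toReal : ℂ) * dz j (dzbar k fun y => (η y : ℂ)) z

/-- Near each point of `X` the current `α` has an upper semicontinuous local potential (so `α` is
in particular real and closed). -/
def HasUscPotentials (α : Current n X) : Prop :=
  ∀ x : X, ∃ e ∈ holCharts n X, x ∈ e.source ∧ ∃ (O : Set (Cn n)) (φ : Cn n → EReal),
    e x ∈ O ∧ IsUscPotential e (fun j k η => α.coeff e j k η) O φ

/-- `P_ω(α) ≤_v c` on `X`: every upper semicontinuous local potential `φ` of `α`, in any holomorphic
chart, satisfies `P_ω(i∂∂̄φ) ≤_v c`. -/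
def ViscosityLE (κ : KahlerForm n X) (α : Current n X) (c : ℝ) : Prop :=
  ∀ e ∈ holCharts n X, ∀ (O : Set (Cn n)) (φ : Cn n → EReal),
    IsUscPotential e (fun j k η => α.coeff e j k η) O φ →
      IsViscositySubsolution (κ.coeff e) c φ O

end Manifold

/-! ### Regularization -/

/-- A standard mollifier: smooth, nonnegative, zero for `|w| > 1`, of integral `1`. -/
structure IsMollifier {n : ℕ} (ρ : Cn n → ℝ) : Prop where
  smooth : ContDiff ℝ ∞ ρ
  nonneg : ∀ w, 0 ≤ ρ w
  zero_of_one_lt : ∀ w, 1 < ‖w‖ → ρ w = 0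
  integral_eq_one : ∫ w, ρ w = 1

/-- The regularization `φ^δ(z) = ∫ φ(z - δw) ρ(w) dw`. -/
def regularize {n : ℕ} (ρ : Cn n → ℝ) (δ : ℝ) (φ : Cn n → EReal) (z : Cn n) : ℝ :=
  ∫ w, (φ (z - δ • w)).toReal * ρ w

/-- `O_δ`, the set of points of the open set `O` at distance more than `δ` from its boundary. -/
def shrink {n : ℕ} (O : Set (Cn n)) (δ : ℝ) : Set (Cn n) :=
  {z | Metric.closedBall z δ ⊆ O}

/-- `|H - G|_G ≤ r` for Hermitian forms, i.e. `-r G ≤ H - G ≤ r G`. -/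
def CloseTo {n : ℕ} (H G : Matrix (Fin n) (Fin n) ℂ) (r : ℝ) : Prop :=
  ∀ v : Fin n → ℂ, ‖star v ⬝ᵥ (H - G).mulVec v‖ ≤ r * ‖star v ⬝ᵥ G.mulVec v‖

end DHYM

end

noncomputable section

namespace DHYM

/-! ### The inverse cotangent -/

/-! The inequality `opP G A ≤ -cot θ` alone does not bound the angle sums: a sum of n - 1 angles may
exceed π, where the cotangent takes all its values again. Upper tests remove this defect. If q is an
upper test at x, so is q plus t times the quadratic form with Levi matrix G(x), for every t ≥ 0.
Hence the inequality holds along the whole ray A + tG. There the angle sums decrease continuously to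
0, and a sum starting above θ would have to pass through values just above θ, where the cotangent is
too small (`mem_angleSet_of_ray`, `admissible_of_upperTest_ray`). So the viscosity inequality says
exactly that Levi matrices of upper tests are `Admissible`.

For θ < π admissibility is well behaved. The set `angleSet` is closed, convex, invariant under
permutations and stable under increasing the entries. Convexity rests on the concavity of (xu -
1)/(x + u), the cotangent of the sum of two angles, on x + u > 0. Through Birkhoff's theorem and
Schur's argument (`Admissible.diag_mem`) this passes to matrices: diagonals of an admissible matrix
in all G-orthonormal frames lie in `angleSet`, whence monotonicity and closedness of admissibility.
Moreover, admissibility of A for G implies that of A + εG for every H close to G, with a closeness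
independent of A and G (`exists_admissible_of_closeTo`). The eigenvalues of A are unbounded above,
but the large ones contribute almost no angle.

From (a) to (b): subtracting ε times a smooth local potential of ω (`KahlerForm.exists_potential`)
turns a potential of α + εω into one of α, and stability makes the Levi matrices of upper tests of
the given potential admissible for the constant metric H. If the Hessian of a regularization were
not admissible at z, a hyperplane separating its eigenvalues from `angleSet` would have nonnegative
weights. It would thus define an operator L = ∑ ∂²/∂(m i)² with constant coefficients, possibly
degenerate, and a number b such that all upper tests satisfy L q ≥ b while the regularization
violates this at z. But a viscosity subsolution of L u ≥ b is a distributional one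
(`IsLinearSubsolution.integral_ge`), and pairing with the mollifier gives a contradiction
(`admissible_regularize`).

The linear statement is proved with the resolvent of L. If g ≥ u is smooth, comparison at a maximum
of u - w, where w - τ L w = g, gives u + τ b ≤ w. Integrating against η, moving the resolvent onto η
by symmetry, letting g decrease to u, expanding the resolvent of η as η + τ L η + O(τ²) and dividing
by τ yields b ∫ η ≤ ∫ u L η. A barrier p, glued to u, supplies the boundary values that the
comparison needs.

From (b) to (a): near x the metric is frozen to its value at x. Regularizations converge almost
everywhere, and the normalization of potentials makes every strict upper test touch a regularization
at points arbitrarily near x (`exists_touching_regularize`). Monotonicity and closedness then give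
admissibility of the test, up to ε, which tends to 0 at the end. -/

lemma arccot_pos (t : ℝ) : 0 < arccot t := by
  have := Real.arctan_lt_pi_div_two t
  unfold arccot; linarith

lemma arccot_lt_pi (t : ℝ) : arccot t < Real.pi := by
  have := Real.neg_pi_div_two_lt_arctan t
  unfold arccot; linarith

lemma arccot_strictAnti : StrictAnti arccot := fun a b h => by
  have := Real.arctan_strictMono h
  unfold arccot; linarith

lemma arccot_continuous : Continuous arccot := by
  unfold arccot; exact continuous_const.sub Real.continuous_arctan

lemma cot_arccot (t : ℝ) : Real.cot (arccot t) = t := by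
  rw [Real.cot_eq_cos_div_sin, arccot, Real.cos_pi_div_two_sub, Real.sin_pi_div_two_sub,
    ← Real.tan_eq_sin_div_cos, Real.tan_arctan]

lemma exists_arccot_eq {θ : ℝ} (h0 : 0 < θ) (h1 : θ < Real.pi) : ∃ c, arccot c = θ := by
  refine ⟨Real.tan (Real.pi / 2 - θ), ?_⟩
  rw [arccot, Real.arctan_tan (by linarith) (by linarith)]; ring

lemma arccot_cot {θ : ℝ} (h0 : 0 < θ) (h1 : θ < Real.pi) : arccot (Real.cot θ) = θ := by
  obtain ⟨c, rfl⟩ := exists_arccot_eq h0 h1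
  rw [cot_arccot]

lemma arccot_neg (t : ℝ) : arccot (-t) = Real.pi - arccot t := by
  unfold arccot; rw [Real.arctan_neg]; ring

lemma add_pos_of_arccot_add_lt {x u : ℝ} (h : arccot x + arccot u < Real.pi) : 0 < x + u := by
  have h1 : arccot x < arccot (-u) := by rw [arccot_neg]; linarith
  have := arccot_strictAnti.lt_iff_gt.1 h1
  linarith

/-- The addition formula for the cotangent; positivity of x + u is what keeps the sum of the two
angles below π. -/
lemma arccot_add {x u : ℝ} (h : 0 < x + u) :
    arccot x + arccot u = arccot ((x * u - 1) / (x + u)) := by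
  have h1 : arccot x < arccot (-u) := arccot_strictAnti (by linarith)
  rw [arccot_neg] at h1
  have h0 : 0 < arccot x + arccot u := add_pos (arccot_pos _) (arccot_pos _)
  rw [← arccot_cot h0 (by linarith)]
  congr 1
  have hx : ∀ t : ℝ, Real.sin (arccot t) ≠ 0 := fun t =>
    (Real.sin_pos_of_pos_of_lt_pi (arccot_pos t) (arccot_lt_pi t)).ne'
  have hs : Real.sin (arccot x + arccot u) ≠ 0 :=
    (Real.sin_pos_of_pos_of_lt_pi h0 (by linarith)).ne'
  have ex := cot_arccot x
  have eu := cot_arccot u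
  rw [Real.cot_eq_cos_div_sin, div_eq_iff (hx _)] at ex eu
  rw [Real.cot_eq_cos_div_sin, div_eq_div_iff hs h.ne', Real.sin_add, Real.cos_add, ex, eu]
  ring

/-- The function (xu - 1)/(x + u) is concave on the half plane x + u > 0: the defect in the
concavity inequality is an explicit sum of two squares with nonnegative weight. -/
lemma arccot_add_le_of_convex_comb {p q x y u v : ℝ} (hp : 0 ≤ p) (hq : 0 ≤ q) (hpq : p + q = 1)
    (hx : 0 < x + u) (hy : 0 < y + v) :
    arccot (p * x + q * y) + arccot (p * u + q * v) ≤
      arccot (p * ((x * u - 1) / (x + u)) + q * ((y * v - 1) / (y + v))) := by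
  have hs : 0 < (p * x + q * y) + (p * u + q * v) := by
    rcases hp.eq_or_lt with rfl | hp'
    · have : q = 1 := by linarith
      subst this; linarith
    · have : 0 < p * (x + u) := mul_pos hp' hx
      have : 0 ≤ q * (y + v) := mul_nonneg hq hy.le
      linarith
  rw [arccot_add hs]
  apply arccot_strictAnti.antitone
  rw [le_div_iff₀ hs]
  have hq' : q = 1 - p := by linarith
  have key : ((p * x + q * y) * (p * u + q * v) - 1)
      - (p * ((x * u - 1) / (x + u)) + q * ((y * v - 1) / (y + v))) *
        ((p * x + q * y) + (p * u + q * v))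
      = p * q * ((x * (y + v) - y * (x + u)) ^ 2 + ((y + v) - (x + u)) ^ 2)
        / ((x + u) * (y + v)) := by
    subst hq'
    field_simp
    ring
  have : 0 ≤ p * q * ((x * (y + v) - y * (x + u)) ^ 2 + ((y + v) - (x + u)) ^ 2)
        / ((x + u) * (y + v)) := by positivity
  linarith

/-- Any partial sum of angles below π is itself the arccotangent of some number, so the two-angle
inequality iterates. -/
lemma sum_arccot_convex_comb {ι : Type*} [DecidableEq ι] (s : Finset ι) (hs : s.Nonempty)
    {p q : ℝ} (hp : 0 ≤ p) (hq : 0 ≤ q) (hpq : p + q = 1) (x y : ι → ℝ) :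
    ∀ a b, ∑ j ∈ s, arccot (x j) = arccot a → ∑ j ∈ s, arccot (y j) = arccot b →
      ∑ j ∈ s, arccot (p * x j + q * y j) ≤ arccot (p * a + q * b) := by
  induction hs using Finset.Nonempty.cons_induction with
  | singleton i =>
    intro a b ha hb
    simp only [Finset.sum_singleton] at ha hb ⊢
    rw [arccot_strictAnti.injective ha, arccot_strictAnti.injective hb]
  | cons i s hi hs ih =>
    intro a b ha hb
    rw [Finset.sum_cons] at ha hb ⊢
    have aux : ∀ (x : ι → ℝ) (a : ℝ), arccot (x i) + ∑ j ∈ s, arccot (x j) = arccot a →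
        ∃ c, ∑ j ∈ s, arccot (x j) = arccot c ∧ 0 < x i + c ∧
          a = (x i * c - 1) / (x i + c) := by
      intro x a ha
      have h0 : 0 < ∑ j ∈ s, arccot (x j) := Finset.sum_pos (fun j _ => arccot_pos _) hs
      have h1 : ∑ j ∈ s, arccot (x j) < Real.pi := by
        have := arccot_lt_pi a
        have := arccot_pos (x i)
        linarith
      obtain ⟨c, hc⟩ := exists_arccot_eq h0 h1
      rw [← hc] at ha
      have hp : 0 < x i + c := add_pos_of_arccot_add_lt (by rw [ha]; exact arccot_lt_pi a)
      refine ⟨c, hc.symm, hp, ?_⟩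
      rw [arccot_add hp] at ha
      exact (arccot_strictAnti.injective ha).symm
    obtain ⟨c, hc, hc0, rfl⟩ := aux x a ha
    obtain ⟨d, hd, hd0, rfl⟩ := aux y b hb
    exact (add_le_add_right (ih c d hc hd) _).trans
      (arccot_add_le_of_convex_comb hp hq hpq hc0 hd0)

/-! ### The admissible sets of eigenvalues -/

/-- The vectors whose entries, leaving out any one of them, have arccotangents of sum at
most `θ`. -/
def angleSet (n : ℕ) (θ : ℝ) : Set (Fin n → ℝ) :=
  {d | ∀ k, ∑ j ∈ Finset.univ.erase k, arccot (d j) ≤ θ}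

/-- As θ < π, the angle sums of the two vectors are arccot a and arccot b; the sum for the
combination is at most arccot (p a + q b), hence at most the larger of the two. -/
lemma angleSet_convex {n : ℕ} {θ : ℝ} (hθ : θ < Real.pi) : Convex ℝ (angleSet n θ) := by
  intro x hx y hy p q hp hq hpq k
  simp only [Pi.add_apply, Pi.smul_apply, smul_eq_mul]
  rcases (Finset.univ.erase k).eq_empty_or_nonempty with he | hne
  · simpa [he] using hx k
  · have aux : ∀ x : Fin n → ℝ, x ∈ angleSet n θ →
        ∃ c, ∑ j ∈ Finset.univ.erase k, arccot (x j) = arccot c ∧ arccot c ≤ θ := by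
      intro x hx
      obtain ⟨c, hc⟩ := exists_arccot_eq (Finset.sum_pos (fun j _ => arccot_pos (x j)) hne)
        ((hx k).trans_lt hθ)
      exact ⟨c, hc.symm, hc ▸ hx k⟩
    obtain ⟨a, ha, ha'⟩ := aux x hx
    obtain ⟨b, hb, hb'⟩ := aux y hy
    refine (sum_arccot_convex_comb _ hne hp hq hpq x y a b ha hb).trans ?_
    rcases le_total a b with h | h
    · refine (arccot_strictAnti.antitone ?_).trans ha'
      have : q * a ≤ q * b := mul_le_mul_of_nonneg_left h hq
      have : p * a + q * a = a := by rw [← add_mul, hpq, one_mul]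
      linarith
    · refine (arccot_strictAnti.antitone ?_).trans hb'
      have : p * b ≤ p * a := mul_le_mul_of_nonneg_left h hp
      have : p * b + q * b = b := by rw [← add_mul, hpq, one_mul]
      linarith

lemma angleSet_isClosed {n : ℕ} {θ : ℝ} : IsClosed (angleSet n θ) := by
  simp only [angleSet, Set.ofPred_forall]
  refine isClosed_iInter fun k => isClosed_le ?_ continuous_const
  exact continuous_finsetSum _ fun j _ => arccot_continuous.comp (continuous_apply j)

lemma angleSet_upper {n : ℕ} {θ : ℝ} {x y : Fin n → ℝ} (hx : x ∈ angleSet n θ) (hxy : x ≤ y) :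
    y ∈ angleSet n θ := fun k =>
  (Finset.sum_le_sum fun j _ => arccot_strictAnti.antitone (hxy j)).trans (hx k)

lemma angleSet_perm {n : ℕ} {θ : ℝ} {x : Fin n → ℝ} (hx : x ∈ angleSet n θ)
    (σ : Equiv.Perm (Fin n)) : x ∘ σ ∈ angleSet n θ := by
  intro k
  refine le_trans (le_of_eq ?_) (hx (σ k))
  refine Finset.sum_bij (fun j _ => σ j) ?_ (fun _ _ _ _ h => σ.injective h) ?_ (fun _ _ => rfl)
  · intro j hj; simpa using hj
  · intro j hj; exact ⟨σ.symm j, by simpa [Equiv.symm_apply_eq] using hj, by simp⟩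

/-- A vector in `angleSet n θ` with `n ≥ 2` has entries at least `cot θ`. -/
lemma le_of_mem_angleSet {n : ℕ} (hn : 2 ≤ n) {c : ℝ} {x : Fin n → ℝ}
    (hx : x ∈ angleSet n (arccot c)) (j : Fin n) : c ≤ x j := by
  have : Nontrivial (Fin n) := Fin.nontrivial_iff_two_le.2 hn
  obtain ⟨k, hk⟩ := exists_ne j
  refine arccot_strictAnti.le_iff_ge.1 (le_trans ?_ (hx k))
  exact Finset.single_le_sum (f := fun j => arccot (x j)) (fun i _ => (arccot_pos _).le)
    (by simp [hk.symm])

/-- By Birkhoff's theorem the image is a convex combination of permutations of x. -/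
lemma angleSet_doublyStochastic {n : ℕ} {θ : ℝ} (hθ : θ < Real.pi) {x : Fin n → ℝ}
    (hx : x ∈ angleSet n θ) {D : Matrix (Fin n) (Fin n) ℝ}
    (hD : D ∈ doublyStochastic ℝ (Fin n)) : D.mulVec x ∈ angleSet n θ := by
  obtain ⟨w, hw0, hw1, hw⟩ := exists_eq_sum_perm_of_mem_doublyStochastic hD
  have : D.mulVec x = ∑ σ, w σ • (x ∘ σ) := by
    rw [← hw, Matrix.sum_mulVec]
    refine Finset.sum_congr rfl fun σ _ => ?_
    rw [Matrix.smul_mulVec, Matrix.permMatrix_mulVec]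
  rw [this]
  exact (angleSet_convex hθ).sum_mem (fun σ _ => hw0 σ) hw1 fun σ _ => angleSet_perm hx σ

lemma tendsto_arccot_atTop : Filter.Tendsto arccot Filter.atTop (𝓝 0) := by
  have : Filter.Tendsto Real.arctan Filter.atTop (𝓝 (Real.pi / 2)) :=
    Real.tendsto_arctan_atTop.mono_right nhdsWithin_le_nhds
  have h := this.const_sub (Real.pi / 2)
  rwa [sub_self] at h

lemma exists_sum_arccot_add_eq {ι : Type*} (s : Finset ι) (x : ι → ℝ) {σ : ℝ} (h0 : 0 < σ)
    (h1 : σ ≤ ∑ j ∈ s, arccot (x j)) : ∃ t, 0 ≤ t ∧ ∑ j ∈ s, arccot (x j + t) = σ := by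
  have hc : Continuous fun t : ℝ => ∑ j ∈ s, arccot (x j + t) :=
    continuous_finsetSum _ fun j _ => arccot_continuous.comp (continuous_const.add continuous_id)
  have hl : Filter.Tendsto (fun t : ℝ => ∑ j ∈ s, arccot (x j + t)) Filter.atTop (𝓝 0) := by
    have := tendsto_finsetSum s fun j (_ : j ∈ s) =>
      tendsto_arccot_atTop.comp (Filter.tendsto_atTop_add_const_left Filter.atTop (x j)
        Filter.tendsto_id)
    simpa using this
  obtain ⟨T, hT, hT0⟩ := ((hl.eventually (gt_mem_nhds h0)).and (Filter.eventually_ge_atTop 0)).exists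
  obtain ⟨t, ht, hte⟩ := intermediate_value_Icc' hT0 hc.continuousOn ⟨hT.le, by simpa using h1⟩
  exact ⟨t, ht.1, hte⟩

lemma cot_lt_cot {a b : ℝ} (ha : 0 < a) (hab : a < b) (hb : b < Real.pi) :
    Real.cot b < Real.cot a := by
  rw [← arccot_strictAnti.lt_iff_gt, arccot_cot ha (hab.trans hb), arccot_cot (ha.trans hab) hb]
  exact hab

lemma cot_le_cot {a b : ℝ} (ha : 0 < a) (hab : a ≤ b) (hb : b < Real.pi) :
    Real.cot b ≤ Real.cot a := by
  rcases hab.eq_or_lt with rfl | h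
  · rfl
  · exact (cot_lt_cot ha h hb).le

/-- If the cotangents of the partial angle sums stay above `cot θ` along the whole ray
`x + t (1, …, 1)`, then the angle sums themselves are at most `θ`. -/
lemma mem_angleSet_of_ray {n : ℕ} {θ : ℝ} (h0 : 0 < θ) (h1 : θ < Real.pi) {x : Fin n → ℝ}
    (h : ∀ t, 0 ≤ t → ∀ k, Real.cot θ ≤
      Real.cot (∑ j ∈ Finset.univ.erase k, arccot (x j + t))) : x ∈ angleSet n θ := by
  intro k
  by_contra! hk
  obtain ⟨σ, hσ1, hσ2⟩ := exists_between (lt_min h1 hk)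
  obtain ⟨t, ht, hte⟩ := exists_sum_arccot_add_eq _ x (h0.trans hσ1)
    (hσ2.le.trans (min_le_right _ _))
  have := h t ht k
  rw [hte] at this
  exact absurd (cot_lt_cot h0 hσ1 (hσ2.trans_le (min_le_left _ _))) (not_lt.2 this)

/-- The scalar estimate behind the stability of `angleSet` under perturbation of the metric. -/
lemma exists_contraction_angleSet {n : ℕ} (hn : 2 ≤ n) (c : ℝ) {s : ℝ} (hs : 0 < s) :
    ∃ r₀, 0 < r₀ ∧ ∀ r, 0 < r → r ≤ r₀ → ∀ μ : Fin n → ℝ, (∀ j, 0 ≤ μ j) →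
      (fun j => μ j + c) ∈ angleSet n (arccot c) →
      (fun j => μ j / (1 + r) + c + s) ∈ angleSet n (arccot c) := by
  have hn0 : (0 : ℝ) < n := by exact_mod_cast (by omega : 0 < n)
  -- a threshold beyond which all angles together are small
  obtain ⟨Λ, hΛ, hΛ0⟩ := ((tendsto_arccot_atTop.eventually
    (gt_mem_nhds (div_pos (arccot_pos c) hn0))).and (Filter.eventually_ge_atTop |c|)).exists
  -- the gain of a small entry
  have hgain : ∃ γ, 0 < γ ∧ ∀ m ∈ Set.Icc (0 : ℝ) (2 * (Λ + |c|)),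
      arccot (m + c + s / 2) + γ ≤ arccot (m + c) := by
    have hcont : Continuous fun m : ℝ => arccot (m + c) - arccot (m + c + s / 2) :=
      (arccot_continuous.comp (by fun_prop)).sub (arccot_continuous.comp (by fun_prop))
    have hne : (Set.Icc (0 : ℝ) (2 * (Λ + |c|))).Nonempty := ⟨0, by
      constructor
      · rfl
      · have := abs_nonneg c; linarith⟩
    obtain ⟨m₀, -, hm₀⟩ := isCompact_Icc.exists_isMinOn hne hcont.continuousOn
    refine ⟨_, sub_pos.2 (arccot_strictAnti (by linarith : m₀ + c < m₀ + c + s / 2)), ?_⟩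
    intro m hm
    have : arccot (m₀ + c) - arccot (m₀ + c + s / 2) ≤ arccot (m + c) - arccot (m + c + s / 2) :=
      hm₀ hm
    linarith
  obtain ⟨γ, hγ, hgain⟩ := hgain
  -- An entry beyond M has angle below γ / n, so all such entries together cost less than the gain γ
  -- of one moderate entry.
  obtain ⟨M, hM, hM0⟩ := ((tendsto_arccot_atTop.eventually
    (gt_mem_nhds (div_pos hγ hn0))).and (Filter.eventually_ge_atTop 1)).exists
  have hcn := abs_nonneg c
  have hLpos : 0 < 2 * (Λ + |c|) + 2 * (M + |c|) := by linarith
  -- The bound r ≤ 1 gives μ / (1 + r) ≥ μ / 2. The second bound makes the loss μ - μ / (1 + r) at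
  -- most s / 2 for all μ up to the sum of the two thresholds.
  refine ⟨min 1 (s / 2 / (2 * (Λ + |c|) + 2 * (M + |c|))), by positivity, ?_⟩
  intro r hr hr0 μ hμ hmem k
  have hr1 : r ≤ 1 := hr0.trans (min_le_left _ _)
  have hr2 : r * (2 * (Λ + |c|) + 2 * (M + |c|)) ≤ s / 2 :=
    (le_div_iff₀ hLpos).1 (hr0.trans (min_le_right _ _))
  have hhalf : ∀ j, μ j / 2 ≤ μ j / (1 + r) := fun j =>
    div_le_div_of_nonneg_left (hμ j) (by linarith) (by linarith)
  have hne : (Finset.univ.erase k).Nonempty := by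
    have : Nontrivial (Fin n) := Fin.nontrivial_iff_two_le.2 hn
    obtain ⟨j, hj⟩ := exists_ne k
    exact ⟨j, by simp [hj]⟩
  have hcard : ((Finset.univ.erase k).card : ℝ) ≤ n := by
    exact_mod_cast (Finset.card_le_univ _).trans (by simp)
  have habs := neg_abs_le c
  -- If all remaining entries are large, every angle is below arccot c / n. Otherwise a moderate
  -- entry i gains γ; other entries below the larger threshold do not lose, and the huge ones lose
  -- at most γ / n each.
  by_cases hbig : ∀ j ∈ Finset.univ.erase k, 2 * (Λ + |c|) ≤ μ j
  · have : ∑ j ∈ Finset.univ.erase k, arccot (μ j / (1 + r) + c + s) ≤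
        ∑ j ∈ Finset.univ.erase k, arccot c / n := by
      refine Finset.sum_le_sum fun j hj => (arccot_strictAnti.antitone ?_).trans hΛ.le
      have := hbig j hj
      have := hhalf j
      linarith
    refine this.trans ?_
    rw [Finset.sum_const, nsmul_eq_mul, ← mul_div_assoc, div_le_iff₀ hn0, mul_comm]
    exact mul_le_mul_of_nonneg_left hcard (arccot_pos c).le
  · push Not at hbig
    obtain ⟨i, hi, hiΛ⟩ := hbig
    refine le_trans ?_ (hmem k)
    rw [← Finset.add_sum_erase _ _ hi, ← Finset.add_sum_erase _ _ hi]
    have hdiv : ∀ j, μ j / (1 + r) = μ j - r * (μ j / (1 + r)) := fun j => by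
      field_simp; ring
    have h1r : 0 < 1 + r := by linarith
    have hle : ∀ j, μ j / (1 + r) ≤ μ j := fun j => div_le_self (hμ j) (by linarith)
    have h1 : arccot (μ i / (1 + r) + c + s) + γ ≤ arccot (μ i + c) := by
      refine le_trans (add_le_add_left (arccot_strictAnti.antitone ?_) γ)
        (hgain (μ i) ⟨hμ i, hiΛ.le⟩)
      rw [hdiv i]
      have : r * (μ i / (1 + r)) ≤ r * (2 * (Λ + |c|) + 2 * (M + |c|)) :=
        mul_le_mul_of_nonneg_left (((hle i).trans hiΛ.le).trans (by linarith)) hr.le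
      linarith
    have h2 : ∀ j, arccot (μ j / (1 + r) + c + s) ≤ arccot (μ j + c) + γ / n := by
      intro j
      by_cases hj : μ j ≤ 2 * (Λ + |c|) + 2 * (M + |c|)
      · refine (arccot_strictAnti.antitone ?_).trans (le_add_of_nonneg_right (by positivity))
        rw [hdiv j]
        have : r * (μ j / (1 + r)) ≤ r * (2 * (Λ + |c|) + 2 * (M + |c|)) :=
          mul_le_mul_of_nonneg_left ((hle j).trans hj) hr.le
        linarith
      · have hM' : arccot (μ j / (1 + r) + c + s) ≤ γ / n := by
          refine (arccot_strictAnti.antitone ?_).trans hM.le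
          have := hhalf j
          push Not at hj
          linarith
        have := (arccot_pos (μ j + c)).le
        linarith
    have h3 : ∑ j ∈ (Finset.univ.erase k).erase i, arccot (μ j / (1 + r) + c + s) ≤
        ∑ j ∈ (Finset.univ.erase k).erase i, arccot (μ j + c) + γ := by
      refine (Finset.sum_le_sum fun j _ => h2 j).trans ?_
      rw [Finset.sum_add_distrib]
      refine add_le_add_right ?_ _
      rw [Finset.sum_const, nsmul_eq_mul, ← mul_div_assoc, div_le_iff₀ hn0, mul_comm]
      refine mul_le_mul_of_nonneg_left ?_ hγ.le
      exact_mod_cast (Finset.card_le_univ _).trans (by simp)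
    linarith

/-! ### Simultaneous diagonalization -/

section Frames

open Matrix

variable {n : ℕ}

/-- A Hermitian matrix is diagonal in a basis which is orthonormal for a given positive definite
one. -/
lemma exists_frame {G A : Matrix (Fin n) (Fin n) ℂ} (hG : G.PosDef) (hA : A.IsHermitian) :
    ∃ (S : Matrix (Fin n) (Fin n) ℂ) (d : Fin n → ℝ),
      Sᴴ * G * S = 1 ∧ Sᴴ * A * S = diagonal fun j => (d j : ℂ) := by
  have key : ∀ {B : Matrix (Fin n) (Fin n) ℂ} (hB : B.IsHermitian),
      ∃ U : Matrix (Fin n) (Fin n) ℂ, Uᴴ * U = 1 ∧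
        Uᴴ * B * U = diagonal fun j => (hB.eigenvalues j : ℂ) := by
    intro B hB
    refine ⟨hB.eigenvectorUnitary, ?_, ?_⟩
    · exact Unitary.coe_star_mul_self hB.eigenvectorUnitary
    · have := hB.conjStarAlgAut_star_eigenvectorUnitary
      rw [Unitary.conjStarAlgAut_star_apply] at this
      exact this
  -- The matrix U D normalizes G to the identity; the congruent image of A is then diagonalized
  -- unitarily, which does not disturb the identity.
  obtain ⟨U, hU, hUG⟩ := key hG.1
  let D : Matrix (Fin n) (Fin n) ℂ := diagonal fun j => (((√(hG.1.eigenvalues j))⁻¹ : ℝ) : ℂ)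
  have hD : Dᴴ = D := by
    simp only [D, diagonal_conjTranspose]
    congr 1; ext j; simp
  have hR : (U * D)ᴴ * G * (U * D) = 1 := by
    have : (U * D)ᴴ * G * (U * D) = Dᴴ * (Uᴴ * G * U) * D := by
      simp only [conjTranspose_mul, Matrix.mul_assoc]
    rw [this, hUG, hD, diagonal_mul_diagonal, diagonal_mul_diagonal, ← diagonal_one]
    congr 1; ext j
    have hpos := hG.eigenvalues_pos j
    have h1 : (√(hG.1.eigenvalues j))⁻¹ * hG.1.eigenvalues j * (√(hG.1.eigenvalues j))⁻¹ = 1 := by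
      have h2 := Real.sq_sqrt hpos.le
      have h3 := (Real.sqrt_pos.2 hpos).ne'
      field_simp
      exact h2.symm
    exact_mod_cast h1
  obtain ⟨V, hV, hVA⟩ := key (isHermitian_conjTranspose_mul_mul (U * D) hA)
  refine ⟨U * D * V, (isHermitian_conjTranspose_mul_mul (U * D) hA).eigenvalues, ?_, ?_⟩
  · have : (U * D * V)ᴴ * G * (U * D * V) = Vᴴ * ((U * D)ᴴ * G * (U * D)) * V := by
      simp only [conjTranspose_mul, Matrix.mul_assoc]
    rw [this, hR, Matrix.mul_one, hV]
  · rw [← hVA]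
    simp only [conjTranspose_mul, Matrix.mul_assoc]

lemma frame_mul_inv {G S : Matrix (Fin n) (Fin n) ℂ} (h : Sᴴ * G * S = 1) :
    S * Sᴴ * G = 1 := by
  rw [Matrix.mul_assoc] at h ⊢
  have := mul_eq_one_comm.1 h
  rw [← Matrix.mul_assoc] at h
  exact mul_eq_one_comm.1 h

/-- Since G⁻¹ = S Sᴴ, the products G⁻¹ A = S (Sᴴ A) and Sᴴ A S have the same characteristic
polynomial. -/
lemma eigs_eq_of_frame {G A S : Matrix (Fin n) (Fin n) ℂ} {d : Fin n → ℝ}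
    (hG : Sᴴ * G * S = 1) (hA : Sᴴ * A * S = diagonal fun j => (d j : ℂ)) :
    eigs G A = Finset.univ.val.map d := by
  have hinv : G⁻¹ = S * Sᴴ := inv_eq_left_inv (frame_mul_inv hG)
  rw [eigs, hinv, Matrix.mul_assoc, charpoly_mul_comm, hA, charpoly_diagonal,
    Polynomial.roots_prod]
  · simp only [Polynomial.roots_X_sub_C, Multiset.bind_singleton, Multiset.map_map]
    rfl
  · simp [Finset.prod_ne_zero_iff, Polynomial.X_sub_C_ne_zero]

lemma opP_le_iff_of_frame (hn : 0 < n) {G A S : Matrix (Fin n) (Fin n) ℂ} {d : Fin n → ℝ}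
    (hG : Sᴴ * G * S = 1) (hA : Sᴴ * A * S = diagonal fun j => (d j : ℂ)) (c : ℝ) :
    opP G A ≤ -c ↔ ∀ k, c ≤ Real.cot (∑ j ∈ Finset.univ.erase k, arccot (d j)) := by
  have hset : (fun t => Real.cot ((((eigs G A).erase t).map arccot).sum)) '' {t | t ∈ eigs G A}
      = Set.range fun k => Real.cot (∑ j ∈ Finset.univ.erase k, arccot (d j)) := by
    have hk : ∀ k, (((eigs G A).erase (d k)).map arccot).sum =
        ∑ j ∈ Finset.univ.erase k, arccot (d j) := by
      intro k
      rw [eigs_eq_of_frame hG hA, ← Multiset.map_erase_of_mem _ _ (Finset.mem_univ_val k),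
        ← Finset.erase_val, Multiset.map_map]
      rfl
    ext y
    constructor
    · rintro ⟨t, ht, rfl⟩
      rw [Set.mem_ofPred_eq, eigs_eq_of_frame hG hA] at ht
      obtain ⟨k, -, rfl⟩ := Multiset.mem_map.1 ht
      exact ⟨k, by simp only [hk]⟩
    · rintro ⟨k, rfl⟩
      refine ⟨d k, ?_, by simp only [hk]⟩
      rw [Set.mem_ofPred_eq, eigs_eq_of_frame hG hA]
      exact Multiset.mem_map_of_mem _ (Finset.mem_univ_val k)
  have : Nonempty (Fin n) := ⟨⟨0, hn⟩⟩
  rw [opP, hset, neg_le_neg_iff, le_csInf_iff (Set.finite_range _).bddBelow (Set.range_nonempty _)]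
  simp

/-! ### The admissible cone of Hermitian matrices -/

/-- The eigenvalues of the Hermitian matrix `A` with respect to `G` lie in `angleSet n θ`. -/
def Admissible (θ : ℝ) (G A : Matrix (Fin n) (Fin n) ℂ) : Prop :=
  ∃ (S : Matrix (Fin n) (Fin n) ℂ) (d : Fin n → ℝ),
    Sᴴ * G * S = 1 ∧ (Sᴴ * A * S = diagonal fun j => (d j : ℂ)) ∧ d ∈ angleSet n θ

lemma Admissible.opP_le (hn : 2 ≤ n) {θ : ℝ} (hθ : θ < Real.pi)
    {G A : Matrix (Fin n) (Fin n) ℂ} (h : Admissible θ G A) : opP G A ≤ -Real.cot θ := by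
  obtain ⟨S, d, hG, hA, hd⟩ := h
  rw [opP_le_iff_of_frame (by omega) hG hA]
  intro k
  refine cot_le_cot (Finset.sum_pos (fun j _ => arccot_pos _) ?_) (hd k) hθ
  have : Nontrivial (Fin n) := Fin.nontrivial_iff_two_le.2 hn
  obtain ⟨j, hj⟩ := exists_ne k
  exact ⟨j, by simp [hj]⟩

/-- Adding t G shifts every eigenvalue by t in one and the same frame, so the ray of matrices is the
ray of vectors in `mem_angleSet_of_ray`. -/
lemma admissible_of_ray (hn : 2 ≤ n) {θ : ℝ} (h0 : 0 < θ) (hθ : θ < Real.pi)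
    {G A : Matrix (Fin n) (Fin n) ℂ} (hG : G.PosDef) (hA : A.IsHermitian)
    (h : ∀ t : ℝ, 0 ≤ t → opP G (A + (t : ℂ) • G) ≤ -Real.cot θ) : Admissible θ G A := by
  obtain ⟨S, d, hSG, hSA⟩ := exists_frame hG hA
  refine ⟨S, d, hSG, hSA, mem_angleSet_of_ray h0 hθ fun t ht => ?_⟩
  refine (opP_le_iff_of_frame (by omega) hSG ?_ _).1 (h t ht)
  rw [Matrix.mul_add, Matrix.add_mul, hSA, Matrix.mul_smul, Matrix.smul_mul, hSG,
    ← diagonal_one, ← diagonal_smul, diagonal_add]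
  congr 1; ext j; simp

/-- Schur's theorem: the diagonal of an admissible matrix in any orthonormal frame is
admissible. -/
lemma Admissible.diag_mem {θ : ℝ} (hθ : θ < Real.pi) {G A S : Matrix (Fin n) (Fin n) ℂ}
    (hG : G.IsHermitian) (h : Admissible θ G A) (hS : Sᴴ * G * S = 1) :
    (fun j => ((Sᴴ * A * S) j j).re) ∈ angleSet n θ := by
  obtain ⟨T, d, hTG, hTA, hd⟩ := h
  -- U is the unitary passage between the two G-orthonormal frames, S = T U. Its squared moduli form
  -- a doubly stochastic matrix that maps d to the diagonal in question.
  set U := Tᴴ * G * S with hU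
  have hTU : T * U = S := by
    rw [hU, ← Matrix.mul_assoc, ← Matrix.mul_assoc, frame_mul_inv hTG, Matrix.one_mul]
  have hUU : Uᴴ * U = 1 := by
    have : Uᴴ = Sᴴ * G * T := by
      rw [hU, conjTranspose_mul, conjTranspose_mul, conjTranspose_conjTranspose, hG.eq,
        Matrix.mul_assoc]
    rw [this, Matrix.mul_assoc, hTU, hS]
  have hUU' : U * Uᴴ = 1 := mul_eq_one_comm.1 hUU
  have hdiag : Sᴴ * A * S = Uᴴ * (diagonal fun j => (d j : ℂ)) * U := by
    rw [← hTA, ← hTU]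
    simp only [conjTranspose_mul, Matrix.mul_assoc]
  let D : Matrix (Fin n) (Fin n) ℝ := of fun j k => Complex.normSq (U k j)
  have hD : D ∈ doublyStochastic ℝ (Fin n) := by
    rw [mem_doublyStochastic_iff_sum]
    refine ⟨fun i j => Complex.normSq_nonneg _, fun j => ?_, fun k => ?_⟩
    · have := congrFun (congrFun hUU j) j
      rw [mul_apply, one_apply_eq] at this
      have h2 : ((∑ k, Complex.normSq (U k j) : ℝ) : ℂ) = 1 := by
        rw [← this]; push_cast
        exact Finset.sum_congr rfl fun k _ => by
          rw [conjTranspose_apply, Complex.star_def, Complex.normSq_eq_conj_mul_self]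
      exact_mod_cast h2
    · have := congrFun (congrFun hUU' k) k
      rw [mul_apply, one_apply_eq] at this
      have h2 : ((∑ j, Complex.normSq (U k j) : ℝ) : ℂ) = 1 := by
        rw [← this]; push_cast
        exact Finset.sum_congr rfl fun j _ => by
          rw [conjTranspose_apply, Complex.star_def, Complex.mul_conj]
      exact_mod_cast h2
  convert angleSet_doublyStochastic hθ hd hD using 1
  ext j
  rw [hdiag, mul_apply]
  simp only [mul_diagonal, conjTranspose_apply, mulVec, dotProduct, D, of_apply, Complex.re_sum]
  refine Finset.sum_congr rfl fun k _ => ?_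
  simp [Complex.normSq_apply]
  ring

lemma posSemidef_diag_re_nonneg {P S : Matrix (Fin n) (Fin n) ℂ} (hP : P.PosSemidef)
    (j : Fin n) : 0 ≤ ((Sᴴ * P * S) j j).re :=
  (Complex.le_def.1 ((hP.conjTranspose_mul_mul_same S).diag_nonneg (i := j))).1

/-- In an eigenframe of B the diagonal of A is admissible by Schur's theorem and lies entrywise
below the eigenvalues of B. -/
lemma Admissible.mono {θ : ℝ} (hθ : θ < Real.pi) {G A B : Matrix (Fin n) (Fin n) ℂ}
    (hG : G.PosDef) (h : Admissible θ G A) (hB : B.IsHermitian) (hAB : (B - A).PosSemidef) :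
    Admissible θ G B := by
  obtain ⟨S, d, hSG, hSB⟩ := exists_frame hG hB
  refine ⟨S, d, hSG, hSB, angleSet_upper (h.diag_mem hθ hG.1 hSG) fun j => ?_⟩
  have h1 := posSemidef_diag_re_nonneg (S := S) hAB j
  rw [Matrix.mul_sub, Matrix.sub_mul, hSB, Matrix.sub_apply, diagonal_apply_eq, Complex.sub_re,
    Complex.ofReal_re] at h1
  linarith

/-- Diagonals are taken in a fixed eigenframe of the limit, so no continuity of eigenvalues or of
frames is needed. -/
lemma admissible_of_tendsto {θ : ℝ} (hθ : θ < Real.pi) {G A : Matrix (Fin n) (Fin n) ℂ}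
    (hG : G.PosDef) (hA : A.IsHermitian) {ι : Type*} {l : Filter ι} [l.NeBot]
    {B : ι → Matrix (Fin n) (Fin n) ℂ} (hB : Filter.Tendsto B l (𝓝 A))
    (h : ∀ᶠ i in l, Admissible θ G (B i)) : Admissible θ G A := by
  obtain ⟨S, d, hSG, hSA⟩ := exists_frame hG hA
  refine ⟨S, d, hSG, hSA, ?_⟩
  have hc : Continuous fun M : Matrix (Fin n) (Fin n) ℂ => fun j => ((Sᴴ * M * S) j j).re := by
    refine continuous_pi fun j => Complex.continuous_re.comp ?_
    exact ((continuous_const.matrix_mul continuous_id).matrix_mul continuous_const).matrix_elem j j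
  have hlim := (hc.tendsto A).comp hB
  have he : (fun j => ((Sᴴ * A * S) j j).re) = d := by
    ext j; rw [hSA]; simp
  rw [he] at hlim
  exact angleSet_isClosed.mem_of_tendsto hlim (h.mono fun i hi => hi.diag_mem hθ hG.1 hSG)

end Frames

/-! ### Stability of admissibility under perturbation of the metric -/

section Stability

open Matrix

variable {n : ℕ}

/-- Membership depends only on the multiset of entries, hence can be transferred between two pencils
with equal spectra. -/
lemma mem_angleSet_iff_multiset {θ : ℝ} {d : Fin n → ℝ} : d ∈ angleSet n θ ↔
    ∀ t ∈ Finset.univ.val.map d,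
      ((Finset.univ.val.map d).map arccot).sum - arccot t ≤ θ := by
  have h : ∀ k, ∑ j ∈ Finset.univ.erase k, arccot (d j) =
      ((Finset.univ.val.map d).map arccot).sum - arccot (d k) := by
    intro k
    rw [Multiset.map_map]
    have := Finset.sum_erase_add Finset.univ (fun j => arccot (d j)) (Finset.mem_univ k)
    exact eq_sub_of_add_eq this
  constructor
  · intro hd t ht
    obtain ⟨k, -, rfl⟩ := Multiset.mem_map.1 ht
    exact (h k) ▸ hd k
  · intro hd k
    rw [h k]
    exact hd _ (Multiset.mem_map_of_mem _ (Finset.mem_univ_val k))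

/-- The numerical range of N lies in [-r, r], so b + a N is bounded below by b - |a| r. -/
lemma add_smul_posSemidef {N : Matrix (Fin n) (Fin n) ℂ} (hN : N.IsHermitian) {r a b : ℝ}
    (h : ∀ v : Fin n → ℂ, ‖star v ⬝ᵥ N.mulVec v‖ ≤ r * ‖star v ⬝ᵥ v‖) (hab : |a| * r ≤ b) :
    ((b : ℂ) • (1 : Matrix (Fin n) (Fin n) ℂ) + (a : ℂ) • N).PosSemidef := by
  have hH : ((b : ℂ) • (1 : Matrix (Fin n) (Fin n) ℂ) + (a : ℂ) • N).IsHermitian := by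
    rw [IsHermitian, conjTranspose_add, conjTranspose_smul, conjTranspose_smul,
      conjTranspose_one, hN.eq]
    simp
  refine PosSemidef.of_dotProduct_mulVec_nonneg hH fun v => ?_
  have h1 : star v ⬝ᵥ ((b : ℂ) • (1 : Matrix (Fin n) (Fin n) ℂ) + (a : ℂ) • N).mulVec v
      = (b : ℂ) * (star v ⬝ᵥ v) + (a : ℂ) * (star v ⬝ᵥ N.mulVec v) := by
    rw [add_mulVec, smul_mulVec, smul_mulVec, one_mulVec, dotProduct_add, dotProduct_smul,
      dotProduct_smul, smul_eq_mul, smul_eq_mul]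
  have h2 : (0 : ℂ) ≤ star v ⬝ᵥ v := dotProduct_star_self_nonneg v
  obtain ⟨y, hy⟩ : ∃ y : ℝ, star v ⬝ᵥ v = y :=
    ⟨_, (Complex.ext rfl (Complex.le_def.1 h2).2.symm : star v ⬝ᵥ v = ((star v ⬝ᵥ v).re : ℂ))⟩
  have him : (star v ⬝ᵥ N.mulVec v).im = 0 := hN.im_star_dotProduct_mulVec_self v
  obtain ⟨x, hx⟩ : ∃ x : ℝ, star v ⬝ᵥ N.mulVec v = x :=
    ⟨_, (Complex.ext rfl him : star v ⬝ᵥ N.mulVec v = ((star v ⬝ᵥ N.mulVec v).re : ℂ))⟩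
  have h3 := h v
  rw [hy] at h2 h3
  rw [hx] at h3
  have hy0 : 0 ≤ y := by exact_mod_cast h2
  rw [h1, hx, hy, ← Complex.ofReal_mul, ← Complex.ofReal_mul, ← Complex.ofReal_add]
  have h4 : |x| ≤ r * y := by
    simpa [abs_of_nonneg hy0] using h3
  have h5 : -(|a| * |x|) ≤ a * x := by rw [← abs_mul]; exact neg_abs_le _
  have h6 : |a| * |x| ≤ |a| * (r * y) := mul_le_mul_of_nonneg_left h4 (abs_nonneg a)
  have h7 : |a| * r * y ≤ b * y := mul_le_mul_of_nonneg_right hab hy0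
  have : 0 ≤ b * y + a * x := by linarith
  exact_mod_cast this

/-- If `D ≥ 0` is diagonal and `H` is at most `(1 + r) • 1`, the eigenvalues of `D` with respect
to `H` dominate `D / (1 + r)`. -/
lemma admissible_diag_of_close {c s r : ℝ} (hr : 0 < r)
    {H : Matrix (Fin n) (Fin n) ℂ} (hH : H.PosDef)
    (hle : (((1 + r : ℝ) : ℂ) • (1 : Matrix (Fin n) (Fin n) ℂ) - H).PosSemidef)
    {μ : Fin n → ℝ} (hμ : ∀ j, 0 ≤ μ j)
    (hmem : (fun j => μ j / (1 + r) + c + s) ∈ angleSet n (arccot c)) :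
    Admissible (arccot c) H ((diagonal fun j => (μ j : ℂ)) + ((c + s : ℝ) : ℂ) • H) := by
  have hr1 : 0 < 1 + r := by linarith
  have hθ := arccot_lt_pi c
  have hDH : (diagonal fun j => (μ j : ℂ)).IsHermitian := by
    rw [IsHermitian, diagonal_conjTranspose]; congr 1; ext j; simp
  let E : Matrix (Fin n) (Fin n) ℂ := diagonal fun j => ((√(μ j) : ℝ) : ℂ)
  have hE : Eᴴ = E := by
    simp only [E, diagonal_conjTranspose]; congr 1; ext j; simp
  have hEE : E * E = diagonal fun j => (μ j : ℂ) := by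
    simp only [E, diagonal_mul_diagonal]; congr 1; ext j
    rw [← Complex.ofReal_mul, Real.mul_self_sqrt (hμ j)]
  have hu := hH.isUnit
  have hHi : H⁻¹ * H = 1 := nonsing_inv_mul _ ((isUnit_iff_isUnit_det _).1 hu)
  set t : ℝ := (1 + r)⁻¹ with ht
  have ht0 : 0 < t := inv_pos.2 hr1
  have hinv : (H⁻¹ - (t : ℂ) • (1 : Matrix (Fin n) (Fin n) ℂ)).PosSemidef := by
    have hK : (H⁻¹ - (t : ℂ) • (1 : Matrix (Fin n) (Fin n) ℂ)).IsHermitian := by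
      rw [IsHermitian, conjTranspose_sub, conjTranspose_smul, conjTranspose_one, hH.inv.1.eq]
      simp
    -- With t (1 + r) = 1 this is the identity H⁻¹ - t = (H⁻¹ - t) H (H⁻¹ - t) + t² (1 + r - H), a
    -- sum of two nonnegative terms. It proves that inversion reverses the order.
    have e : H⁻¹ - (t : ℂ) • (1 : Matrix (Fin n) (Fin n) ℂ) =
        (H⁻¹ - (t : ℂ) • (1 : Matrix (Fin n) (Fin n) ℂ))ᴴ * H *
          (H⁻¹ - (t : ℂ) • (1 : Matrix (Fin n) (Fin n) ℂ)) +
        ((t * t : ℝ) : ℂ) • (((1 + r : ℝ) : ℂ) • (1 : Matrix (Fin n) (Fin n) ℂ) - H) := by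
      have htr : t * t * (1 + r) = t := by rw [ht]; field_simp
      have hHi' : H * H⁻¹ = 1 := mul_eq_one_comm.1 hHi
      rw [hK.eq, Matrix.sub_mul, hHi, Matrix.mul_sub, Matrix.sub_mul, Matrix.one_mul, smul_sub,
        smul_smul, ← Complex.ofReal_mul, htr, Matrix.smul_mul, Matrix.one_mul, Matrix.smul_mul,
        hHi', Matrix.sub_mul, Matrix.mul_smul, Matrix.mul_smul, Matrix.mul_one]
      simp only [Matrix.mul_one, Complex.ofReal_mul]
      module
    rw [e]
    refine PosSemidef.add (hH.posSemidef.conjTranspose_mul_mul_same _) (hle.smul ?_)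
    exact_mod_cast (mul_pos ht0 ht0).le
  set M := E * H⁻¹ * E with hM
  have hMH : M.IsHermitian := by
    have := isHermitian_conjTranspose_mul_mul E hH.inv.1
    rwa [hE] at this
  obtain ⟨V, ν, hV, hVM⟩ := exists_frame PosDef.one hMH
  obtain ⟨S, d, hSH, hSD⟩ := exists_frame hH hDH
  have hadd : ∀ {S N Q : Matrix (Fin n) (Fin n) ℂ} {d : Fin n → ℝ} (a : ℝ), Sᴴ * N * S = 1 →
      Sᴴ * Q * S = diagonal (fun j => (d j : ℂ)) →
      Sᴴ * (Q + (a : ℂ) • N) * S = diagonal fun j => ((d j + a : ℝ) : ℂ) := by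
    intro S N Q d a h1 h2
    rw [Matrix.mul_add, Matrix.add_mul, h2, Matrix.mul_smul, Matrix.smul_mul, h1,
      ← diagonal_one, ← diagonal_smul, diagonal_add]
    congr 1; ext j; simp
  -- H⁻¹ D and the Hermitian matrix √D H⁻¹ √D have the same characteristic polynomial, and the
  -- latter dominates D / (1 + r).
  have heigs : Finset.univ.val.map d = Finset.univ.val.map ν := by
    rw [← eigs_eq_of_frame hSH hSD, ← eigs_eq_of_frame hV hVM, eigs, eigs, inv_one,
      Matrix.one_mul, ← hEE, ← Matrix.mul_assoc, charpoly_mul_comm, hM, Matrix.mul_assoc]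
  refine ⟨S, fun j => d j + (c + s), hSH, hadd _ hSH hSD, ?_⟩
  have hν : (fun j => ν j + (c + s)) ∈ angleSet n (arccot c) := by
    have hbase : Admissible (arccot c) (1 : Matrix (Fin n) (Fin n) ℂ)
        (diagonal fun j => ((μ j / (1 + r) + c + s : ℝ) : ℂ)) :=
      ⟨1, _, by simp, by simp, hmem⟩
    have hMs : (M + ((c + s : ℝ) : ℂ) • (1 : Matrix (Fin n) (Fin n) ℂ)).IsHermitian := by
      rw [IsHermitian, conjTranspose_add, conjTranspose_smul, conjTranspose_one, hMH.eq]
      simp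
    have hadm := hbase.mono hθ PosDef.one hMs (by
      have e : M + ((c + s : ℝ) : ℂ) • (1 : Matrix (Fin n) (Fin n) ℂ)
          - (diagonal fun j => ((μ j / (1 + r) + c + s : ℝ) : ℂ))
          = Eᴴ * (H⁻¹ - (t : ℂ) • (1 : Matrix (Fin n) (Fin n) ℂ)) * E := by
        have e2 : (diagonal fun j => ((μ j / (1 + r) + c + s : ℝ) : ℂ)) =
            (t : ℂ) • (diagonal fun j => (μ j : ℂ)) +
              ((c + s : ℝ) : ℂ) • (1 : Matrix (Fin n) (Fin n) ℂ) := by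
          rw [← diagonal_one, ← diagonal_smul, ← diagonal_smul, diagonal_add]
          congr 1; ext j
          simp only [Pi.smul_apply, smul_eq_mul, ht]
          push_cast
          ring
        rw [e2, hE, Matrix.mul_sub, Matrix.sub_mul, Matrix.mul_smul, Matrix.smul_mul,
          Matrix.mul_one, hEE, ← hM]
        abel
      rw [e]
      exact hinv.conjTranspose_mul_mul_same E)
    have := hadm.diag_mem hθ isHermitian_one hV
    rw [hadd (c + s) hV hVM] at this
    simpa using this
  rw [mem_angleSet_iff_multiset] at hν ⊢
  have : ∀ x : Fin n → ℝ, Finset.univ.val.map (fun j => x j + (c + s)) =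
      (Finset.univ.val.map x).map (fun y => y + (c + s)) := fun x => by
    rw [Multiset.map_map]; rfl
  rw [this, heigs, ← this]
  exact hν

/-- Admissibility of `A` for `G` implies admissibility of `A + ε G` for all `H` close to `G`,
uniformly in `A` and `G`. -/
lemma exists_admissible_of_closeTo (hn : 2 ≤ n) {θ : ℝ} (h0 : 0 < θ) (hθ : θ < Real.pi)
    {ε : ℝ} (hε : 0 < ε) : ∃ r, 0 < r ∧ ∀ G H A : Matrix (Fin n) (Fin n) ℂ, G.PosDef → H.PosDef →
      CloseTo H G r → Admissible θ G A → Admissible θ H (A + (ε : ℂ) • G) := by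
  obtain ⟨c, rfl⟩ := exists_arccot_eq h0 hθ
  have hs : 0 < ε / 2 := by linarith
  obtain ⟨r₀, hr₀, hcon⟩ := exists_contraction_angleSet hn c hs
  -- One half of ε pays for dividing the eigenvalues by 1 + r, the other half for the error (c + ε /
  -- 2)(H' - 1) made on replacing the identity by H'.
  refine ⟨min r₀ (ε / 2 / (|c + ε / 2| + 1)), by positivity, ?_⟩
  set r := min r₀ (ε / 2 / (|c + ε / 2| + 1)) with hr
  have hr0 : 0 < r := by rw [hr]; positivity
  have hr2 : |c + ε / 2| * r ≤ ε / 2 := by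
    have h1 : r * (|c + ε / 2| + 1) ≤ ε / 2 :=
      (le_div_iff₀ (by positivity)).1 (min_le_right _ _)
    nlinarith
  intro G H A hG hH hclose hadm
  obtain ⟨T, d, hTG, hTA, hd⟩ := hadm
  have hTinj : Function.Injective T.mulVec := by
    rw [mulVec_injective_iff_isUnit]
    exact IsUnit.of_mul_eq_one_right _ hTG
  set H' := Tᴴ * H * T with hH'
  have hH'P : H'.PosDef := hH.conjTranspose_mul_mul_same hTinj
  have hN : (H' - 1).IsHermitian := hH'P.1.sub isHermitian_one
  have hclose' : ∀ v : Fin n → ℂ, ‖star v ⬝ᵥ (H' - 1).mulVec v‖ ≤ r * ‖star v ⬝ᵥ v‖ := by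
    intro v
    have htr : ∀ N : Matrix (Fin n) (Fin n) ℂ, star v ⬝ᵥ (Tᴴ * N * T).mulVec v =
        star (T.mulVec v) ⬝ᵥ N.mulVec (T.mulVec v) := by
      intro N
      simp only [star_mulVec, dotProduct_mulVec, vecMul_vecMul, ← mulVec_mulVec]
    have := hclose (T.mulVec v)
    rw [← htr, ← htr, hTG, one_mulVec, Matrix.mul_sub, Matrix.sub_mul, hTG] at this
    exact this
  have hle : (((1 + r : ℝ) : ℂ) • (1 : Matrix (Fin n) (Fin n) ℂ) - H').PosSemidef := by
    have := add_smul_posSemidef (a := -1) (b := r) hN hclose' (by simp)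
    convert this using 1
    push_cast
    module
  -- Splitting off c makes the diagonal part nonnegative, so that it has a square root; the lower
  -- bound c on each entry uses that some other index can be left out.
  have hlow : ∀ j, 0 ≤ d j - c := fun j => sub_nonneg.2 (le_of_mem_angleSet hn hd j)
  have h1 := admissible_diag_of_close (c := c) (s := ε / 2) hr0 hH'P hle hlow
    (hcon r hr0 (min_le_left _ _) _ hlow (by simpa using hd))
  have hBH : ((diagonal fun j => (d j : ℂ)) + (ε : ℂ) • (1 : Matrix (Fin n) (Fin n) ℂ)).IsHermitian := by
    rw [IsHermitian, conjTranspose_add, conjTranspose_smul, conjTranspose_one,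
      diagonal_conjTranspose]
    congr 1
    · congr 1; ext j; simp
    · simp
  have h2 := h1.mono hθ hH'P hBH (by
    have := add_smul_posSemidef (a := -(c + ε / 2)) (b := ε / 2) hN hclose'
      (by rwa [abs_neg])
    convert this using 1
    have e : (diagonal fun j => ((d j - c : ℝ) : ℂ)) =
        (diagonal fun j => (d j : ℂ)) - (c : ℂ) • (1 : Matrix (Fin n) (Fin n) ℂ) := by
      rw [← diagonal_one, ← diagonal_smul, diagonal_sub]
      congr 1; ext j; simp
    rw [e]
    push_cast
    module)
  obtain ⟨S, f, hS, hSA, hf⟩ := h2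
  refine ⟨T * S, f, ?_, ?_, hf⟩
  · rw [← hS, hH']; simp only [conjTranspose_mul, Matrix.mul_assoc]
  · rw [← hSA, ← hTA, ← hTG]
    simp only [conjTranspose_mul, Matrix.mul_assoc, Matrix.mul_add, Matrix.add_mul,
      Matrix.mul_smul, Matrix.smul_mul]

end Stability

/-! ### The resolvent of a constant coefficient sum of squares -/

section Resolvent

open SchwartzMap LineDeriv
open scoped FourierTransform

variable {E : Type*} [NormedAddCommGroup E] [InnerProductSpace ℝ E] {ι : Type*} [Fintype ι]

/-- The operator `∑ i, ∂²/∂(m i)²` on Schwartz functions. -/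
def schwartzSumSq {F : Type*} [NormedAddCommGroup F] [NormedSpace ℝ F] (m : ι → E)
    (f : 𝓢(E, F)) : 𝓢(E, F) :=
  ∑ i, ∂_{m i} (∂_{m i} f)

/-- The operator `∑ i, ∂²/∂(m i)²` on functions. -/
def sumSq {E : Type*} [NormedAddCommGroup E] [NormedSpace ℝ E] (m : ι → E) (q : E → ℝ) (x : E) :
    ℝ :=
  ∑ i, fderiv ℝ (fderiv ℝ q) x (m i) (m i)

lemma schwartzSumSq_apply (m : ι → E) (f : 𝓢(E, ℝ)) (x : E) :
    schwartzSumSq m f x = sumSq m f x := by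
  simp only [schwartzSumSq, sumSq, _root_.sum_apply]
  refine Finset.sum_congr rfl fun i _ => ?_
  have h : ∀ y, (∂_{m i} f : 𝓢(E, ℝ)) y = fderiv ℝ f y (m i) := fun y => lineDerivOp_apply_eq_fderiv _ _ _
  rw [lineDerivOp_apply_eq_fderiv, show (⇑(∂_{m i} f : 𝓢(E, ℝ)) : E → ℝ) = fun y => fderiv ℝ f y (m i) from
    funext h]
  have hd : DifferentiableAt ℝ (fderiv ℝ f) x :=
    (((f.smooth 2).fderiv_right (m := 1) (by norm_num)).differentiable (by norm_num)) x
  rw [fderiv_clm_apply hd (differentiableAt_const _)]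
  simp

/-- The symbol is (1 + ‖·‖²)⁻¹ composed with the linear map ξ ↦ √τ (⟨ξ, m i⟩)ᵢ. The vectors m i need
not span, so degenerate operators are included. -/
lemma hasTemperateGrowth_resolvent (m : ι → E) {τ : ℝ} (hτ : 0 ≤ τ) :
    (fun ξ : E => (1 + τ * ∑ i, (inner ℝ ξ (m i)) ^ 2)⁻¹).HasTemperateGrowth := by
  let T : E →L[ℝ] EuclideanSpace ℝ ι :=
    (√τ) • ((EuclideanSpace.equiv ι ℝ).symm.toContinuousLinearMap ∘L
      ContinuousLinearMap.pi fun i => innerSL ℝ (m i))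
  have h := (Function.hasTemperateGrowth_one_add_norm_sq_rpow (EuclideanSpace ℝ ι) (-1)).comp
    T.hasTemperateGrowth
  convert! h using 1
  ext ξ
  have : ‖T ξ‖ ^ 2 = τ * ∑ i, (inner ℝ ξ (m i)) ^ 2 := by
    rw [EuclideanSpace.norm_sq_eq, Finset.mul_sum]
    refine Finset.sum_congr rfl fun i _ => ?_
    have : (T ξ) i = √τ * inner ℝ (m i) ξ := rfl
    rw [this, norm_mul, mul_pow, Real.norm_eq_abs, Real.norm_eq_abs, sq_abs, sq_abs,
      Real.sq_sqrt hτ, real_inner_comm]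
  simp only [Function.comp_apply]
  rw [this, Real.rpow_neg_one]

lemma schwartzSumSq_re (m : ι → E) (h : 𝓢(E, ℂ)) :
    schwartzSumSq m (h.postcompCLM Complex.reCLM) =
      (schwartzSumSq m h).postcompCLM Complex.reCLM := by
  have key : ∀ (v : E) (g : 𝓢(E, ℂ)), ∂_{v} (g.postcompCLM Complex.reCLM) =
      (∂_{v} g).postcompCLM Complex.reCLM := by
    intro v g
    ext x
    rw [lineDerivOp_apply_eq_fderiv, postcompCLM_apply, lineDerivOp_apply_eq_fderiv]
    have : (⇑(g.postcompCLM Complex.reCLM) : E → ℝ) = Complex.reCLM ∘ g := rfl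
    rw [this, (Complex.reCLM.hasFDerivAt.comp x (g.hasFDerivAt x)).fderiv]
    rfl
  simp only [schwartzSumSq, map_sum, key]

variable [FiniteDimensional ℝ E] [MeasurableSpace E] [BorelSpace E]

/-- On the Fourier side 1 - τ L is multiplication by 1 + τ (2π)² ∑ ⟨ξ, m i⟩² ≥ 1, and the reciprocal
is a multiplier of Schwartz functions. -/
lemma exists_resolvent_complex (m : ι → E) {τ : ℝ} (hτ : 0 ≤ τ) (f : 𝓢(E, ℂ)) :
    ∃ h : 𝓢(E, ℂ), h - (τ : ℂ) • schwartzSumSq m h = f := by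
  set σ : ℝ := τ * (2 * Real.pi) ^ 2 with hσ
  have hσ0 : 0 ≤ σ := by positivity
  have hR := hasTemperateGrowth_resolvent m hσ0
  have hQ : (fun ξ : E => ∑ i, (inner ℝ ξ (m i)) ^ 2).HasTemperateGrowth := by fun_prop
  have hQ' : ∀ i ∈ (Finset.univ : Finset ι),
    (fun ξ : E => (inner ℝ ξ (m i)) ^ 2).HasTemperateGrowth := by fun_prop
  refine ⟨fourierMultiplierCLM ℂ (fun ξ : E => (1 + σ * ∑ i, (inner ℝ ξ (m i)) ^ 2)⁻¹) f, ?_⟩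
  set h := fourierMultiplierCLM ℂ (fun ξ : E => (1 + σ * ∑ i, (inner ℝ ξ (m i)) ^ 2)⁻¹) f with hh
  have hL : schwartzSumSq m h =
      -(2 * Real.pi) ^ 2 • fourierMultiplierCLM ℂ (fun ξ : E => ∑ i, (inner ℝ ξ (m i)) ^ 2) h := by
    rw [fourierMultiplierCLM_sum ℂ hQ', schwartzSumSq, _root_.sum_apply, Finset.smul_sum]
    refine Finset.sum_congr rfl fun i _ => ?_
    simp_rw [lineDeriv_eq_fourierMultiplierCLM]
    rw [← fourierMultiplierCLM_ofReal ℂ (by fun_prop)]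
    simp_rw [map_smul, smul_smul]
    rw [fourierMultiplierCLM_ofReal ℂ (by fun_prop),
      fourierMultiplierCLM_fourierMultiplierCLM_apply (by fun_prop) (by fun_prop)]
    have e : (inner ℝ · (m i) : E → ℝ) * (inner ℝ · (m i)) = fun ξ : E => (inner ℝ ξ (m i)) ^ 2 := by
      ext ξ; simp [sq]
    rw [e, ← Complex.coe_smul (-(2 * Real.pi) ^ 2)]
    congr 1
    push_cast
    ring_nf
    simp
  have h1 : h = fourierMultiplierCLM ℂ (fun _ : E => (1 : ℝ)) h := by simp
  have hsum : h + σ • fourierMultiplierCLM ℂ (fun ξ : E => ∑ i, (inner ℝ ξ (m i)) ^ 2) h = f := by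
    have hσQ : (fun ξ : E => σ * ∑ i, (inner ℝ ξ (m i)) ^ 2).HasTemperateGrowth := by fun_prop
    have e1 : σ • fourierMultiplierCLM ℂ (fun ξ : E => ∑ i, (inner ℝ ξ (m i)) ^ 2) h
        = fourierMultiplierCLM ℂ (fun ξ : E => σ * ∑ i, (inner ℝ ξ (m i)) ^ 2) h := by
      have := fourierMultiplierCLM_smul (F := ℂ) hQ σ
      rw [← _root_.smul_apply, ← this]
      rfl
    rw [e1]
    have e2 : ∀ g : E → ℝ, g.HasTemperateGrowth → fourierMultiplierCLM ℂ g h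
        = fourierMultiplierCLM ℂ
          (g * fun ξ : E => (1 + σ * ∑ i, (inner ℝ ξ (m i)) ^ 2)⁻¹) f := fun g hg =>
      fourierMultiplierCLM_fourierMultiplierCLM_apply hg hR f
    rw [e2 _ hσQ, hh]
    -- Additivity in the symbol, in its version for finite sums, is applied to two symbols whose sum
    -- is 1.
    have e3 := fourierMultiplierCLM_sum ℂ (s := (Finset.univ : Finset (Fin 2)))
      (g := ![fun ξ : E => (1 + σ * ∑ i, (inner ℝ ξ (m i)) ^ 2)⁻¹,
        (fun ξ : E => σ * ∑ i, (inner ℝ ξ (m i)) ^ 2) *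
          fun ξ : E => (1 + σ * ∑ i, (inner ℝ ξ (m i)) ^ 2)⁻¹]) (by
        intro i _
        fin_cases i
        · exact hR
        · exact hσQ.mul hR)
    rw [Fin.sum_univ_two] at e3
    have e4 := congrArg (fun T : 𝓢(E, ℂ) →L[ℝ] 𝓢(E, ℂ) => T f) e3
    simp only [Fin.sum_univ_two] at e4
    refine e4.symm.trans ?_
    have e5 : (fun ξ : E => (![fun ξ : E => (1 + σ * ∑ i, (inner ℝ ξ (m i)) ^ 2)⁻¹,
        (fun ξ : E => σ * ∑ i, (inner ℝ ξ (m i)) ^ 2) *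
          fun ξ : E => (1 + σ * ∑ i, (inner ℝ ξ (m i)) ^ 2)⁻¹] 0 ξ : ℝ) +
        (![fun ξ : E => (1 + σ * ∑ i, (inner ℝ ξ (m i)) ^ 2)⁻¹,
        (fun ξ : E => σ * ∑ i, (inner ℝ ξ (m i)) ^ 2) *
          fun ξ : E => (1 + σ * ∑ i, (inner ℝ ξ (m i)) ^ 2)⁻¹] 1 ξ : ℝ)) = fun _ => (1 : ℝ) := by
      ext ξ
      have : (0 : ℝ) < 1 + σ * ∑ i, (inner ℝ ξ (m i)) ^ 2 := by positivity
      simp only [Matrix.cons_val_zero, Matrix.cons_val_one, Pi.mul_apply]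
      field_simp
    rw [e5]
    simp
  rw [hL]
  rw [← hsum]
  conv_rhs => rw [hσ]
  rw [sub_eq_add_neg]
  congr 1
  rw [← Complex.coe_smul (-(2 * Real.pi) ^ 2), smul_smul, ← neg_smul, ← Complex.coe_smul]
  congr 1
  push_cast
  ring

/-- Solvability of `h - τ ∑ i, ∂²h/∂(m i)² = f`. -/
lemma exists_resolvent (m : ι → E) {τ : ℝ} (hτ : 0 ≤ τ) (f : 𝓢(E, ℝ)) :
    ∃ h : 𝓢(E, ℝ), ∀ x, h x - τ * sumSq m h x = f x := by
  obtain ⟨h, hh⟩ := exists_resolvent_complex m hτ (f.postcompCLM Complex.ofRealCLM)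
  refine ⟨h.postcompCLM Complex.reCLM, fun x => ?_⟩
  rw [← schwartzSumSq_apply, schwartzSumSq_re]
  have := congrArg (fun g : 𝓢(E, ℂ) => (g x).re) hh
  simpa using this

end Resolvent

/-! ### Second derivatives -/

section SecondDerivative

variable {E : Type*} [NormedAddCommGroup E] [NormedSpace ℝ E] {ι : Type*} [Fintype ι]

lemma _root_.ContDiffAt.eventually_differentiableAt_of_two {f : E → ℝ} {x : E}
    (hf : ContDiffAt ℝ 2 f x) : ∀ᶠ y in 𝓝 x, DifferentiableAt ℝ f y :=
  (hf.eventually (by simp)).mono fun _ h => h.differentiableAt (by simp)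

lemma _root_.ContDiffAt.differentiableAt_fderiv_of_two {f : E → ℝ} {x : E}
    (hf : ContDiffAt ℝ 2 f x) : DifferentiableAt ℝ (fderiv ℝ f) x :=
  (hf.fderiv_right (m := 1) (by norm_num)).differentiableAt (by simp)

lemma sumSq_congr {m : ι → E} {f g : E → ℝ} {x : E} (h : f =ᶠ[𝓝 x] g) :
    sumSq m f x = sumSq m g x := by
  rw [sumSq, sumSq, (h.fderiv (𝕜 := ℝ)).fderiv_eq]

lemma fderiv_fderiv_add {f g : E → ℝ} {x : E} (hf : ContDiffAt ℝ 2 f x)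
    (hg : ContDiffAt ℝ 2 g x) :
    fderiv ℝ (fderiv ℝ (f + g)) x = fderiv ℝ (fderiv ℝ f) x + fderiv ℝ (fderiv ℝ g) x := by
  have h : fderiv ℝ (f + g) =ᶠ[𝓝 x] fderiv ℝ f + fderiv ℝ g := by
    filter_upwards [hf.eventually_differentiableAt_of_two, hg.eventually_differentiableAt_of_two]
      with y h1 h2
    exact fderiv_add h1 h2
  rw [h.fderiv_eq, fderiv_add hf.differentiableAt_fderiv_of_two hg.differentiableAt_fderiv_of_two]

lemma fderiv_fderiv_const_smul {f : E → ℝ} {x : E} (hf : ContDiffAt ℝ 2 f x) (c : ℝ) :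
    fderiv ℝ (fderiv ℝ (c • f)) x = c • fderiv ℝ (fderiv ℝ f) x := by
  have h : fderiv ℝ (c • f) =ᶠ[𝓝 x] c • fderiv ℝ f := by
    filter_upwards [hf.eventually_differentiableAt_of_two] with y h1
    exact fderiv_const_smul h1 c
  rw [h.fderiv_eq, fderiv_const_smul hf.differentiableAt_fderiv_of_two]

lemma sumSq_add {m : ι → E} {f g : E → ℝ} {x : E} (hf : ContDiffAt ℝ 2 f x)
    (hg : ContDiffAt ℝ 2 g x) : sumSq m (f + g) x = sumSq m f x + sumSq m g x := by
  simp [sumSq, fderiv_fderiv_add hf hg, Finset.sum_add_distrib]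

lemma sumSq_const_smul {m : ι → E} {f : E → ℝ} {x : E} (hf : ContDiffAt ℝ 2 f x) (c : ℝ) :
    sumSq m (c • f) x = c * sumSq m f x := by
  simp [sumSq, fderiv_fderiv_const_smul hf c, Finset.mul_sum]

lemma sumSq_add_const {m : ι → E} {f : E → ℝ} {x : E} (c : ℝ) :
    sumSq m (fun y => f y + c) x = sumSq m f x := by
  have : fderiv ℝ (fun y => f y + c) = fderiv ℝ f := by
    ext1 y; rw [fderiv_add_const]
  rw [sumSq, this, sumSq]

/-- The second derivative is nonnegative at a local minimum. -/
lemma _root_.IsLocalMin.fderiv_fderiv_nonneg {f : E → ℝ} {x : E} (h : IsLocalMin f x)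
    (hf : ContDiffAt ℝ 2 f x) (v : E) : 0 ≤ fderiv ℝ (fderiv ℝ f) x v v := by
  set g : ℝ → ℝ := fun t => f (x + t • v) with hg
  have hline : ∀ t : ℝ, HasDerivAt (fun t : ℝ => x + t • v) v t := fun t => by
    simpa using ((hasDerivAt_id t).smul_const v).const_add x
  have hcont : Filter.Tendsto (fun t : ℝ => x + t • v) (𝓝 0) (𝓝 x) := by
    have : Continuous fun t : ℝ => x + t • v := by fun_prop
    simpa using this.tendsto 0
  have hd : ∀ᶠ t in 𝓝 (0 : ℝ), HasDerivAt g (fderiv ℝ f (x + t • v) v) t := by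
    filter_upwards [hcont.eventually hf.eventually_differentiableAt_of_two] with t ht
    exact ht.hasFDerivAt.comp_hasDerivAt t (hline t)
  have hdg : deriv g =ᶠ[𝓝 0] fun t => fderiv ℝ f (x + t • v) v := hd.mono fun t ht => ht.deriv
  have hdd : deriv (deriv g) 0 = fderiv ℝ (fderiv ℝ f) x v v := by
    rw [hdg.deriv_eq]
    have h1 : HasFDerivAt (fderiv ℝ f) (fderiv ℝ (fderiv ℝ f) x) (x + (0 : ℝ) • v) := by
      simpa using hf.differentiableAt_fderiv_of_two.hasFDerivAt
    have h2 : HasDerivAt (fun t : ℝ => fderiv ℝ f (x + t • v)) (fderiv ℝ (fderiv ℝ f) x v) 0 :=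
      h1.comp_hasDerivAt (0 : ℝ) (hline 0)
    have h3 : HasDerivAt (fun t : ℝ => fderiv ℝ f (x + t • v) v)
        (fderiv ℝ (fderiv ℝ f) x v v) 0 :=
      (ContinuousLinearMap.apply ℝ ℝ v).hasFDerivAt.comp_hasDerivAt (0 : ℝ) h2
    exact h3.deriv
  have hmin : IsLocalMin g 0 := by
    have := hcont.eventually h
    filter_upwards [this] with t ht
    simpa [hg] using ht
  -- A negative second derivative would make the minimum a local maximum as well; g would be
  -- constant near 0 and its second derivative zero.
  by_contra! hneg
  rw [← hdd] at hneg
  have hmax := isLocalMax_of_deriv_deriv_neg hneg hmin.deriv_eq_zero hd.self_of_nhds.continuousAt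
  have hconst : g =ᶠ[𝓝 0] fun _ => g 0 := by
    filter_upwards [hmin, hmax] with t h1 h2 using le_antisymm h2 h1
  have h0 : deriv g =ᶠ[𝓝 0] fun _ => (0 : ℝ) := by
    have := hconst.deriv
    simpa using this
  rw [h0.deriv_eq] at hneg
  simp at hneg

lemma _root_.IsLocalMin.sumSq_nonneg {f : E → ℝ} {x : E} (h : IsLocalMin f x)
    (hf : ContDiffAt ℝ 2 f x) (m : ι → E) : 0 ≤ sumSq m f x :=
  Finset.sum_nonneg fun i _ => h.fderiv_fderiv_nonneg hf (m i)

end SecondDerivative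

/-! ### Properties of the resolvent -/

section Resolvent

open SchwartzMap LineDeriv

variable {E : Type*} [NormedAddCommGroup E] [InnerProductSpace ℝ E] {ι : Type*} [Fintype ι]

lemma _root_.SchwartzMap.contDiffAt_two (f : 𝓢(E, ℝ)) (x : E) : ContDiffAt ℝ 2 f x :=
  (f.smooth 2).contDiffAt

lemma _root_.SchwartzMap.exists_abs_le (f : 𝓢(E, ℝ)) : ∃ C, 0 ≤ C ∧ ∀ x, |f x| ≤ C := by
  obtain ⟨C, hC, h⟩ := f.decay 0 0
  exact ⟨C, hC.le, fun x => by simpa using h x⟩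

lemma schwartz_sumSq_add (m : ι → E) (f g : 𝓢(E, ℝ)) (x : E) :
    sumSq m (f + g : 𝓢(E, ℝ)) x = sumSq m f x + sumSq m g x :=
  sumSq_add (f.contDiffAt_two x) (g.contDiffAt_two x)

lemma schwartz_sumSq_smul (m : ι → E) (c : ℝ) (f : 𝓢(E, ℝ)) (x : E) :
    sumSq m (c • f : 𝓢(E, ℝ)) x = c * sumSq m f x :=
  sumSq_const_smul (f.contDiffAt_two x) c

variable [FiniteDimensional ℝ E]

/-- The maximum principle. -/
lemma resolvent_le {m : ι → E} {τ : ℝ} (hτ : 0 ≤ τ) {f h : 𝓢(E, ℝ)}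
    (hh : ∀ x, h x - τ * sumSq m h x = f x) {c : ℝ} (hc : 0 ≤ c) (hf : ∀ x, f x ≤ c) (x : E) :
    h x ≤ c := by
  by_contra! hx
  -- As h tends to 0 at infinity and c ≥ 0, a value above c forces a global maximum, where L h ≤ 0.
  have h1 : ∀ᶠ y in Filter.cocompact E, h y ≤ h x :=
    (h.tendsto_cocompact.eventually (gt_mem_nhds (hc.trans_lt hx))).mono fun y hy => hy.le
  obtain ⟨y, hy⟩ := h.continuous.exists_forall_ge' x h1
  have hmin : IsLocalMin ((-1 : ℝ) • h : 𝓢(E, ℝ)) y := Filter.Eventually.of_forall fun z => by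
    simpa using hy z
  have h2 := hmin.sumSq_nonneg (SchwartzMap.contDiffAt_two _ y) m
  rw [schwartz_sumSq_smul] at h2
  have h3 := hh y
  have h4 := hf y
  have h5 := hy x
  nlinarith [mul_nonneg hτ (neg_one_mul (sumSq m h y) ▸ h2)]

lemma resolvent_nonneg {m : ι → E} {τ : ℝ} (hτ : 0 ≤ τ) {f h : 𝓢(E, ℝ)}
    (hh : ∀ x, h x - τ * sumSq m h x = f x) (hf : ∀ x, 0 ≤ f x) (x : E) : 0 ≤ h x := by
  have := resolvent_le (f := (-1 : ℝ) • f) (h := (-1 : ℝ) • h) (m := m) hτ (fun x => by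
    rw [schwartz_sumSq_smul, _root_.smul_apply, _root_.smul_apply, ← hh x]
    simp only [smul_eq_mul]; ring) le_rfl (fun x => by simpa using hf x) x
  simpa using this

lemma resolvent_mono {m : ι → E} {τ : ℝ} (hτ : 0 ≤ τ) {f f' h h' : 𝓢(E, ℝ)}
    (hh : ∀ x, h x - τ * sumSq m h x = f x) (hh' : ∀ x, h' x - τ * sumSq m h' x = f' x)
    (hf : ∀ x, f x ≤ f' x) (x : E) : h x ≤ h' x := by
  have := resolvent_nonneg (f := f' + (-1 : ℝ) • f) (h := h' + (-1 : ℝ) • h) (m := m) hτ (fun x => by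
    rw [schwartz_sumSq_add, schwartz_sumSq_smul]
    simp only [_root_.add_apply, _root_.smul_apply, ← hh x, ← hh' x, smul_eq_mul]
    ring) (fun x => by simpa using hf x) x
  simpa using this

variable [MeasurableSpace E] [BorelSpace E]

/-- The resolvent of `f` is `f + τ L f + O(τ²)`, uniformly. -/
lemma exists_resolvent_expansion (m : ι → E) (f : 𝓢(E, ℝ)) :
    ∃ C, 0 ≤ C ∧ ∀ τ, 0 ≤ τ → ∃ h : 𝓢(E, ℝ), (∀ x, h x - τ * sumSq m h x = f x) ∧
      ∀ x, |h x - f x - τ * sumSq m f x| ≤ τ ^ 2 * C := by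
  set g := schwartzSumSq m f with hg
  set k := schwartzSumSq m g with hk
  obtain ⟨C, hC, hkC⟩ := k.exists_abs_le
  refine ⟨C, hC, fun τ hτ => ?_⟩
  -- If z is the resolvent of L² f, then f + τ L f + τ² z is exactly the resolvent of f, and the
  -- maximum principle bounds z by the supremum of |L² f|.
  obtain ⟨z, hz⟩ := exists_resolvent m hτ k
  have hz1 : ∀ x, z x ≤ C := resolvent_le hτ hz hC fun x => (le_abs_self _).trans (hkC x)
  have hz2 : ∀ x, -z x ≤ C := by
    have := resolvent_le (f := (-1 : ℝ) • k) (h := (-1 : ℝ) • z) (m := m) hτ (fun x => by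
      rw [schwartz_sumSq_smul, _root_.smul_apply, _root_.smul_apply, ← hz x]
      simp only [smul_eq_mul]; ring) hC
      (fun x => by simpa using (neg_le_abs _).trans (hkC x))
    intro x; simpa using this x
  refine ⟨f + τ • g + τ ^ 2 • z, fun x => ?_, fun x => ?_⟩
  · rw [schwartz_sumSq_add, schwartz_sumSq_add, schwartz_sumSq_smul, schwartz_sumSq_smul,
      ← schwartzSumSq_apply m f, ← schwartzSumSq_apply m g, ← hk, ← hg, ← hz x]
    simp only [_root_.add_apply, _root_.smul_apply, smul_eq_mul]
    ring
  · have : (f + τ • g + τ ^ 2 • z) x - f x - τ * sumSq m f x = τ ^ 2 * z x := by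
      rw [← schwartzSumSq_apply m f, ← hg]
      simp only [_root_.add_apply, _root_.smul_apply, smul_eq_mul]
      ring
    rw [this, abs_mul, abs_of_nonneg (sq_nonneg τ)]
    exact mul_le_mul_of_nonneg_left (abs_le.2 ⟨by linarith [hz2 x], hz1 x⟩) (sq_nonneg τ)

lemma schwartz_integrable_mul (f g : 𝓢(E, ℝ)) {μ : Measure E} [μ.IsAddHaarMeasure] :
    Integrable (fun x => f x * g x) μ := by
  obtain ⟨C, -, hC⟩ := f.exists_abs_le
  exact g.integrable.bdd_mul f.continuous.aestronglyMeasurable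
    (Filter.Eventually.of_forall fun x => hC x)

lemma integral_mul_schwartzSumSq (m : ι → E) (f g : 𝓢(E, ℝ)) {μ : Measure E}
    [μ.IsAddHaarMeasure] :
    ∫ x, f x * schwartzSumSq m g x ∂μ = ∫ x, schwartzSumSq m f x * g x ∂μ := by
  simp only [schwartzSumSq, _root_.sum_apply, Finset.mul_sum, Finset.sum_mul]
  rw [integral_finsetSum _ fun i _ => schwartz_integrable_mul _ _,
    integral_finsetSum _ fun i _ => schwartz_integrable_mul _ _]
  refine Finset.sum_congr rfl fun i _ => ?_
  rw [integral_mul_lineDerivOp_right_eq_neg_left, integral_mul_lineDerivOp_right_eq_neg_left,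
    neg_neg]

/-- The resolvent is symmetric. -/
lemma integral_resolvent_mul {m : ι → E} {τ : ℝ} {f g h k : 𝓢(E, ℝ)}
    (hh : ∀ x, h x - τ * sumSq m h x = f x) (hk : ∀ x, k x - τ * sumSq m k x = g x)
    {μ : Measure E} [μ.IsAddHaarMeasure] :
    ∫ x, h x * g x ∂μ = ∫ x, f x * k x ∂μ := by
  have e1 : ∀ x, h x * g x = h x * k x - τ * (h x * schwartzSumSq m k x) := fun x => by
    rw [← hk x, schwartzSumSq_apply]; ring
  have e2 : ∀ x, f x * k x = h x * k x - τ * (schwartzSumSq m h x * k x) := fun x => by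
    rw [← hh x, schwartzSumSq_apply]; ring
  simp_rw [e1, e2]
  rw [integral_sub (schwartz_integrable_mul _ _) ((schwartz_integrable_mul _ _).const_mul τ),
    integral_sub (schwartz_integrable_mul _ _) ((schwartz_integrable_mul _ _).const_mul τ),
    integral_const_mul, integral_const_mul, integral_mul_schwartzSumSq]

end Resolvent

/-! ### Approximation of upper semicontinuous functions from above -/

section Approximation

variable {E : Type*} [NormedAddCommGroup E] [NormedSpace ℝ E] [FiniteDimensional ℝ E]

/-- A bounded upper semicontinuous function is the limit of its sup-convolutions. -/
lemma exists_lipschitz_approx_of_upperSemicontinuous {E : Type*} [PseudoMetricSpace E]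
    {v : E → ℝ} (hv : UpperSemicontinuous v)
    {C : ℝ} (hC : ∀ x, |v x| ≤ C) :
    ∃ g : ℕ → E → ℝ, (∀ j, Continuous (g j)) ∧ (∀ j x, v x ≤ g j x) ∧ (∀ j x, g j x ≤ C) ∧
      ∀ x, Filter.Tendsto (fun j => g j x) Filter.atTop (𝓝 (v x)) := by
  have hbdd : ∀ (j : ℕ) (x : E), BddAbove (Set.range fun y => v y - j * dist x y) := fun j x =>
    ⟨C, by
      rintro _ ⟨y, rfl⟩
      have := (abs_le.1 (hC y)).2
      have : 0 ≤ (j : ℝ) * dist x y := by positivity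
      simp only
      linarith⟩
  have hle : ∀ (j : ℕ) (x : E), v x ≤ ⨆ y, (v y - j * dist x y) := fun j x => by
    simpa using le_ciSup (hbdd j x) x
  refine ⟨fun j x => ⨆ y, (v y - j * dist x y), fun j => ?_, hle, fun j x => ?_, fun x => ?_⟩
  · refine (LipschitzWith.of_le_add_mul j fun x x' => ?_).continuous
    have : Nonempty E := ⟨x⟩
    refine ciSup_le fun y => ?_
    have h1 := le_ciSup (hbdd j x') y
    have h2 : (j : ℝ) * dist x' y ≤ j * (dist x x' + dist x y) := by
      refine mul_le_mul_of_nonneg_left ?_ (Nat.cast_nonneg j)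
      rw [dist_comm x x']; exact dist_triangle _ _ _
    rw [NNReal.coe_natCast]
    linarith
  · have : Nonempty E := ⟨x⟩
    refine ciSup_le fun y => ?_
    have := (abs_le.1 (hC y)).2
    have : 0 ≤ (j : ℝ) * dist x y := by positivity
    linarith
  · refine tendsto_order.2 ⟨fun a ha => Filter.Eventually.of_forall fun j => ha.trans_le (hle j x),
      fun a ha => ?_⟩
    obtain ⟨b, hb, hba⟩ := exists_between ha
    obtain ⟨s, hs, hsb⟩ := Metric.eventually_nhds_iff.1 (hv x b hb)
    -- Within distance s of x semicontinuity bounds v by b; farther away the penalty N s outweighs C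
    -- - v x.
    obtain ⟨N, hN⟩ := exists_nat_gt ((C - v x) / s)
    filter_upwards [Filter.eventually_ge_atTop N] with j hj
    have : Nonempty E := ⟨x⟩
    refine lt_of_le_of_lt (ciSup_le fun y => ?_) hba
    by_cases hy : dist y x < s
    · have := hsb hy
      have : 0 ≤ (j : ℝ) * dist x y := by positivity
      linarith
    · rw [dist_comm] at hy
      have h1 := (abs_le.1 (hC y)).2
      have h2 : C - v x < N * s := (div_lt_iff₀ hs).1 hN
      have h3 : (N : ℝ) * s ≤ j * dist x y :=
        mul_le_mul (by exact_mod_cast hj) (not_lt.1 hy) hs.le (Nat.cast_nonneg j)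
      linarith

/-- A bounded, compactly supported upper semicontinuous function is a limit of larger smooth
functions with compact support. -/
lemma exists_smooth_approx_of_upperSemicontinuous {v : E → ℝ} (hv : UpperSemicontinuous v)
    {C : ℝ} (hC : ∀ x, |v x| ≤ C) {x₀ : E} {R : ℝ} (hR : 0 < R)
    (hsupp : ∀ x, x ∉ Metric.closedBall x₀ R → v x = 0) :
    ∃ (g : ℕ → E → ℝ) (C' : ℝ), (∀ j, ContDiff ℝ ∞ (g j)) ∧ (∀ j, HasCompactSupport (g j)) ∧
      (∀ j x, v x ≤ g j x) ∧ (∀ j x, |g j x| ≤ C') ∧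
      ∀ x, Filter.Tendsto (fun j => g j x) Filter.atTop (𝓝 (v x)) := by
  obtain ⟨f, hfc, hvf, hfC, hlim⟩ := exists_lipschitz_approx_of_upperSemicontinuous hv hC
  let χ : ContDiffBump x₀ := ⟨R, R + 1, hR, by linarith⟩
  have hε : ∀ j : ℕ, (0 : ℝ) < 1 / ((j : ℝ) + 1) := fun j => by positivity
  -- Raising f j by twice the approximation error keeps the smooth function above f j, hence above
  -- v.
  have happ := fun j : ℕ => ((hfc j).add (continuous_const (y := 2 * (1 / ((j : ℝ) + 1))))).exists_contDiff_approx
    ⊤ (ε := fun _ => 1 / ((j : ℝ) + 1)) continuous_const (fun _ => hε j)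
  choose g hg hgd _ using happ
  have hgd' : ∀ j x, f j x + 1 / ((j : ℝ) + 1) ≤ g j x ∧ g j x ≤ f j x + 3 * (1 / ((j : ℝ) + 1)) := by
    intro j x
    have := hgd j x
    rw [Real.dist_eq, Pi.add_apply, abs_lt] at this
    constructor <;> linarith [this.1, this.2]
  have hε1 : ∀ j : ℕ, 1 / ((j : ℝ) + 1) ≤ 1 := fun j => by
    rw [div_le_one (by positivity)]; linarith [(Nat.cast_nonneg j : (0 : ℝ) ≤ j)]
  refine ⟨fun j x => χ x * g j x, C + 3, fun j => χ.contDiff.mul (hg j),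
    fun j => χ.hasCompactSupport.mul_right, fun j x => ?_, fun j x => ?_, fun x => ?_⟩
  · by_cases hx : x ∈ Metric.closedBall x₀ R
    · simp only [χ.one_of_mem_closedBall hx, one_mul]
      linarith [(hgd' j x).1, hvf j x, hε j]
    · rw [hsupp x hx]
      have := hvf j x
      rw [hsupp x hx] at this
      exact mul_nonneg χ.nonneg (by linarith [(hgd' j x).1, hε j])
  · rw [abs_mul, abs_of_nonneg χ.nonneg]
    have h1 : |g j x| ≤ C + 3 := by
      have := (abs_le.1 (hC x)).1
      rw [abs_le]
      constructor <;> linarith [(hgd' j x).1, (hgd' j x).2, hvf j x, hfC j x, hε j, hε1 j]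
    calc χ x * |g j x| ≤ 1 * |g j x| := mul_le_mul_of_nonneg_right χ.le_one (abs_nonneg _)
      _ ≤ C + 3 := by rwa [one_mul]
  · have hg' : Filter.Tendsto (fun j => g j x) Filter.atTop (𝓝 (v x)) := by
      have hz := tendsto_one_div_add_atTop_nhds_zero_nat (𝕜 := ℝ)
      have h1 := (hlim x).add hz
      have h2 := (hlim x).add (hz.const_mul 3)
      rw [add_zero] at h1
      rw [mul_zero, add_zero] at h2
      exact tendsto_of_tendsto_of_tendsto_of_le_of_le h1 h2 (fun j => (hgd' j x).1)
        fun j => (hgd' j x).2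
    have := hg'.const_mul (χ x)
    by_cases hx : x ∈ Metric.closedBall x₀ R
    · simpa [χ.one_of_mem_closedBall hx] using this
    · simpa [hsupp x hx] using this

end Approximation

/-! ### Viscosity subsolutions of linear equations are distributional subsolutions -/

section LinearViscosity

open SchwartzMap Metric

variable {E : Type*} [NormedAddCommGroup E] {ι : Type*} [Fintype ι]

/-- `q` touches `u` from above at `x` for every `C²` function `q` only with `L q(x) ≥ b`, where
`L = ∑ i, ∂²/∂(m i)²`. -/
def IsLinearSubsolution [NormedSpace ℝ E] (m : ι → E) (b : ℝ) (u : E → EReal) (O : Set E) : Prop :=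
  ∀ x ∈ O, ∀ q : E → ℝ, ContDiff ℝ 2 q → (q x : EReal) = u x →
    (∀ᶠ y in 𝓝 x, u y ≤ (q y : EReal)) → b ≤ sumSq m q x

/-- At an interior maximum y of u - w a vertical translate of w is an upper test, so L w(y) ≥ b and
u(y) ≤ g(y) = w(y) - τ L w(y) ≤ w(y) - τ b. A maximum on the sphere is covered by `hbd`. -/
lemma IsLinearSubsolution.le_resolvent [NormedSpace ℝ E] [ProperSpace E] {m : ι → E} {b : ℝ}
    {u : E → EReal} {O : Set E} (hu : IsLinearSubsolution m b u O) (husc : UpperSemicontinuousOn u O)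
    (htop : ∀ x ∈ O, u x ≠ ⊤) {z : E} {R : ℝ} (hRO : closedBall z R ⊆ O)
    {τ : ℝ} (hτ : 0 ≤ τ) {w g : E → ℝ} (hw : ContDiff ℝ 2 w)
    (hwg : ∀ x, w x - τ * sumSq m w x = g x)
    (hg : ∀ x ∈ closedBall z R, u x ≤ (g x : EReal))
    (hbd : ∀ x, dist x z = R → u x ≤ ((w x - τ * b : ℝ) : EReal))
    {x : E} (hx : x ∈ closedBall z R) : u x ≤ ((w x - τ * b : ℝ) : EReal) := by
  have hF : UpperSemicontinuousOn (fun y => u y + ((-w y : ℝ) : EReal)) (closedBall z R) := by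
    refine (husc.mono hRO).add' ?_ fun y hy => EReal.continuousAt_add (Or.inl (htop y (hRO hy)))
      (Or.inr (EReal.coe_ne_top _))
    exact (continuous_coe_real_ereal.comp hw.continuous.neg).upperSemicontinuous.upperSemicontinuousOn _
  obtain ⟨y, hy, hmax⟩ := hF.exists_isMaxOn ⟨x, hx⟩ (isCompact_closedBall z R)
  have hcmp : ∀ t ∈ closedBall z R, u t + ((-w t : ℝ) : EReal) ≤ u y + ((-w y : ℝ) : EReal) :=
    fun t ht => hmax ht
  induction hcase : u y with
  | bot =>
    have := hcmp x hx
    rw [hcase, EReal.bot_add, le_bot_iff, EReal.add_eq_bot_iff] at this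
    rcases this with h | h
    · rw [h]; exact bot_le
    · exact absurd h (EReal.coe_ne_bot _)
  | top => exact absurd hcase (htop y (hRO hy))
  | coe a =>
    have hle : ∀ t ∈ closedBall z R, u t ≤ ((w t + (a - w y) : ℝ) : EReal) := by
      intro t ht
      have h := hcmp t ht
      rw [hcase, ← EReal.coe_add] at h
      have h' : u t + ((-w t : ℝ) : EReal) + (w t : EReal) ≤ ((a + -w y : ℝ) : EReal) + (w t : EReal) :=
        add_le_add_left h _
      rw [add_assoc, ← EReal.coe_add, neg_add_cancel, EReal.coe_zero, add_zero,
        ← EReal.coe_add] at h'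
      refine h'.trans_eq ?_
      congr 1; ring
    suffices h : a - w y ≤ -(τ * b) by
      refine (hle x hx).trans ?_
      exact_mod_cast (by linarith : w x + (a - w y) ≤ w x - τ * b)
    rcases (mem_closedBall.1 hy).lt_or_eq with hlt | heq
    · have hnear : ∀ᶠ t in 𝓝 y, u t ≤ ((w t + (a - w y) : ℝ) : EReal) := by
        filter_upwards [isOpen_ball.mem_nhds (mem_ball.2 hlt)] with t ht
        exact hle t (ball_subset_closedBall ht)
      have h1 := hu y (hRO hy) (fun t => w t + (a - w y)) (hw.add contDiff_const)
        (by rw [hcase]; congr 1; ring) hnear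
      rw [sumSq_add_const] at h1
      have h2 := hg y hy
      rw [hcase] at h2
      have h3 : a ≤ g y := by exact_mod_cast h2
      have h4 := hwg y
      nlinarith [mul_le_mul_of_nonneg_left h1 hτ]
    · have h1 := hbd y heq
      rw [hcase] at h1
      have : a ≤ w y - τ * b := by exact_mod_cast h1
      linarith

open Classical in
/-- The function equal to `max u p` on the ball `closedBall z R` and to `p` outside of it. -/
def glue (u : E → EReal) (p : E → ℝ) (z : E) (R : ℝ) (x : E) : ℝ :=
  if x ∈ closedBall z R then (max (u x) (p x : EReal)).toReal else p x

section Glue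

variable {u : E → EReal} {O : Set E} {p : E → ℝ} {z : E} {R : ℝ}

lemma coe_glue (htop : ∀ x ∈ O, u x ≠ ⊤) (hRO : closedBall z R ⊆ O) {x : E}
    (hx : x ∈ closedBall z R) : (glue u p z R x : EReal) = max (u x) (p x : EReal) := by
  rw [glue, if_pos hx, EReal.coe_toReal]
  · intro h
    rcases max_choice (u x) (p x : EReal) with h1 | h1
    · exact htop x (hRO hx) (h1 ▸ h)
    · exact EReal.coe_ne_top _ (h1 ▸ h)
  · exact ((EReal.bot_lt_coe _).trans_le (le_max_right _ _)).ne'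

lemma le_glue (htop : ∀ x ∈ O, u x ≠ ⊤) (hRO : closedBall z R ⊆ O) (x : E) :
    p x ≤ glue u p z R x := by
  by_cases hx : x ∈ closedBall z R
  · have h := le_max_right (u x) (p x : EReal)
    rw [← coe_glue htop hRO hx] at h
    exact_mod_cast h
  · rw [glue, if_neg hx]

lemma glue_lt_iff (htop : ∀ x ∈ O, u x ≠ ⊤) (hRO : closedBall z R ⊆ O) {x : E} {c : ℝ} :
    glue u p z R x < c ↔ p x < c ∧ (x ∈ closedBall z R → u x < (c : EReal)) := by
  by_cases hx : x ∈ closedBall z R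
  · rw [← EReal.coe_lt_coe_iff, coe_glue htop hRO hx, max_lt_iff, EReal.coe_lt_coe_iff]
    tauto
  · rw [glue, if_neg hx]; tauto

/-- Leaving the closed ball replaces max u p by the smaller value p, and a downward jump off a
closed set preserves upper semicontinuity. -/
lemma glue_upperSemicontinuous (hO : IsOpen O) (husc : UpperSemicontinuousOn u O)
    (htop : ∀ x ∈ O, u x ≠ ⊤) (hp : Continuous p) (hRO : closedBall z R ⊆ O) :
    UpperSemicontinuous (glue u p z R) := by
  intro x c hc
  simp only [glue_lt_iff htop hRO] at hc ⊢
  refine (hp.continuousAt.eventually (gt_mem_nhds hc.1)).and ?_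
  by_cases hx : x ∈ closedBall z R
  · have := husc x (hRO hx) c (hc.2 hx)
    rw [hO.nhdsWithin_eq (hRO hx)] at this
    exact this.mono fun y hy _ => hy
  · filter_upwards [isClosed_closedBall.isOpen_compl.mem_nhds hx] with y hy hy'
    exact absurd hy' hy

end Glue

end LinearViscosity

/-! ### The weak inequality for a glued subsolution -/

section LinearViscosityIntegral

open SchwartzMap Metric

variable {E : Type*} [NormedAddCommGroup E] [InnerProductSpace ℝ E] [FiniteDimensional ℝ E]
  [MeasurableSpace E] [BorelSpace E] {ι : Type*} [Fintype ι]

lemma integrable_of_bounded_of_support {v : E → ℝ} (hv : AEStronglyMeasurable v volume) {C : ℝ}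
    (hC : ∀ x, |v x| ≤ C) {z : E} {R : ℝ} (hsupp : ∀ x, x ∉ closedBall z R → v x = 0) :
    Integrable v volume := by
  have h1 : IntegrableOn v (closedBall z R) volume :=
    Measure.integrableOn_of_bounded (M := C) measure_closedBall_lt_top.ne hv
      (Filter.Eventually.of_forall hC)
  rwa [integrableOn_iff_integrable_of_support_subset] at h1
  intro x hx
  by_contra h
  exact hx (hsupp x h)

/-- If `v` is the glueing of a subsolution with a strict classical subsolution `p` which is large
on the boundary, then `L v ≥ b` weakly near the centre. -/
lemma IsLinearSubsolution.integral_glue_ge {m : ι → E} {b : ℝ}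
    {u : E → EReal} {O : Set E} (hu : IsLinearSubsolution m b u O) (hO : IsOpen O)
    (husc : UpperSemicontinuousOn u O)
    (htop : ∀ x ∈ O, u x ≠ ⊤) {z : E} {R δ : ℝ} (hR : 0 < R) (hδR : δ ≤ R)
    (hRO : closedBall z R ⊆ O) {M : ℝ}
    (hM : ∀ x ∈ closedBall z R, u x ≤ (M : EReal)) (p : 𝓢(E, ℝ))
    (hpsupp : ∀ x, x ∉ closedBall z (R + 1) → p x = 0)
    (hpb : ∀ x, dist x z = R → M + 1 ≤ p x)
    (hpL : ∀ x ∈ closedBall z δ, b + 1 ≤ sumSq m p x)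
    (η : 𝓢(E, ℝ)) (hη0 : ∀ x, 0 ≤ η x) (hη : ∀ x, x ∉ closedBall z δ → η x = 0) :
    b * ∫ x, η x ≤ ∫ x, glue u p z R x * sumSq m η x := by
  set v := glue u p z R with hv
  have hvusc : UpperSemicontinuous v := glue_upperSemicontinuous hO husc htop p.continuous hRO
  have hvmeas : Measurable v := hvusc.measurable
  obtain ⟨Cp, hCp0, hCp⟩ := p.exists_abs_le
  have hvC : ∀ x, |v x| ≤ |M| + Cp + 1 := by
    intro x
    have h1 := le_glue (p := p) htop hRO x
    have h2 := hCp x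
    have h3 : v x < |M| + Cp + 1 := by
      rw [hv, glue_lt_iff htop hRO]
      refine ⟨by linarith [le_abs_self (p x), abs_nonneg M], fun hx => (hM x hx).trans_lt ?_⟩
      exact_mod_cast (by linarith [le_abs_self M] : M < |M| + Cp + 1)
    rw [abs_le]
    exact ⟨by linarith [neg_abs_le (p x), abs_nonneg M], h3.le⟩
  have hvsupp : ∀ x, x ∉ closedBall z (R + 1) → v x = 0 := by
    intro x hx
    have : x ∉ closedBall z R := fun h => hx (closedBall_subset_closedBall (by linarith) h)
    rw [hv, glue, if_neg this, hpsupp x hx]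
  have hvint : Integrable v volume :=
    integrable_of_bounded_of_support hvmeas.aestronglyMeasurable hvC hvsupp
  have hprod : ∀ h : 𝓢(E, ℝ), Integrable (fun x => v x * h x) volume := fun h =>
    h.integrable.bdd_mul hvmeas.aestronglyMeasurable (Filter.Eventually.of_forall hvC)
  obtain ⟨g, C', hgs, hgc, hvg, hgC, hglim⟩ :=
    exists_smooth_approx_of_upperSemicontinuous hvusc hvC (by linarith : 0 < R + 1) hvsupp
  obtain ⟨C₀, hC₀, hexp⟩ := exists_resolvent_expansion m p
  obtain ⟨C₁, hC₁, hC₁p⟩ := (schwartzSumSq m p).exists_abs_le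
  obtain ⟨Cη, hCη, hηexp⟩ := exists_resolvent_expansion m η
  set I := ∫ x, |v x| with hI
  have hI0 : 0 ≤ I := integral_nonneg fun _ => abs_nonneg _
  have hsumη : ∀ x, sumSq m η x = schwartzSumSq m η x := fun x => (schwartzSumSq_apply m η x).symm
  -- the inequality for the resolvent of a small parameter
  have main : ∀ τ : ℝ, 0 < τ → τ ≤ 1 → τ * (|b| + C₁ + C₀) ≤ 1 →
      b * ∫ x, η x ≤ (∫ x, v x * sumSq m η x) + τ * (Cη * I) := by
    intro τ hτ hτ1 hτs
    obtain ⟨w₀, hw₀, hw₀e⟩ := hexp τ hτ.le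
    obtain ⟨h, hh, hhe⟩ := hηexp τ hτ.le
    have hττ : τ ^ 2 ≤ τ := by nlinarith
    have hC₀τ : τ * C₀ ≤ 1 := by
      nlinarith [mul_nonneg hτ.le (add_nonneg (abs_nonneg b) hC₁)]
    have hstep : ∀ j, ∫ x, v x * η x + τ * b * η x ≤ ∫ x, g j x * h x := by
      intro j
      let gS : 𝓢(E, ℝ) := (hgc j).toSchwartzMap (hgs j)
      obtain ⟨w, hw⟩ := exists_resolvent m hτ.le gS
      -- Since g j ≥ v ≥ p and the resolvent is monotone, w lies above the resolvent of p, which is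
      -- p + τ L p up to O(τ²). This gives both the boundary values and the strictness.
      have hw0w : ∀ x, w₀ x ≤ w x := resolvent_mono hτ.le hw₀ hw fun x =>
        (le_glue (u := u) htop hRO x).trans (hvg j x)
      have hle : ∀ x ∈ closedBall z R, u x ≤ ((w x - τ * b : ℝ) : EReal) := by
        intro x hx
        refine hu.le_resolvent husc htop hRO hτ.le (w.smooth 2) hw (fun y hy => ?_) (fun y hy => ?_) hx
        · refine le_trans (le_max_left _ (p y : EReal)) ?_
          rw [← coe_glue htop hRO hy]
          exact_mod_cast hvg j y
        · refine (hM y hy.le).trans ?_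
          have h1 := hpb y hy
          have h2 := (abs_le.1 (hw₀e y)).1
          have h3 := (abs_le.1 (hC₁p y)).1
          rw [schwartzSumSq_apply] at h3
          have h4 := hw0w y
          have h5 := mul_le_mul_of_nonneg_left h3 hτ.le
          have h6 := mul_le_mul_of_nonneg_right hττ hC₀
          have h7 := mul_le_mul_of_nonneg_left (le_abs_self b) hτ.le
          have : M ≤ w y - τ * b := by nlinarith
          exact_mod_cast this
      -- For the part coming from u this is the comparison `hle`; for p the surplus 1 in L p ≥ b + 1
      -- absorbs the error τ² C₀.
      have hvw : ∀ x ∈ closedBall z δ, v x + τ * b ≤ w x := by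
        intro x hx
        have hxR := closedBall_subset_closedBall hδR hx
        have h1 : (v x : EReal) ≤ ((w x - τ * b : ℝ) : EReal) := by
          rw [hv, coe_glue htop hRO hxR]
          refine max_le (hle x hxR) ?_
          have h2 := (abs_le.1 (hw₀e x)).1
          have h3 := mul_le_mul_of_nonneg_left (hpL x hx) hτ.le
          have h4 := hw0w x
          have h5 : τ ^ 2 * C₀ ≤ τ := by nlinarith
          have : p x ≤ w x - τ * b := by nlinarith
          exact_mod_cast this
        have h2 : v x ≤ w x - τ * b := by exact_mod_cast h1
        linarith
      -- By symmetry the resolvent is moved onto η, so that only g j depends on j and dominated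
      -- convergence applies.
      have e1 : ∫ x, g j x * h x = ∫ x, w x * η x :=
        (integral_resolvent_mul (f := gS) hw hh).symm
      rw [e1]
      refine integral_mono ((hprod η).add (η.integrable.const_mul _)) (schwartz_integrable_mul _ _) ?_
      intro x
      by_cases hx : x ∈ closedBall z δ
      · have := mul_le_mul_of_nonneg_right (hvw x hx) (hη0 x)
        simp only
        linarith
      · simp [hη x hx]
    have hlim : Filter.Tendsto (fun j => ∫ x, g j x * h x) Filter.atTop (𝓝 (∫ x, v x * h x)) := by
      refine tendsto_integral_of_dominated_convergence (fun x => C' * |h x|) (fun j => ?_)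
        (h.integrable.abs.const_mul _) (fun j => Filter.Eventually.of_forall fun x => ?_)
        (Filter.Eventually.of_forall fun x => (hglim x).mul_const _)
      · exact ((hgs j).continuous.mul h.continuous).aestronglyMeasurable
      · rw [Real.norm_eq_abs, abs_mul]
        exact mul_le_mul_of_nonneg_right (hgC j x) (abs_nonneg _)
    have h1 : ∫ x, v x * η x + τ * b * η x ≤ ∫ x, v x * h x :=
      ge_of_tendsto' hlim hstep
    rw [integral_add (hprod η) (η.integrable.const_mul _), integral_const_mul] at h1
    have hsum : Integrable (fun x => v x * η x + τ * (v x * schwartzSumSq m η x)) volume :=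
      (hprod η).add ((hprod _).const_mul τ)
    have h2 : ∫ x, v x * h x ≤ ∫ x, (v x * η x + τ * (v x * schwartzSumSq m η x) +
        τ ^ 2 * Cη * |v x|) := by
      refine integral_mono (hprod h) (hsum.add (hvint.abs.const_mul _)) fun x => ?_
      have h3 := hhe x
      rw [hsumη] at h3
      have h4 : v x * (h x - η x - τ * schwartzSumSq m η x) ≤ |v x| * (τ ^ 2 * Cη) := by
        refine (le_abs_self _).trans ?_
        rw [abs_mul]
        exact mul_le_mul_of_nonneg_left h3 (abs_nonneg _)
      simp only
      linarith
    rw [integral_add hsum (hvint.abs.const_mul _),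
      integral_add (hprod η) ((hprod _).const_mul τ), integral_const_mul, integral_const_mul,
      ← hI] at h2
    -- The integral of v η cancels; what remains carries a factor τ, and dividing by it leaves an
    -- error of order τ.
    have h3 : τ * (b * ∫ x, η x) ≤
        τ * ((∫ x, v x * schwartzSumSq m η x) + τ * (Cη * I)) := by linarith
    simp_rw [hsumη]
    exact le_of_mul_le_mul_left h3 hτ
  have hlim : Filter.Tendsto (fun τ : ℝ => (∫ x, v x * sumSq m η x) + τ * (Cη * I)) (𝓝[>] 0)
      (𝓝 (∫ x, v x * sumSq m η x)) := by
    have : Continuous fun τ : ℝ => (∫ x, v x * sumSq m η x) + τ * (Cη * I) := by fun_prop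
    have := this.tendsto 0
    simp only [zero_mul, add_zero] at this
    exact this.mono_left nhdsWithin_le_nhds
  refine ge_of_tendsto hlim ?_
  have hs : 0 < |b| + C₁ + C₀ + 1 := by positivity
  have hpos : (0 : ℝ) < min 1 (1 / (|b| + C₁ + C₀ + 1)) := by positivity
  filter_upwards [Ioc_mem_nhdsGT hpos] with τ hτ
  refine main τ hτ.1 (hτ.2.trans (min_le_left _ _)) ?_
  have := (le_div_iff₀ hs).1 (hτ.2.trans (min_le_right _ _))
  nlinarith [hτ.1]

end LinearViscosityIntegral

/-! ### Removal of the barrier -/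

section LinearViscosityIntegral

open SchwartzMap Metric

lemma fderiv_fderiv_apply {E F : Type*} [NormedAddCommGroup E] [NormedSpace ℝ E]
    [NormedAddCommGroup F] [NormedSpace ℝ F] {f : E → F} {x : E}
    (hf : DifferentiableAt ℝ (fderiv ℝ f) x) (v w : E) :
    fderiv ℝ (fun y => fderiv ℝ f y v) x w = fderiv ℝ (fderiv ℝ f) x w v := by
  have h : HasFDerivAt (fun y => fderiv ℝ f y v)
      ((ContinuousLinearMap.apply ℝ F v).comp (fderiv ℝ (fderiv ℝ f) x)) x :=
    (ContinuousLinearMap.apply ℝ F v).hasFDerivAt.comp x hf.hasFDerivAt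
  rw [h.fderiv]
  rfl

variable {E : Type*} [NormedAddCommGroup E] [InnerProductSpace ℝ E] {ι : Type*} [Fintype ι]

lemma fderiv_fderiv_norm_sq (z : E) (c : ℝ) (x v : E) :
    fderiv ℝ (fderiv ℝ fun y => ‖y - z‖ ^ 2 - c) x v v = 2 * ‖v‖ ^ 2 := by
  have hs : ContDiff ℝ 2 fun y : E => ‖y - z‖ ^ 2 - c :=
    ((contDiff_id.sub contDiff_const).norm_sq ℝ).sub contDiff_const
  have h1 : (fun y => fderiv ℝ (fun y : E => ‖y - z‖ ^ 2 - c) y v) =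
      fun y => 2 * inner ℝ (y - z) v := by
    ext y
    have : HasFDerivAt (fun y : E => ‖y - z‖ ^ 2 - c) (2 • innerSL ℝ (y - z)) y := by
      have := (((hasFDerivAt_id y).sub_const z).norm_sq).sub_const c
      exact this
    rw [this.fderiv]
    simp [inner_sub_left]
  rw [← fderiv_fderiv_apply hs.contDiffAt.differentiableAt_fderiv_of_two, h1]
  have h2 : HasFDerivAt (fun y : E => 2 * inner ℝ (y - z) v) ((2 : ℝ) • innerSL ℝ v) x := by
    have h3 : HasFDerivAt (fun y : E => innerSL ℝ v (y - z)) (innerSL ℝ v) x :=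
      (innerSL ℝ v).hasFDerivAt.comp x ((hasFDerivAt_id x).sub_const z)
    have := h3.const_mul 2
    simpa [real_inner_comm] using this
  rw [h2.fderiv]
  simp

lemma sumSq_norm_sq (m : ι → E) (z : E) (c : ℝ) (x : E) :
    sumSq m (fun y => ‖y - z‖ ^ 2 - c) x = 2 * ∑ i, ‖m i‖ ^ 2 := by
  simp only [sumSq, fderiv_fderiv_norm_sq, Finset.mul_sum]

lemma sumSq_eq_zero_of_notMem_closedBall {m : ι → E} {η : E → ℝ} {z : E} {δ : ℝ}
    (hη : ∀ x, x ∉ closedBall z δ → η x = 0) {x : E} (hx : x ∉ closedBall z δ) :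
    sumSq m η x = 0 := by
  have : η =ᶠ[𝓝 x] fun _ => 0 := by
    filter_upwards [isClosed_closedBall.isOpen_compl.mem_nhds hx] with y hy using hη y hy
  rw [sumSq_congr this]
  simp [sumSq]

variable [FiniteDimensional ℝ E] [MeasurableSpace E] [BorelSpace E]

/-- A viscosity subsolution of the linear equation `∑ i, ∂²u/∂(m i)² ≥ b` is a distributional
subsolution. -/
theorem IsLinearSubsolution.integral_ge {m : ι → E} (hm : ∃ i, m i ≠ 0) {b : ℝ}
    {u : E → EReal} {O : Set E} (hu : IsLinearSubsolution m b u O) (hO : IsOpen O)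
    (husc : UpperSemicontinuousOn u O) (htop : ∀ x ∈ O, u x ≠ ⊤)
    (hbot : ∀ᵐ x ∂(volume.restrict O), u x ≠ ⊥)
    (hint : LocallyIntegrableOn (fun x => (u x).toReal) O volume)
    {z : E} {δ : ℝ} (hδ : 0 < δ) (hδO : closedBall z δ ⊆ O)
    {η : E → ℝ} (hηs : ContDiff ℝ ∞ η) (hη0 : ∀ x, 0 ≤ η x)
    (hη : ∀ x, x ∉ closedBall z δ → η x = 0) :
    b * ∫ x, η x ≤ ∫ x, (u x).toReal * sumSq m η x := by
  obtain ⟨s, hs, hsO⟩ := (isCompact_closedBall z δ).exists_cthickening_subset_open hO hδO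
  rw [cthickening_closedBall hs.le hδ.le] at hsO
  set R := s + δ with hR
  have hR0 : 0 < R := by positivity
  have hδR : δ < R := by linarith
  -- With δ < R' < R the paraboloid ‖x - z‖² - R'² is negative on the ball of radius δ and positive
  -- on the sphere of radius R.
  set R' := (δ + R) / 2 with hR'
  -- an upper bound
  obtain ⟨M, hM⟩ : ∃ M : ℝ, ∀ x ∈ closedBall z R, u x ≤ (M : EReal) := by
    obtain ⟨y, hy, hmax⟩ := (husc.mono hsO).exists_isMaxOn ⟨z, mem_closedBall_self hR0.le⟩
      (isCompact_closedBall z R)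
    exact ⟨(u y).toReal, fun x hx => (hmax hx).trans (EReal.le_coe_toReal (htop y (hsO hy)))⟩
  -- the barrier
  let χ : ContDiffBump z := ⟨R, R + 1, hR0, by linarith⟩
  let P : E → ℝ := fun x => ‖x - z‖ ^ 2 - R' ^ 2
  have hPs : ContDiff ℝ ∞ P := ((contDiff_id.sub contDiff_const).norm_sq ℝ).sub contDiff_const
  have hcpt : HasCompactSupport fun x => χ x * P x := χ.hasCompactSupport.mul_right
  let p : 𝓢(E, ℝ) := hcpt.toSchwartzMap (χ.contDiff.mul hPs)
  have hpP : ∀ x ∈ closedBall z R, p x = P x := fun x hx => by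
    change χ x * P x = P x
    rw [χ.one_of_mem_closedBall hx, one_mul]
  have hpsupp : ∀ x, x ∉ closedBall z (R + 1) → p x = 0 := fun x hx => by
    change χ x * P x = 0
    rw [χ.zero_of_le_dist (le_of_lt (by simpa using hx)), zero_mul]
  set k := 2 * ∑ i, ‖m i‖ ^ 2 with hk
  have hk0 : 0 < k := by
    obtain ⟨i, hi⟩ := hm
    have : 0 < ∑ i, ‖m i‖ ^ 2 := Finset.sum_pos' (fun _ _ => by positivity)
      ⟨i, Finset.mem_univ i, by positivity⟩
    positivity
  have hpL : ∀ x ∈ closedBall z δ, sumSq m p x = k := by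
    intro x hx
    have : (p : E → ℝ) =ᶠ[𝓝 x] P := by
      filter_upwards [isOpen_ball.mem_nhds (closedBall_subset_ball hδR hx)] with y hy
      exact hpP y (ball_subset_closedBall hy)
    rw [sumSq_congr this]
    exact sumSq_norm_sq m z _ x
  have hd : 0 < R ^ 2 - R' ^ 2 := by
    rw [hR']; nlinarith
  have hd' : ∀ x ∈ closedBall z δ, P x ≤ δ ^ 2 - R' ^ 2 := fun x hx => by
    have : ‖x - z‖ ≤ δ := by rwa [← dist_eq_norm]
    have := pow_le_pow_left₀ (norm_nonneg _) this 2
    change ‖x - z‖ ^ 2 - R' ^ 2 ≤ _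
    linarith
  have hdneg : δ ^ 2 - R' ^ 2 < 0 := by rw [hR']; nlinarith
  have hηc : HasCompactSupport η := HasCompactSupport.of_support_subset_isCompact
    (isCompact_closedBall z δ) fun x hx => by
      by_contra h; exact hx (hη x h)
  let ηS : 𝓢(E, ℝ) := hηc.toSchwartzMap hηs
  have hsumη : ∀ x, sumSq m η x = schwartzSumSq m ηS x := fun x => (schwartzSumSq_apply m ηS x).symm
  obtain ⟨Cη, -, hCη⟩ := (schwartzSumSq m ηS).exists_abs_le
  -- the inequality for the glued functions
  have hglue : ∀ᶠ A : ℕ in Filter.atTop,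
      b * ∫ x, η x ≤ ∫ x, glue u ((A : ℝ) • p : 𝓢(E, ℝ)) z R x * sumSq m η x := by
    -- Large multiples A p exceed M + 1 on the sphere and satisfy L (A p) = A k ≥ b + 1 near the
    -- centre; k > 0 because some m i is nonzero.
    obtain ⟨N, hN⟩ := exists_nat_ge (max ((M + 1) / (R ^ 2 - R' ^ 2)) ((b + 1) / k))
    filter_upwards [Filter.eventually_ge_atTop N] with A hA
    have hA' : max ((M + 1) / (R ^ 2 - R' ^ 2)) ((b + 1) / k) ≤ A :=
      hN.trans (by exact_mod_cast hA)
    refine hu.integral_glue_ge hO husc htop hR0 hδR.le hsO hM ((A : ℝ) • p) (fun x hx => ?_)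
      (fun x hx => ?_) (fun x hx => ?_) ηS hη0 hη
    · simp [hpsupp x hx]
    · have h1 := (div_le_iff₀ hd).1 ((le_max_left _ _).trans hA')
      have h2 : ‖x - z‖ = R := by rwa [← dist_eq_norm]
      rw [_root_.smul_apply, hpP x hx.le, smul_eq_mul]
      change M + 1 ≤ A * (‖x - z‖ ^ 2 - R' ^ 2)
      rwa [h2]
    · have h1 := (div_le_iff₀ hk0).1 ((le_max_right _ _).trans hA')
      rwa [schwartz_sumSq_smul, hpL x hx]
  -- passage to the limit
  have hintB : IntegrableOn (fun x => (u x).toReal) (closedBall z δ) volume :=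
    hint.integrableOn_compact_subset hδO (isCompact_closedBall z δ)
  have hbot' : ∀ᵐ x ∂volume, x ∈ O → u x ≠ ⊥ := (ae_restrict_iff' hO.measurableSet).1 hbot
  have hlim : Filter.Tendsto
      (fun A : ℕ => ∫ x, glue u ((A : ℝ) • p : 𝓢(E, ℝ)) z R x * sumSq m η x) Filter.atTop
      (𝓝 (∫ x, (u x).toReal * sumSq m η x)) := by
    have hbound : Integrable ((closedBall z δ).indicator fun x => Cη * |(u x).toReal|) volume :=
      (integrable_indicator_iff measurableSet_closedBall).2 (hintB.abs.const_mul Cη)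
    have hle0 : ∀ (A : ℕ), ∀ x ∈ closedBall z δ, ((A : ℝ) • p : 𝓢(E, ℝ)) x ≤ A * (δ ^ 2 - R' ^ 2) := by
      intro A x hx
      rw [_root_.smul_apply, hpP x (closedBall_subset_closedBall hδR.le hx), smul_eq_mul]
      exact mul_le_mul_of_nonneg_left (hd' x hx) (Nat.cast_nonneg A)
    refine tendsto_integral_of_dominated_convergence _ (fun A => ?_) hbound (fun A => ?_) ?_
    · have h1 : Measurable (glue u ((A : ℝ) • p : 𝓢(E, ℝ)) z R) :=
        (glue_upperSemicontinuous hO husc htop (SchwartzMap.continuous _) hsO).measurable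
      have h2 : Measurable (sumSq m η) := by
        rw [funext hsumη]; exact (SchwartzMap.continuous _).measurable
      exact (h1.mul h2).aestronglyMeasurable
    · filter_upwards [hbot'] with x hxb
      by_cases hx : x ∈ closedBall z δ
      · rw [Set.indicator_of_mem hx, Real.norm_eq_abs, abs_mul, mul_comm Cη]
        refine mul_le_mul ?_ (by rw [hsumη]; exact hCη x) (abs_nonneg _) (abs_nonneg _)
        have hxR := closedBall_subset_closedBall hδR.le hx
        have hc := coe_glue (p := ((A : ℝ) • p : 𝓢(E, ℝ))) htop hsO hxR
        have hp0 : ((A : ℝ) • p : 𝓢(E, ℝ)) x ≤ 0 := (hle0 A x hx).trans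
          (mul_nonpos_of_nonneg_of_nonpos (Nat.cast_nonneg A) hdneg.le)
        rw [← EReal.coe_toReal (htop x (hδO hx)) (hxb (hδO hx)), ← EReal.coe_strictMono.monotone.map_max,
          EReal.coe_eq_coe_iff] at hc
        rw [hc, abs_le]
        constructor
        · exact (neg_abs_le _).trans (le_max_left _ _)
        · exact max_le (le_abs_self _) (hp0.trans (abs_nonneg _))
      · rw [sumSq_eq_zero_of_notMem_closedBall hη hx, Set.indicator_of_notMem hx]
        simp
    · filter_upwards [hbot'] with x hxb
      by_cases hx : x ∈ closedBall z δ
      -- Where u is finite, A p eventually lies below u because p < 0 there, and the glued function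
      -- is eventually equal to u.
      · refine Filter.Tendsto.mul_const _ (tendsto_const_nhds.congr' ?_)
        obtain ⟨N, hN⟩ := exists_nat_ge ((u x).toReal / (δ ^ 2 - R' ^ 2))
        filter_upwards [Filter.eventually_ge_atTop N] with A hA
        have hxR := closedBall_subset_closedBall hδR.le hx
        have hc := coe_glue (p := ((A : ℝ) • p : 𝓢(E, ℝ))) htop hsO hxR
        rw [← EReal.coe_toReal (htop x (hδO hx)) (hxb (hδO hx)), ← EReal.coe_strictMono.monotone.map_max,
          EReal.coe_eq_coe_iff] at hc
        rw [hc, max_eq_left]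
        refine (hle0 A x hx).trans ?_
        have : (u x).toReal / (δ ^ 2 - R' ^ 2) ≤ A := hN.trans (by exact_mod_cast hA)
        exact (div_le_iff_of_neg hdneg).1 this
      · rw [sumSq_eq_zero_of_notMem_closedBall hη hx]
        simp
  exact ge_of_tendsto hlim hglue

end LinearViscosityIntegral

/-! ### Calculus of Wirtinger derivatives -/

section Wirtinger

variable {n : ℕ}

/-- The coordinate vector `∂/∂x_j`. -/
abbrev ex (j : Fin n) : Cn n := EuclideanSpace.single j 1

/-- The coordinate vector `∂/∂y_j`. -/
abbrev ey (j : Fin n) : Cn n := EuclideanSpace.single j Complex.I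

lemma dz_congr {f g : Cn n → ℂ} {z : Cn n} (h : f =ᶠ[𝓝 z] g) (j : Fin n) :
    dz j f z = dz j g z := by rw [dz, dz, h.fderiv_eq]

lemma dzbar_congr {f g : Cn n → ℂ} {z : Cn n} (h : f =ᶠ[𝓝 z] g) (j : Fin n) :
    dzbar j f z = dzbar j g z := by rw [dzbar, dzbar, h.fderiv_eq]

lemma _root_.HasFDerivAt.dz {f : Cn n → ℂ} {f' : Cn n →L[ℝ] ℂ} {z : Cn n} (h : HasFDerivAt f f' z)
    (j : Fin n) : dz j f z = (f' (ex j) - Complex.I * f' (ey j)) / 2 := by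
  rw [DHYM.dz, h.fderiv]

lemma _root_.HasFDerivAt.dzbar {f : Cn n → ℂ} {f' : Cn n →L[ℝ] ℂ} {z : Cn n}
    (h : HasFDerivAt f f' z) (j : Fin n) :
    dzbar j f z = (f' (ex j) + Complex.I * f' (ey j)) / 2 := by
  rw [DHYM.dzbar, h.fderiv]

lemma dz_add {f g : Cn n → ℂ} {z : Cn n} (hf : DifferentiableAt ℝ f z)
    (hg : DifferentiableAt ℝ g z) (j : Fin n) :
    dz j (fun y => f y + g y) z = dz j f z + dz j g z := by
  rw [(hf.hasFDerivAt.fun_add hg.hasFDerivAt).dz, dz, dz]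
  simp only [_root_.add_apply]
  ring

lemma dzbar_add {f g : Cn n → ℂ} {z : Cn n} (hf : DifferentiableAt ℝ f z)
    (hg : DifferentiableAt ℝ g z) (j : Fin n) :
    dzbar j (fun y => f y + g y) z = dzbar j f z + dzbar j g z := by
  rw [(hf.hasFDerivAt.fun_add hg.hasFDerivAt).dzbar, dzbar, dzbar]
  simp only [_root_.add_apply]
  ring

lemma dzbar_sub {f g : Cn n → ℂ} {z : Cn n} (hf : DifferentiableAt ℝ f z)
    (hg : DifferentiableAt ℝ g z) (j : Fin n) :
    dzbar j (fun y => f y - g y) z = dzbar j f z - dzbar j g z := by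
  rw [(hf.hasFDerivAt.fun_sub hg.hasFDerivAt).dzbar, dzbar, dzbar]
  simp only [_root_.sub_apply]
  ring

lemma dz_mul {f g : Cn n → ℂ} {z : Cn n} (hf : DifferentiableAt ℝ f z)
    (hg : DifferentiableAt ℝ g z) (j : Fin n) :
    dz j (fun y => f y * g y) z = f z * dz j g z + dz j f z * g z := by
  rw [(hf.hasFDerivAt.fun_mul hg.hasFDerivAt).dz, dz, dz]
  simp only [_root_.add_apply, _root_.smul_apply, smul_eq_mul]
  ring

lemma dzbar_mul {f g : Cn n → ℂ} {z : Cn n} (hf : DifferentiableAt ℝ f z)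
    (hg : DifferentiableAt ℝ g z) (j : Fin n) :
    dzbar j (fun y => f y * g y) z = f z * dzbar j g z + dzbar j f z * g z := by
  rw [(hf.hasFDerivAt.fun_mul hg.hasFDerivAt).dzbar, dzbar, dzbar]
  simp only [_root_.add_apply, _root_.smul_apply, smul_eq_mul]
  ring

lemma dz_sum {ι : Type*} (s : Finset ι) {f : ι → Cn n → ℂ} {z : Cn n}
    (hf : ∀ i ∈ s, DifferentiableAt ℝ (f i) z) (j : Fin n) :
    dz j (fun y => ∑ i ∈ s, f i y) z = ∑ i ∈ s, dz j (f i) z := by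
  rw [(HasFDerivAt.fun_sum fun i hi => (hf i hi).hasFDerivAt).dz]
  simp only [dz, _root_.sum_apply, Finset.mul_sum, ← Finset.sum_sub_distrib, Finset.sum_div]

lemma dzbar_sum {ι : Type*} (s : Finset ι) {f : ι → Cn n → ℂ} {z : Cn n}
    (hf : ∀ i ∈ s, DifferentiableAt ℝ (f i) z) (j : Fin n) :
    dzbar j (fun y => ∑ i ∈ s, f i y) z = ∑ i ∈ s, dzbar j (f i) z := by
  rw [(HasFDerivAt.fun_sum fun i hi => (hf i hi).hasFDerivAt).dzbar]
  simp only [dzbar, _root_.sum_apply, Finset.mul_sum, ← Finset.sum_add_distrib, Finset.sum_div]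

lemma hasFDerivAt_star {f : Cn n → ℂ} {z : Cn n} (hf : DifferentiableAt ℝ f z) :
    HasFDerivAt (fun y => star (f y)) (Complex.conjCLE.toContinuousLinearMap ∘L fderiv ℝ f z) z :=
  Complex.conjCLE.toContinuousLinearMap.hasFDerivAt.comp z hf.hasFDerivAt

lemma dzbar_star {f : Cn n → ℂ} {z : Cn n} (hf : DifferentiableAt ℝ f z) (j : Fin n) :
    dzbar j (fun y => star (f y)) z = star (dz j f z) := by
  rw [(hasFDerivAt_star hf).dzbar, dz]
  simp

lemma dz_star {f : Cn n → ℂ} {z : Cn n} (hf : DifferentiableAt ℝ f z) (j : Fin n) :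
    dz j (fun y => star (f y)) z = star (dzbar j f z) := by
  rw [(hasFDerivAt_star hf).dz, dzbar]
  simp [sub_eq_add_neg]

lemma hasFDerivAt_coord (k : Fin n) (z : Cn n) :
    HasFDerivAt (fun y : Cn n => y k) ((EuclideanSpace.proj k : Cn n →L[ℂ] ℂ).restrictScalars ℝ) z :=
  ((EuclideanSpace.proj k : Cn n →L[ℂ] ℂ).restrictScalars ℝ).hasFDerivAt

lemma dz_coord (j k : Fin n) (z : Cn n) :
    dz j (fun y => y k) z = if k = j then 1 else 0 := by
  rw [(hasFDerivAt_coord k z).dz]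
  by_cases h : k = j <;> simp [h, ex, ey]

lemma dzbar_coord (j k : Fin n) (z : Cn n) : dzbar j (fun y => y k) z = 0 := by
  rw [(hasFDerivAt_coord k z).dzbar]
  by_cases h : k = j <;> simp [h, ex, ey]

/-- A function of the coordinate `z_m` only has no derivatives in the other directions. -/
lemma dzbar_comp_coord {g : ℂ → ℂ} (hg : Differentiable ℝ g) {m l : Fin n} (h : l ≠ m) (z : Cn n) :
    dzbar l (fun y => g (y m)) z = 0 := by
  have : HasFDerivAt (fun y : Cn n => g (y m)) ((fderiv ℝ g (z m)).comp
      ((EuclideanSpace.proj m : Cn n →L[ℂ] ℂ).restrictScalars ℝ)) z :=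
    (hg (z m)).hasFDerivAt.comp z (hasFDerivAt_coord m z)
  rw [this.dzbar]
  simp [ex, ey, h.symm]

lemma fderiv_comp_add_const {f : Cn n → ℂ} (c z : Cn n) :
    fderiv ℝ (fun y => f (y + c)) z = fderiv ℝ f (z + c) := fderiv_comp_add_right c

lemma dz_comp_add_const (f : Cn n → ℂ) (c z : Cn n) (j : Fin n) :
    dz j (fun y => f (y + c)) z = dz j f (z + c) := by
  rw [dz, dz, fderiv_comp_add_const]

lemma dzbar_comp_add_const (f : Cn n → ℂ) (c z : Cn n) (j : Fin n) :
    dzbar j (fun y => f (y + c)) z = dzbar j f (z + c) := by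
  rw [dzbar, dzbar, fderiv_comp_add_const]

lemma _root_.ContDiffAt.differentiableAt_fderiv_complex {f : Cn n → ℂ} {z : Cn n} (hf : ContDiffAt ℝ 2 f z) :
    DifferentiableAt ℝ (fderiv ℝ f) z :=
  (hf.fderiv_right (m := 1) (by norm_num)).differentiableAt (by simp)

lemma hasFDerivAt_fderiv_apply {f : Cn n → ℂ} {z : Cn n} (hf : ContDiffAt ℝ 2 f z) (v : Cn n) :
    HasFDerivAt (fun y => fderiv ℝ f y v)
      ((ContinuousLinearMap.apply ℝ ℂ v).comp (fderiv ℝ (fderiv ℝ f) z)) z :=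
  (ContinuousLinearMap.apply ℝ ℂ v).hasFDerivAt.comp z hf.differentiableAt_fderiv_complex.hasFDerivAt

lemma hasFDerivAt_dzbar {f : Cn n → ℂ} {z : Cn n} (hf : ContDiffAt ℝ 2 f z) (k : Fin n) :
    HasFDerivAt (fun y => dzbar k f y) ((2⁻¹ : ℂ) •
      ((ContinuousLinearMap.apply ℝ ℂ (ex k)).comp (fderiv ℝ (fderiv ℝ f) z) +
        Complex.I • (ContinuousLinearMap.apply ℝ ℂ (ey k)).comp (fderiv ℝ (fderiv ℝ f) z))) z := by
  have := ((hasFDerivAt_fderiv_apply hf (ex k)).add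
    ((hasFDerivAt_fderiv_apply hf (ey k)).const_mul Complex.I)).const_mul (2⁻¹ : ℂ)
  refine this.congr_of_eventuallyEq (Filter.Eventually.of_forall fun y => ?_)
  simp only [dzbar, Pi.add_apply]
  ring

lemma hasFDerivAt_dz {f : Cn n → ℂ} {z : Cn n} (hf : ContDiffAt ℝ 2 f z) (k : Fin n) :
    HasFDerivAt (fun y => dz k f y) ((2⁻¹ : ℂ) •
      ((ContinuousLinearMap.apply ℝ ℂ (ex k)).comp (fderiv ℝ (fderiv ℝ f) z) -
        Complex.I • (ContinuousLinearMap.apply ℝ ℂ (ey k)).comp (fderiv ℝ (fderiv ℝ f) z))) z := by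
  have := ((hasFDerivAt_fderiv_apply hf (ex k)).sub
    ((hasFDerivAt_fderiv_apply hf (ey k)).const_mul Complex.I)).const_mul (2⁻¹ : ℂ)
  refine this.congr_of_eventuallyEq (Filter.Eventually.of_forall fun y => ?_)
  simp only [dz, Pi.sub_apply]
  ring

lemma fderiv_fderiv_symm {F : Type*} [NormedAddCommGroup F] [NormedSpace ℝ F] {f : Cn n → F}
    {z : Cn n} (hf : ContDiffAt ℝ 2 f z) (v w : Cn n) :
    fderiv ℝ (fderiv ℝ f) z v w = fderiv ℝ (fderiv ℝ f) z w v :=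
  (hf.isSymmSndFDerivAt (by simp)) v w

lemma dz_dzbar {f : Cn n → ℂ} {z : Cn n} (hf : ContDiffAt ℝ 2 f z) (j k : Fin n) :
    dz j (fun y => dzbar k f y) z =
      (fderiv ℝ (fderiv ℝ f) z (ex j) (ex k) + fderiv ℝ (fderiv ℝ f) z (ey j) (ey k)
        + Complex.I * (fderiv ℝ (fderiv ℝ f) z (ex j) (ey k)
          - fderiv ℝ (fderiv ℝ f) z (ey j) (ex k))) / 4 := by
  rw [(hasFDerivAt_dzbar hf k).dz]
  simp only [_root_.smul_apply, _root_.add_apply, ContinuousLinearMap.comp_apply,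
    ContinuousLinearMap.apply_apply, smul_eq_mul]
  ring_nf
  rw [Complex.I_sq]
  ring

lemma dz_dzbar_comm {f : Cn n → ℂ} {z : Cn n} (hf : ContDiffAt ℝ 2 f z) (j k : Fin n) :
    dz j (fun y => dzbar k f y) z = dzbar k (fun y => dz j f y) z := by
  rw [dz_dzbar hf, (hasFDerivAt_dz hf j).dzbar]
  simp only [_root_.smul_apply, _root_.sub_apply, ContinuousLinearMap.comp_apply,
    ContinuousLinearMap.apply_apply, smul_eq_mul]
  rw [fderiv_fderiv_symm hf (ex k) (ex j), fderiv_fderiv_symm hf (ey k) (ex j),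
    fderiv_fderiv_symm hf (ex k) (ey j), fderiv_fderiv_symm hf (ey k) (ey j)]
  ring_nf
  rw [Complex.I_sq]
  ring

lemma dzbar_dzbar_comm {f : Cn n → ℂ} {z : Cn n} (hf : ContDiffAt ℝ 2 f z) (j k : Fin n) :
    dzbar j (fun y => dzbar k f y) z = dzbar k (fun y => dzbar j f y) z := by
  rw [(hasFDerivAt_dzbar hf k).dzbar, (hasFDerivAt_dzbar hf j).dzbar]
  simp only [_root_.smul_apply, _root_.add_apply, ContinuousLinearMap.comp_apply,
    ContinuousLinearMap.apply_apply, smul_eq_mul]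
  rw [fderiv_fderiv_symm hf (ex k) (ex j), fderiv_fderiv_symm hf (ey k) (ex j),
    fderiv_fderiv_symm hf (ex k) (ey j), fderiv_fderiv_symm hf (ey k) (ey j)]
  ring

lemma contDiff_dzbar {f : Cn n → ℂ} (hf : ContDiff ℝ ∞ f) (k : Fin n) :
    ContDiff ℝ ∞ (fun y => dzbar k f y) := by
  have h : ContDiff ℝ ∞ (fderiv ℝ f) := hf.fderiv_right (m := ∞) (by simp)
  exact ((h.clm_apply contDiff_const).add (contDiff_const.mul (h.clm_apply contDiff_const))).div_const 2

lemma contDiff_dz {f : Cn n → ℂ} (hf : ContDiff ℝ ∞ f) (k : Fin n) :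
    ContDiff ℝ ∞ (fun y => dz k f y) := by
  have h : ContDiff ℝ ∞ (fderiv ℝ f) := hf.fderiv_right (m := ∞) (by simp)
  exact ((h.clm_apply contDiff_const).sub (contDiff_const.mul (h.clm_apply contDiff_const))).div_const 2

/-- Decomposition of a vector along the real coordinate vectors. -/
lemma eq_sum_ex_ey (v : Cn n) : v = ∑ j, ((v j).re • ex j + (v j).im • ey j) := by
  ext i
  simp only [WithLp.ofLp_sum, Finset.sum_apply, PiLp.add_apply, PiLp.smul_apply, ex, ey]
  rw [Finset.sum_eq_single i]
  · simp only [PiLp.single_apply, if_true, Complex.real_smul, mul_one]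
    exact (Complex.re_add_im _).symm
  · intro b _ hb; simp [hb.symm]
  · simp

/-- The real differential in terms of the Wirtinger derivatives. -/
lemma fderiv_eq_sum_wirtinger (f : Cn n → ℂ) (z v : Cn n) :
    fderiv ℝ f z v = ∑ j, (v j * dz j f z + star (v j) * dzbar j f z) := by
  conv_lhs => rw [eq_sum_ex_ey v, map_sum]
  refine Finset.sum_congr rfl fun j _ => ?_
  rw [map_add, map_smul, map_smul, dz, dzbar, Complex.real_smul, Complex.real_smul]
  have h1 : v j = (v j).re + (v j).im * Complex.I := (Complex.re_add_im _).symm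
  have h2 : star (v j) = (v j).re - (v j).im * Complex.I := by
    rw [Complex.star_def]; apply Complex.ext <;> simp
  rw [h2]
  conv_rhs => rw [h1]
  simp only [Complex.add_re, Complex.ofReal_re, Complex.mul_re, Complex.I_re, mul_zero,
    Complex.ofReal_im, Complex.I_im, mul_one, sub_self, add_zero, Complex.add_im, Complex.mul_im,
    zero_add]
  ring_nf
  rw [Complex.I_sq]
  ring

end Wirtinger

/-! ### Integrals of translates and dilates of a test function -/

section ParamInt

variable {n : ℕ} {S : Type*} [MeasurableSpace S]

/-- The average of `z ↦ F (t z + p)` over a family of parameters, with complex weights. -/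
def paramInt (μ : Measure S) (k : S → ℂ) (t : S → ℝ) (p : S → Cn n) (F : Cn n → ℂ) (z : Cn n) : ℂ :=
  ∫ s, k s * F (t s • z + p s) ∂μ

variable {μ : Measure S} {k : S → ℂ} {t : S → ℝ} {p : S → Cn n} {F : Cn n → ℂ}

lemma integrable_weight_mul (hk : Integrable k μ) (ht : Measurable t) (ht1 : ∀ᵐ s ∂μ, |t s| ≤ 1) :
    Integrable (fun s => k s * (t s : ℂ)) μ := by
  refine hk.mul_bdd (c := 1) (Complex.measurable_ofReal.comp ht).aestronglyMeasurable ?_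
  filter_upwards [ht1] with s hs
  simpa using hs

lemma integrable_paramInt (hk : Integrable k μ) (ht : Measurable t)
    (hp : Measurable p) (hF : Continuous F) (hFc : HasCompactSupport F) (z : Cn n) :
    Integrable (fun s => k s * F (t s • z + p s)) μ := by
  obtain ⟨C, hC⟩ := hF.bounded_above_of_compact_support hFc
  refine hk.mul_bdd (c := C) ?_ (Filter.Eventually.of_forall fun s => hC _)
  exact (hF.measurable.comp ((ht.smul_const z).add hp)).aestronglyMeasurable

/-- Differentiation multiplies the weight by t and differentiates F, so the class of such integrals
is preserved; |t| ≤ 1 keeps the weight integrable. Convolutions are the case t = 1, averages along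
rays the case p = 0. -/
lemma hasFDerivAt_paramInt (hk : Integrable k μ) (ht : Measurable t) (ht1 : ∀ᵐ s ∂μ, |t s| ≤ 1)
    (hp : Measurable p) (hF : ContDiff ℝ ∞ F) (hFc : HasCompactSupport F) (z : Cn n) :
    ∃ L : Cn n →L[ℝ] ℂ, HasFDerivAt (paramInt μ k t p F) L z ∧
      ∀ v, L v = paramInt μ (fun s => k s * (t s : ℂ)) t p (fun y => fderiv ℝ F y v) z := by
  have hF1 : ContDiff ℝ 1 F := hF.of_le (by exact_mod_cast le_top)
  have hdc : Continuous (fderiv ℝ F) := hF1.continuous_fderiv (by simp)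
  obtain ⟨C, hC⟩ := hdc.bounded_above_of_compact_support (hFc.fderiv (𝕜 := ℝ))
  have hm (z : Cn n) : Measurable fun s => t s • z + p s := (ht.smul_const z).add hp
  have hkt := integrable_weight_mul hk ht ht1
  have hmeas : AEStronglyMeasurable
      (fun s => (k s * (t s : ℂ)) • fderiv ℝ F (t s • z + p s)) μ :=
    hkt.1.smul (hdc.comp_aestronglyMeasurable (hm z).aestronglyMeasurable)
  have key := hasFDerivAt_integral_of_dominated_of_fderiv_le (𝕜 := ℝ) (μ := μ)
    (F := fun z s => k s * F (t s • z + p s))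
    (F' := fun z s => (k s * (t s : ℂ)) • fderiv ℝ F (t s • z + p s)) (x₀ := z)
    (s := Set.univ) (bound := fun s => ‖k s * (t s : ℂ)‖ * C) Filter.univ_mem
    (Filter.Eventually.of_forall fun z => (integrable_paramInt hk ht hp hF.continuous hFc z).1)
    (integrable_paramInt hk ht hp hF.continuous hFc z) hmeas
    (Filter.Eventually.of_forall fun s z _ => by
      rw [norm_smul]; exact mul_le_mul_of_nonneg_left (hC _) (norm_nonneg _))
    (hkt.norm.mul_const C)
    (Filter.Eventually.of_forall fun s z _ => by
      have h1 : HasFDerivAt (fun z : Cn n => t s • z + p s)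
          (t s • ContinuousLinearMap.id ℝ (Cn n)) z :=
        ((hasFDerivAt_id z).const_smul (t s)).add_const _
      have h2 := ((hF1.differentiable (by simp) (t s • z + p s)).hasFDerivAt.comp z h1).const_mul
        (k s)
      refine h2.congr_fderiv ?_
      ext v
      simp [mul_assoc])
  refine ⟨_, key, fun v => ?_⟩
  rw [ContinuousLinearMap.integral_apply]
  · rfl
  · exact (hkt.norm.mul_const C).mono' hmeas (Filter.Eventually.of_forall fun s => by
      rw [norm_smul]; exact mul_le_mul_of_nonneg_left (hC _) (norm_nonneg _))

lemma contDiff_fderiv_apply_const (hF : ContDiff ℝ ∞ F) (v : Cn n) :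
    ContDiff ℝ ∞ (fun y => fderiv ℝ F y v) :=
  (hF.fderiv_right (m := ∞) (by simp)).clm_apply contDiff_const

lemma fderiv_paramInt (hk : Integrable k μ) (ht : Measurable t) (ht1 : ∀ᵐ s ∂μ, |t s| ≤ 1)
    (hp : Measurable p) (hF : ContDiff ℝ ∞ F) (hFc : HasCompactSupport F) (z v : Cn n) :
    fderiv ℝ (paramInt μ k t p F) z v =
      paramInt μ (fun s => k s * (t s : ℂ)) t p (fun y => fderiv ℝ F y v) z := by
  obtain ⟨L, hL, h⟩ := hasFDerivAt_paramInt hk ht ht1 hp hF hFc z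
  rw [hL.fderiv, h]

lemma contDiff_paramInt (hk : Integrable k μ) (ht : Measurable t) (ht1 : ∀ᵐ s ∂μ, |t s| ≤ 1)
    (hp : Measurable p) (hF : ContDiff ℝ ∞ F) (hFc : HasCompactSupport F) :
    ContDiff ℝ ∞ (paramInt μ k t p F) := by
  have key (m : ℕ) : ∀ (k : S → ℂ) (F : Cn n → ℂ), Integrable k μ → ContDiff ℝ ∞ F →
      HasCompactSupport F → ContDiff ℝ m (paramInt μ k t p F) := by
    induction m with
    | zero =>
      intro k F hk hF hFc
      refine contDiff_zero.2 (continuous_iff_continuousAt.2 fun z => ?_)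
      obtain ⟨L, hL, -⟩ := hasFDerivAt_paramInt hk ht ht1 hp hF hFc z
      exact hL.continuousAt
    | succ m ih =>
      intro k F hk hF hFc
      rw [Nat.cast_succ, contDiff_succ_iff_fderiv_apply]
      refine ⟨fun z => ?_, by simp, fun v => ?_⟩
      · obtain ⟨L, hL, -⟩ := hasFDerivAt_paramInt hk ht ht1 hp hF hFc z
        exact hL.differentiableAt
      · simp_rw [fderiv_paramInt hk ht ht1 hp hF hFc]
        exact ih _ _ (integrable_weight_mul hk ht ht1) (contDiff_fderiv_apply_const hF v)
          (hFc.fderiv_apply (𝕜 := ℝ) v)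
  exact contDiff_infty.2 fun m => key m k F hk hF hFc

lemma hasCompactSupport_dzbar (hFc : HasCompactSupport F) (j : Fin n) :
    HasCompactSupport (fun y => dzbar j F y) := by
  refine (hFc.fderiv (𝕜 := ℝ)).mono fun y hy => ?_
  contrapose! hy
  simp only [Function.mem_support, not_not] at hy
  simp [dzbar, hy]

lemma hasCompactSupport_dz (hFc : HasCompactSupport F) (j : Fin n) :
    HasCompactSupport (fun y => dz j F y) := by
  refine (hFc.fderiv (𝕜 := ℝ)).mono fun y hy => ?_
  contrapose! hy
  simp only [Function.mem_support, not_not] at hy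
  simp [dz, hy]

lemma dzbar_paramInt (hk : Integrable k μ) (ht : Measurable t) (ht1 : ∀ᵐ s ∂μ, |t s| ≤ 1)
    (hp : Measurable p) (hF : ContDiff ℝ ∞ F) (hFc : HasCompactSupport F) (j : Fin n) (z : Cn n) :
    dzbar j (paramInt μ k t p F) z =
      paramInt μ (fun s => k s * (t s : ℂ)) t p (fun y => dzbar j F y) z := by
  have hkt := integrable_weight_mul hk ht ht1
  have hi (v : Cn n) := integrable_paramInt hkt ht hp (contDiff_fderiv_apply_const hF v).continuous
    (hFc.fderiv_apply (𝕜 := ℝ) v) z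
  rw [dzbar, fderiv_paramInt hk ht ht1 hp hF hFc, fderiv_paramInt hk ht ht1 hp hF hFc, paramInt,
    paramInt, ← integral_const_mul, ← integral_add (hi _) ((hi _).const_mul _), ← integral_div]
  exact integral_congr_ae (Filter.Eventually.of_forall fun s => by simp only [dzbar]; ring)

lemma dz_paramInt (hk : Integrable k μ) (ht : Measurable t) (ht1 : ∀ᵐ s ∂μ, |t s| ≤ 1)
    (hp : Measurable p) (hF : ContDiff ℝ ∞ F) (hFc : HasCompactSupport F) (j : Fin n) (z : Cn n) :
    dz j (paramInt μ k t p F) z =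
      paramInt μ (fun s => k s * (t s : ℂ)) t p (fun y => dz j F y) z := by
  have hkt := integrable_weight_mul hk ht ht1
  have hi (v : Cn n) := integrable_paramInt hkt ht hp (contDiff_fderiv_apply_const hF v).continuous
    (hFc.fderiv_apply (𝕜 := ℝ) v) z
  rw [dz, fderiv_paramInt hk ht ht1 hp hF hFc, fderiv_paramInt hk ht ht1 hp hF hFc, paramInt,
    paramInt, ← integral_const_mul, ← integral_sub (hi _) ((hi _).const_mul _), ← integral_div]
  exact integral_congr_ae (Filter.Eventually.of_forall fun s => by simp only [dz]; ring)

end ParamInt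

/-! ### The Cauchy transform and the local solvability of the `∂̄`-equation -/

/-- Up to the factor r the integrand is the derivative of the 2π-periodic function θ ↦ g(r e^{iθ}).
-/
lemma integral_angular_deriv_eq_zero {g : ℂ → ℂ} (hg : ContDiff ℝ 1 g) {r : ℝ} (hr : 0 < r) :
    ∫ θ in Set.Ioo (-Real.pi) Real.pi,
      fderiv ℝ g (r * Complex.exp (θ * Complex.I)) (Complex.I * Complex.exp (θ * Complex.I)) = 0 := by
  have hd (θ : ℝ) : HasDerivAt (fun θ : ℝ => g (r * Complex.exp (θ * Complex.I)))
      (fderiv ℝ g (r * Complex.exp (θ * Complex.I))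
        (r * (Complex.I * Complex.exp (θ * Complex.I)))) θ := by
    have h1 : HasDerivAt (fun θ : ℝ => (r : ℂ) * Complex.exp (θ * Complex.I))
        (r * (Complex.I * Complex.exp (θ * Complex.I))) θ := by
      have h2 : HasDerivAt (fun θ : ℝ => (θ : ℂ) * Complex.I) (1 * Complex.I) θ :=
        (Complex.ofRealCLM.hasDerivAt (x := θ)).mul_const Complex.I
      refine (h2.cexp.const_mul (r : ℂ)).congr_deriv ?_
      ring
    exact ((hg.differentiable (by simp) _).hasFDerivAt).comp_hasDerivAt θ h1
  have hc : Continuous fun θ : ℝ => fderiv ℝ g (r * Complex.exp (θ * Complex.I))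
        (r * (Complex.I * Complex.exp (θ * Complex.I))) :=
    ((hg.continuous_fderiv (by simp)).comp (by fun_prop)).clm_apply (by fun_prop)
  have key := intervalIntegral.integral_eq_sub_of_hasDerivAt (a := -Real.pi) (b := Real.pi)
    (fun θ _ => hd θ) (hc.intervalIntegrable _ _)
  have h0 : g (r * Complex.exp ((Real.pi : ℝ) * Complex.I)) =
      g (r * Complex.exp ((-Real.pi : ℝ) * Complex.I)) := by
    simp [Complex.exp_neg, Complex.exp_pi_mul_I]
  rw [h0, sub_self, intervalIntegral.integral_of_le (by linarith [Real.pi_pos]),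
    integral_Ioc_eq_integral_Ioo] at key
  have h3 (θ : ℝ) : fderiv ℝ g (r * Complex.exp (θ * Complex.I))
        (r * (Complex.I * Complex.exp (θ * Complex.I))) = (r : ℂ) *
      fderiv ℝ g (r * Complex.exp (θ * Complex.I)) (Complex.I * Complex.exp (θ * Complex.I)) := by
    rw [← Complex.real_smul (x := r) (z := Complex.I * Complex.exp (θ * Complex.I)), map_smul,
      Complex.real_smul]
  simp_rw [h3] at key
  rw [integral_const_mul] at key
  exact (mul_eq_zero.1 key).resolve_left (by exact_mod_cast hr.ne')

lemma integral_radial_deriv {g : ℂ → ℂ} (hg : ContDiff ℝ 1 g) (hgc : HasCompactSupport g) (θ : ℝ) :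
    ∫ r in Set.Ioi (0 : ℝ),
      fderiv ℝ g (r * Complex.exp (θ * Complex.I)) (Complex.exp (θ * Complex.I)) = - g 0 := by
  have hd (r : ℝ) : HasDerivAt (fun r : ℝ => g (r * Complex.exp (θ * Complex.I)))
      (fderiv ℝ g (r * Complex.exp (θ * Complex.I)) (Complex.exp (θ * Complex.I))) r := by
    have h1 : HasDerivAt (fun r : ℝ => (r : ℂ) * Complex.exp (θ * Complex.I))
        (1 * Complex.exp (θ * Complex.I)) r :=
      (Complex.ofRealCLM.hasDerivAt (x := r)).mul_const _
    rw [one_mul] at h1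
    exact ((hg.differentiable (by simp) _).hasFDerivAt).comp_hasDerivAt r h1
  have hc : ContDiff ℝ 1 fun r : ℝ => g (r * Complex.exp (θ * Complex.I)) := by
    refine hg.comp ?_
    exact Complex.ofRealCLM.contDiff.mul contDiff_const
  have hs : HasCompactSupport fun r : ℝ => g (r * Complex.exp (θ * Complex.I)) := by
    obtain ⟨R, hR⟩ := hgc.isCompact.isBounded.subset_closedBall 0
    refine HasCompactSupport.intro (isCompact_Icc (a := -R) (b := R)) fun r hr => ?_
    refine image_eq_zero_of_notMem_tsupport fun h => hr ?_
    have := hR h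
    simp only [mem_closedBall_zero_iff, norm_mul, Complex.norm_exp_ofReal_mul_I, mul_one,
      Complex.norm_real, Real.norm_eq_abs] at this
    exact abs_le.1 this
  have := hs.integral_Ioi_deriv_eq hc 0
  simp only [fun r => (hd r).deriv] at this
  simpa using this

/-- The Cauchy-Pompeiu formula: `∫ ζ⁻¹ ∂g/∂ζ̄ = -π g(0)`. -/
lemma integral_inv_mul_dbar {g : ℂ → ℂ} (hg : ContDiff ℝ 1 g) (hgc : HasCompactSupport g) :
    ∫ ζ : ℂ, ζ⁻¹ * ((fderiv ℝ g ζ 1 + Complex.I * fderiv ℝ g ζ Complex.I) / 2) =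
      -Real.pi * g 0 := by
  -- In polar coordinates ∂g/∂ζ̄ = e^{iθ} (∂_r g + (i / r) ∂_θ g) / 2, and r ζ⁻¹ = e^{-iθ}. The
  -- integrand becomes (A + i B) / 2 with A the radial derivative and B the angular one divided by
  -- r; these contribute -2π g(0) and 0.
  set A : ℝ × ℝ → ℂ := fun p =>
    fderiv ℝ g (p.1 * Complex.exp (p.2 * Complex.I)) (Complex.exp (p.2 * Complex.I)) with hA
  set B : ℝ × ℝ → ℂ := fun p =>
    fderiv ℝ g (p.1 * Complex.exp (p.2 * Complex.I))
      (Complex.I * Complex.exp (p.2 * Complex.I)) with hB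
  have hAc : Continuous A :=
    ((hg.continuous_fderiv (by simp)).comp (by fun_prop)).clm_apply (by fun_prop)
  have hBc : Continuous B :=
    ((hg.continuous_fderiv (by simp)).comp (by fun_prop)).clm_apply (by fun_prop)
  obtain ⟨R, hR⟩ := hgc.isCompact.isBounded.subset_closedBall 0
  have hzero (p : ℝ × ℝ) (hp : R < p.1) :
      fderiv ℝ g (p.1 * Complex.exp (p.2 * Complex.I)) = 0 := by
    refine image_eq_zero_of_notMem_tsupport fun h => ?_
    have := hR (tsupport_fderiv_subset ℝ h)
    simp only [mem_closedBall_zero_iff, norm_mul, Complex.norm_exp_ofReal_mul_I, mul_one,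
      Complex.norm_real, Real.norm_eq_abs] at this
    exact absurd (le_trans (le_abs_self _) this) (not_le.2 hp)
  have hint (C : ℝ × ℝ → ℂ) (hC : Continuous C) (hC0 : ∀ p : ℝ × ℝ, R < p.1 → C p = 0) :
      IntegrableOn C (Set.Ioi 0 ×ˢ Set.Ioo (-Real.pi) Real.pi) (volume.prod volume) := by
    have h1 : IntegrableOn C (Set.Icc 0 R ×ˢ Set.Icc (-Real.pi) Real.pi) (volume.prod volume) :=
      hC.continuousOn.integrableOn_compact (isCompact_Icc.prod isCompact_Icc)
    refine h1.of_forall_sdiff_eq_zero (measurableSet_Ioi.prod measurableSet_Ioo) ?_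
    rintro ⟨r, θ⟩ ⟨⟨h2, h3⟩, h4⟩
    refine hC0 _ (not_le.1 fun h5 => h4 ⟨⟨le_of_lt h2, h5⟩, ⟨h3.1.le, h3.2.le⟩⟩)
  have hAi := hint A hAc fun p hp => by simp [hA, hzero p hp]
  have hBi := hint B hBc fun p hp => by simp [hB, hzero p hp]
  have hIA : ∫ p in Set.Ioi (0 : ℝ) ×ˢ Set.Ioo (-Real.pi) Real.pi, A p ∂(volume.prod volume) =
      -(2 * Real.pi) * g 0 := by
    rw [← setIntegral_prod_swap, setIntegral_prod]
    · simp only [hA, Prod.swap_prod_mk]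
      simp_rw [integral_radial_deriv hg hgc]
      simp [Real.pi_pos.le, two_mul]
      ring
    · exact hAi.swap
  have hIB : ∫ p in Set.Ioi (0 : ℝ) ×ˢ Set.Ioo (-Real.pi) Real.pi, B p ∂(volume.prod volume) =
      0 := by
    rw [setIntegral_prod _ hBi]
    simp only [hB]
    rw [setIntegral_congr_fun measurableSet_Ioi (g := fun _ => 0)]
    · simp
    · intro r hr
      exact integral_angular_deriv_eq_zero hg hr
  rw [← Complex.integral_comp_polarCoord_symm, polarCoord_target, Measure.volume_eq_prod]
  rw [setIntegral_congr_fun (g := fun p => (2 : ℂ)⁻¹ * (A p + Complex.I * B p))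
    (measurableSet_Ioi.prod measurableSet_Ioo)]
  · rw [integral_const_mul, integral_add hAi (hBi.const_mul _), integral_const_mul, hIA, hIB]
    ring
  · rintro ⟨r, θ⟩ ⟨hr, -⟩
    have hr0 : (r : ℂ) ≠ 0 := by exact_mod_cast (ne_of_gt hr : r ≠ 0)
    have hpol : (Complex.polarCoord.symm (r, θ) : ℂ) = r * Complex.exp (θ * Complex.I) := by
      rw [Complex.polarCoord_symm_apply, Complex.exp_mul_I]; push_cast; ring
    have he : Complex.exp (θ * Complex.I) ≠ 0 := Complex.exp_ne_zero _
    have hcs : Complex.exp (θ * Complex.I) = Real.cos θ • (1 : ℂ) + Real.sin θ • Complex.I := by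
      rw [Complex.exp_mul_I]; simp
    have hcs2 : Complex.I * Complex.exp (θ * Complex.I) =
        (-Real.sin θ) • (1 : ℂ) + Real.cos θ • Complex.I := by
      rw [Complex.exp_mul_I]; simp; ring_nf; simp; ring
    have hinv : (Complex.exp (θ * Complex.I))⁻¹ = Real.cos θ - Real.sin θ * Complex.I := by
      rw [← Complex.exp_neg, ← neg_mul, Complex.exp_mul_I]; simp [sub_eq_add_neg]
    simp only [hA, hB, hpol]
    generalize hL : fderiv ℝ g (r * Complex.exp (θ * Complex.I)) = L
    have hlin (a b : ℝ) : L (a • (1 : ℂ) + b • Complex.I) = a * L 1 + b * L Complex.I := by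
      rw [map_add, map_smul, map_smul, Complex.real_smul, Complex.real_smul]
    rw [hcs2, hlin, mul_inv, hinv, hcs, hlin, Complex.real_smul]
    field_simp
    push_cast
    ring_nf
    rw [Complex.I_sq]
    ring

/-- The polar Jacobian r cancels the singularity 1 / r. -/
lemma integrableOn_inv_ball (R : ℝ) : IntegrableOn (fun ζ : ℂ => ζ⁻¹) (Metric.ball 0 R) := by
  have h : Integrable (fun ζ : ℂ => (Set.Iio R).indicator (fun r : ℝ => r⁻¹) ‖ζ‖) := by
    rw [integrable_fun_norm_addHaar volume]
    have h1 : IntegrableOn (fun _ : ℝ => (1 : ℝ)) (Set.Ioo 0 R) :=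
      integrableOn_const (by simp)
    refine IntegrableOn.of_forall_sdiff_eq_zero (s := Set.Ioo 0 R) ?_ measurableSet_Ioi ?_
    · refine h1.congr_fun (fun r hr => ?_) measurableSet_Ioo
      have := hr.1.ne'
      simp [Complex.finrank_real_complex, Set.indicator_of_mem (show r ∈ Set.Iio R from hr.2), this]
    · rintro r ⟨hr, hr2⟩
      have : r ∉ Set.Iio R := fun h => hr2 ⟨hr, h⟩
      simp [this]
  rw [IntegrableOn, ← integrable_norm_iff measurable_inv.aestronglyMeasurable]
  refine (h.integrableOn (s := Metric.ball 0 R)).congr_fun (fun ζ hζ => ?_) measurableSet_ball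
  have : ‖ζ‖ ∈ Set.Iio R := by simpa using hζ
  simp [this]

/-! ### The `∂̄`-equation on small balls -/

section Dolbeault

variable {n : ℕ}

/-- The Cauchy transform in the variable `z_m`, truncated at radius `R`. -/
def cauchyTransform (m : Fin n) (R : ℝ) (F : Cn n → ℂ) : Cn n → ℂ :=
  paramInt (volume.restrict (Metric.ball (0 : ℂ) R)) (fun ζ => (Real.pi : ℂ)⁻¹ * ζ⁻¹) (fun _ => 1)
    (fun ζ => -EuclideanSpace.single m ζ) F

lemma integrable_cauchyKernel (R : ℝ) :
    Integrable (fun ζ : ℂ => (Real.pi : ℂ)⁻¹ * ζ⁻¹) (volume.restrict (Metric.ball (0 : ℂ) R)) :=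
  (integrableOn_inv_ball R).const_mul _

/-- The inclusion of the `m`-th coordinate axis. -/
def axis (m : Fin n) : ℂ →L[ℝ] Cn n :=
  ((ContinuousLinearMap.id ℂ ℂ).smulRight (EuclideanSpace.single m (1 : ℂ))).restrictScalars ℝ

lemma axis_apply (m : Fin n) (ζ : ℂ) : axis m ζ = EuclideanSpace.single m ζ := by
  ext i
  by_cases h : i = m <;> simp [axis, h]

lemma measurable_neg_single (m : Fin n) :
    Measurable fun ζ : ℂ => -(EuclideanSpace.single m ζ : Cn n) := by
  simp_rw [← axis_apply]
  exact (axis m).continuous.measurable.neg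

variable {F : Cn n → ℂ}

lemma contDiff_cauchyTransform (hF : ContDiff ℝ ∞ F) (hFc : HasCompactSupport F)
    (m : Fin n) (R : ℝ) : ContDiff ℝ ∞ (cauchyTransform m R F) :=
  contDiff_paramInt (integrable_cauchyKernel R) measurable_const (by simp)
    (measurable_neg_single m) hF hFc

lemma dzbar_cauchyTransform (hF : ContDiff ℝ ∞ F) (hFc : HasCompactSupport F)
    (m l : Fin n) (R : ℝ) (z : Cn n) :
    dzbar l (cauchyTransform m R F) z = ∫ ζ in Metric.ball (0 : ℂ) R,
      (Real.pi : ℂ)⁻¹ * ζ⁻¹ * dzbar l F (z - EuclideanSpace.single m ζ) := by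
  rw [cauchyTransform, dzbar_paramInt (integrable_cauchyKernel R) measurable_const (by simp)
    (measurable_neg_single m) hF hFc, paramInt]
  simp [sub_eq_add_neg]

/-- The Cauchy-Pompeiu formula on the complex line through z in direction m. By `hz` the function
vanishes on that line for ‖ζ‖ ≥ R, so truncating the kernel changes nothing. -/
lemma dzbar_cauchyTransform_self (hF : ContDiff ℝ ∞ F) (hFc : HasCompactSupport F)
    (m : Fin n) {ρ R : ℝ} (z : Cn n)
    (h0 : ∀ y : Cn n, ρ < ‖y m‖ → F y = 0) (hz : ρ + ‖z m‖ < R) :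
    dzbar m (cauchyTransform m R F) z = F z := by
  have hF1 : ContDiff ℝ 1 F := hF.of_le (by exact_mod_cast le_top)
  set g : ℂ → ℂ := fun ζ => F (z - axis m ζ) with hg
  have hg1 : ContDiff ℝ 1 g := hF1.comp (contDiff_const.sub (axis m).contDiff)
  have hcoord (ζ : ℂ) : (z - axis m ζ) m = z m - ζ := by simp [axis_apply]
  have hgc : HasCompactSupport g := by
    refine HasCompactSupport.intro (isCompact_closedBall (0 : ℂ) R) fun ζ hζ => h0 _ ?_
    rw [hcoord]
    have h1 : R < ‖ζ‖ := by simpa using hζ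
    have h2 : ‖ζ‖ ≤ ‖z m - ζ‖ + ‖z m‖ := by
      calc ‖ζ‖ = ‖-(z m - ζ) + z m‖ := by congr 1; ring
        _ ≤ _ := (norm_add_le _ _).trans (by rw [norm_neg])
    linarith
  have hgd (ζ v : ℂ) : fderiv ℝ g ζ v = -fderiv ℝ F (z - axis m ζ) (axis m v) := by
    have h1 : HasFDerivAt (fun ζ : ℂ => z - axis m ζ) (-axis m) ζ :=
      (axis m).hasFDerivAt.const_sub z
    have h2 : HasFDerivAt g _ ζ := ((hF1.differentiable (by simp) _).hasFDerivAt).comp ζ h1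
    rw [h2.fderiv]
    simp
  have hdz (ζ : ℂ) : dzbar m F (z - EuclideanSpace.single m ζ) =
      -((fderiv ℝ g ζ 1 + Complex.I * fderiv ℝ g ζ Complex.I) / 2) := by
    rw [hgd, hgd, dzbar, axis_apply, axis_apply, axis_apply]
    ring
  rw [dzbar_cauchyTransform hF hFc, setIntegral_eq_integral_of_forall_compl_eq_zero]
  · simp_rw [hdz, mul_neg, mul_assoc]
    rw [integral_neg, integral_const_mul, integral_inv_mul_dbar hg1 hgc]
    have : (Real.pi : ℂ) ≠ 0 := by exact_mod_cast Real.pi_ne_zero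
    simp only [hg, map_zero, sub_zero]
    field_simp
  · intro ζ hζ
    have hopen : IsOpen {y : Cn n | ρ < ‖y m‖} :=
      isOpen_lt continuous_const (by fun_prop)
    have hmem : z - EuclideanSpace.single m ζ ∈ {y : Cn n | ρ < ‖y m‖} := by
      rw [← axis_apply]
      show ρ < ‖(z - axis m ζ) m‖
      rw [hcoord]
      have h1 : R ≤ ‖ζ‖ := by simpa using hζ
      have h2 : ‖ζ‖ ≤ ‖z m - ζ‖ + ‖z m‖ := by
        calc ‖ζ‖ = ‖-(z m - ζ) + z m‖ := by congr 1; ring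
          _ ≤ _ := (norm_add_le _ _).trans (by rw [norm_neg])
      linarith
    have : F =ᶠ[𝓝 (z - EuclideanSpace.single m ζ)] fun _ => 0 :=
      Filter.eventually_of_mem (hopen.mem_nhds hmem) fun y hy => h0 y hy
    rw [dzbar_congr this]
    simp [dzbar]

lemma dzbar_zero (l : Fin n) (z : Cn n) : dzbar l (fun _ => (0 : ℂ)) z = 0 := by simp [dzbar]

/-- Along the line of integration only the m-th coordinate changes, so for z near the origin it
controls the whole norm. -/
lemma norm_le_of_sub_single (m : Fin n) (z : Cn n) (ζ : ℂ) :
    ‖z - EuclideanSpace.single m ζ‖ ≤ ‖(z - EuclideanSpace.single m ζ : Cn n) m‖ + 2 * ‖z‖ := by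
  have h : z - EuclideanSpace.single m ζ =
      EuclideanSpace.single m ((z - EuclideanSpace.single m ζ : Cn n) m) +
        (z - EuclideanSpace.single m (z m)) := by
    ext i
    by_cases hi : i = m
    · subst hi; simp
    · simp [hi]
  have h1 : ‖z m‖ ≤ ‖z‖ := PiLp.norm_apply_le z m
  have h2 : ‖(EuclideanSpace.single m ((z - EuclideanSpace.single m ζ : Cn n) m) : Cn n)‖ =
      ‖(z - EuclideanSpace.single m ζ : Cn n) m‖ := by simp
  have h3 : ‖z - EuclideanSpace.single m (z m)‖ ≤ ‖z‖ + ‖z m‖ :=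
    (norm_sub_le _ _).trans (by simp)
  have h4 := norm_add_le (EuclideanSpace.single m ((z - EuclideanSpace.single m ζ : Cn n) m) : Cn n)
    (z - EuclideanSpace.single m (z m))
  rw [← h] at h4
  linarith

/-- One step of the reduction: a `∂̄`-closed form without `dz̄_k` for `k > m` is, up to a
`∂̄`-exact form and near the origin, without `dz̄_k` for `k ≥ m`. -/
lemma exists_dbar_reduction (m : Fin n) {R : ℝ} (hR : 0 < R) {b : Fin n → Cn n → ℂ}
    (hb : ∀ k, ContDiff ℝ ∞ (b k))
    (hclosed : ∀ l k, ∀ z ∈ Metric.ball (0 : Cn n) R, dzbar l (b k) z = dzbar k (b l) z)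
    (hzero : ∀ k, m < k → ∀ z ∈ Metric.ball (0 : Cn n) R, b k z = 0) :
    ∃ u : Cn n → ℂ, ContDiff ℝ ∞ u ∧ ∃ R', 0 < R' ∧ R' ≤ R ∧
      ∀ k, m ≤ k → ∀ z ∈ Metric.ball (0 : Cn n) R', dzbar k u z = b k z := by
  -- θ depends on z_m alone, so the derivatives ∂/∂z̄_k with k > m do not see it. Θ only provides
  -- compact support: for ‖z‖ < R / 16, points of the line with ‖y m‖ ≤ R / 2 have ‖y‖ ≤ 5R / 8,
  -- where Θ = 1.
  let θ : ContDiffBump (0 : ℂ) := ⟨R / 4, R / 2, by positivity, by linarith⟩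
  let Θ : ContDiffBump (0 : Cn n) := ⟨3 * R / 4, R, by positivity, by linarith⟩
  have hθ : ContDiff ℝ ∞ fun y : Cn n => ((θ (y m) : ℝ) : ℂ) :=
    Complex.ofRealCLM.contDiff.comp (θ.contDiff.comp
      ((EuclideanSpace.proj m : Cn n →L[ℂ] ℂ).restrictScalars ℝ).contDiff)
  have hΘ : ContDiff ℝ ∞ fun y : Cn n => ((Θ y : ℝ) : ℂ) :=
    Complex.ofRealCLM.contDiff.comp Θ.contDiff
  set F : Cn n → ℂ := fun y => (θ (y m) : ℂ) * ((Θ y : ℂ) * b m y) with hFdef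
  have hF : ContDiff ℝ ∞ F := hθ.mul (hΘ.mul (hb m))
  have hFc : HasCompactSupport F := by
    refine HasCompactSupport.intro (isCompact_closedBall (0 : Cn n) R) fun y hy => ?_
    have : Θ y = 0 := Θ.zero_of_le_dist (by simpa using (not_le.1 fun h => hy (by simpa using h)).le)
    simp [hFdef, this]
  have hF0 (y : Cn n) (hy : R / 2 < ‖y m‖) : F y = 0 := by
    have : θ (y m) = 0 := θ.zero_of_le_dist (by simpa using hy.le)
    simp [hFdef, this]
  refine ⟨cauchyTransform m R F, contDiff_cauchyTransform hF hFc m R, R / 16, by positivity,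
    by linarith, fun k hk z hz => ?_⟩
  have hz' : ‖z‖ < R / 16 := by simpa using hz
  have hzm : ‖z m‖ ≤ ‖z‖ := PiLp.norm_apply_le z m
  rcases hk.eq_or_lt with rfl | hk
  · rw [dzbar_cauchyTransform_self hF hFc m z hF0 (by linarith)]
    have h1 : θ (z m) = 1 := θ.one_of_mem_closedBall (by
      rw [mem_closedBall_zero_iff]; show _ ≤ R / 4; linarith)
    have h2 : Θ z = 1 := Θ.one_of_mem_closedBall (by
      rw [mem_closedBall_zero_iff]; show _ ≤ 3 * R / 4; linarith)
    simp [hFdef, h1, h2]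
  · rw [hzero k hk z (by rw [mem_ball_zero_iff]; linarith), dzbar_cauchyTransform hF hFc]
    refine integral_eq_zero_of_ae (Filter.Eventually.of_forall fun ζ => ?_)
    set y : Cn n := z - EuclideanSpace.single m ζ with hy
    suffices h : dzbar k F y = 0 by
      show _ * dzbar k F y = 0
      rw [h, mul_zero]
    by_cases hym : R / 2 < ‖y m‖
    · have hopen : IsOpen {y : Cn n | R / 2 < ‖y m‖} := isOpen_lt continuous_const (by fun_prop)
      rw [dzbar_congr (Filter.eventually_of_mem (hopen.mem_nhds hym) fun y hy => hF0 y hy),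
        dzbar_zero]
    · have hyn : ‖y‖ < 3 * R / 4 := by
        have := norm_le_of_sub_single m z ζ
        rw [← hy] at this
        linarith [not_lt.1 hym]
      have hloc : F =ᶠ[𝓝 y] fun y => (θ (y m) : ℂ) * b m y := by
        refine Filter.eventually_of_mem (Metric.isOpen_ball.mem_nhds
          (show y ∈ Metric.ball (0 : Cn n) (3 * R / 4) by simpa using hyn)) fun x hx => ?_
        have : Θ x = 1 := Θ.one_of_mem_closedBall (Metric.ball_subset_closedBall hx)
        simp [hFdef, this]
      have hθ1 : Differentiable ℝ fun ζ : ℂ => ((θ ζ : ℝ) : ℂ) :=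
        (Complex.ofRealCLM.contDiff.comp (θ.contDiff (n := 1))).differentiable (by simp)
      have hyR : y ∈ Metric.ball (0 : Cn n) R := by rw [mem_ball_zero_iff]; linarith
      -- Closedness exchanges ∂b_m/∂z̄_k for ∂b_k/∂z̄_m, which vanishes because b_k does.
      rw [dzbar_congr hloc, dzbar_mul (hθ.differentiable (by simp) y)
        ((hb m).differentiable (by simp) y), hclosed k m y hyR,
        dzbar_congr (g := fun _ => 0) (Filter.eventually_of_mem
          (Metric.isOpen_ball.mem_nhds hyR) fun x hx => hzero k hk x hx), dzbar_zero,
        dzbar_comp_coord hθ1 hk.ne' y]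
      simp

/-- Local solvability of the `∂̄`-equation for smooth `∂̄`-closed `(0,1)`-forms. -/
lemma exists_dbar_primitive {R : ℝ} (hR : 0 < R) {b : Fin n → Cn n → ℂ}
    (hb : ∀ k, ContDiff ℝ ∞ (b k))
    (hclosed : ∀ l k, ∀ z ∈ Metric.ball (0 : Cn n) R, dzbar l (b k) z = dzbar k (b l) z) :
    ∃ f : Cn n → ℂ, ContDiff ℝ ∞ f ∧ ∃ R', 0 < R' ∧ R' ≤ R ∧
      ∀ k, ∀ z ∈ Metric.ball (0 : Cn n) R', dzbar k f z = b k z := by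
  -- Induction on the number m of differentials dz̄_k that may occur; each step removes the last one
  -- at the price of a smaller ball.
  have key (m : ℕ) : ∀ (R : ℝ), 0 < R → ∀ b : Fin n → Cn n → ℂ, (∀ k, ContDiff ℝ ∞ (b k)) →
      (∀ l k, ∀ z ∈ Metric.ball (0 : Cn n) R, dzbar l (b k) z = dzbar k (b l) z) →
      (∀ k : Fin n, m ≤ k → ∀ z ∈ Metric.ball (0 : Cn n) R, b k z = 0) →
      ∃ f : Cn n → ℂ, ContDiff ℝ ∞ f ∧ ∃ R', 0 < R' ∧ R' ≤ R ∧
        ∀ k, ∀ z ∈ Metric.ball (0 : Cn n) R', dzbar k f z = b k z := by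
    induction m with
    | zero =>
      intro R hR b _ _ h0
      exact ⟨fun _ => 0, contDiff_const, R, hR, le_rfl, fun k z hz => by
        rw [dzbar_zero, h0 k (Nat.zero_le _) z hz]⟩
    | succ m ih =>
      intro R hR b hb hclosed h0
      by_cases hm : m < n
      · obtain ⟨u, hu, R₁, hR₁, hle, hub⟩ := exists_dbar_reduction ⟨m, hm⟩ hR hb hclosed
          fun k hk => h0 k hk
        have hdu (k : Fin n) : ContDiff ℝ ∞ fun z => dzbar k u z := contDiff_dzbar hu k
        obtain ⟨f, hf, R₂, hR₂, hle₂, hfb⟩ := ih R₁ hR₁ (fun k z => b k z - dzbar k u z)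
          (fun k => (hb k).sub (hdu k)) (fun l k z hz => by
            rw [dzbar_sub ((hb k).differentiable (by simp) z) ((hdu k).differentiable (by simp) z),
              dzbar_sub ((hb l).differentiable (by simp) z) ((hdu l).differentiable (by simp) z),
              hclosed l k z (Metric.ball_subset_ball hle hz),
              dzbar_dzbar_comm (hu.of_le (by norm_cast)).contDiffAt])
          (fun k hk z hz => by rw [hub k hk z hz, sub_self])
        refine ⟨fun z => f z + u z, hf.add hu, R₂, hR₂, hle₂.trans hle, fun k z hz => ?_⟩
        rw [dzbar_add (hf.differentiable (by simp) z) (hu.differentiable (by simp) z),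
          hfb k z hz]
        ring
      · exact ih R hR b hb hclosed fun k hk => absurd (hk.trans_lt k.2) hm
  exact key n R hR b hb hclosed fun k hk => absurd k.2 (not_lt.2 hk)

end Dolbeault

/-! ### Local potentials of Kähler forms -/

section LocalPotential

variable {n : ℕ}

/-- The moment `∫₀¹ tⁱ F(tz) dt`. -/
def rayMoment (i : ℕ) (F : Cn n → ℂ) : Cn n → ℂ :=
  paramInt (volume.restrict (Set.Ioc (0 : ℝ) 1)) (fun t => (t : ℂ) ^ i) (fun t => t) (fun _ => 0) F

lemma integrable_pow_Ioc (i : ℕ) :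
    Integrable (fun t : ℝ => (t : ℂ) ^ i) (volume.restrict (Set.Ioc (0 : ℝ) 1)) :=
  ((Complex.continuous_ofReal.pow i).integrableOn_Icc (a := 0) (b := 1)).mono_set
    Set.Ioc_subset_Icc_self

lemma ae_abs_le_one_Ioc : ∀ᵐ t : ℝ ∂(volume.restrict (Set.Ioc (0 : ℝ) 1)), |t| ≤ 1 := by
  filter_upwards [ae_restrict_mem measurableSet_Ioc] with t ht
  rw [abs_of_pos ht.1]; exact ht.2

lemma rayMoment_apply (i : ℕ) (F : Cn n → ℂ) (z : Cn n) :
    rayMoment i F z = ∫ t in (0 : ℝ)..1, (t : ℂ) ^ i * F (t • z) := by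
  rw [rayMoment, paramInt, intervalIntegral.integral_of_le zero_le_one]
  simp

variable {F : Cn n → ℂ}

lemma contDiff_rayMoment (hF : ContDiff ℝ ∞ F) (hFc : HasCompactSupport F) (i : ℕ) :
    ContDiff ℝ ∞ (rayMoment i F) :=
  contDiff_paramInt (t := fun t => t) (integrable_pow_Ioc i) measurable_id ae_abs_le_one_Ioc measurable_const hF hFc

lemma dzbar_rayMoment (hF : ContDiff ℝ ∞ F) (hFc : HasCompactSupport F) (i : ℕ) (j : Fin n)
    (z : Cn n) : dzbar j (rayMoment i F) z = rayMoment (i + 1) (fun y => dzbar j F y) z := by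
  rw [rayMoment, dzbar_paramInt (t := fun t => t) (integrable_pow_Ioc i) measurable_id ae_abs_le_one_Ioc
    measurable_const hF hFc, rayMoment]
  simp_rw [pow_succ]

lemma dz_rayMoment (hF : ContDiff ℝ ∞ F) (hFc : HasCompactSupport F) (i : ℕ) (j : Fin n)
    (z : Cn n) : dz j (rayMoment i F) z = rayMoment (i + 1) (fun y => dz j F y) z := by
  rw [rayMoment, dz_paramInt (t := fun t => t) (integrable_pow_Ioc i) measurable_id ae_abs_le_one_Ioc
    measurable_const hF hFc, rayMoment]
  simp_rw [pow_succ]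

lemma rayMoment_congr {F₁ F₂ : Cn n → ℂ} {R : ℝ}
    (h : ∀ y ∈ Metric.ball (0 : Cn n) R, F₁ y = F₂ y) (i : ℕ) {z : Cn n}
    (hz : z ∈ Metric.ball (0 : Cn n) R) : rayMoment i F₁ z = rayMoment i F₂ z := by
  rw [rayMoment_apply, rayMoment_apply]
  refine intervalIntegral.integral_congr fun t ht => ?_
  rw [Set.uIcc_of_le zero_le_one] at ht
  rw [h]
  rw [mem_ball_zero_iff] at hz ⊢
  rw [norm_smul, Real.norm_eq_abs, abs_of_nonneg ht.1]
  exact lt_of_le_of_lt (mul_le_of_le_one_left (norm_nonneg _) ht.2) hz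

lemma star_rayMoment (i : ℕ) (F : Cn n → ℂ) (z : Cn n) :
    star (rayMoment i F z) = rayMoment i (fun y => star (F y)) z := by
  rw [rayMoment_apply, rayMoment_apply, intervalIntegral.integral_of_le zero_le_one,
    intervalIntegral.integral_of_le zero_le_one, Complex.star_def, ← integral_conj]
  simp

/-- `∫₀¹ d/dt (t² F(tz)) dt = F(z)`. -/
lemma rayMoment_euler (hF : ContDiff ℝ ∞ F) (z : Cn n) :
    2 * rayMoment 1 F z + ∑ j, (z j * rayMoment 2 (fun y => dz j F y) z +
      star (z j) * rayMoment 2 (fun y => dzbar j F y) z) = F z := by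
  have hF1 : ContDiff ℝ 1 F := hF.of_le (by norm_cast)
  have hc (G : Cn n → ℂ) (hG : Continuous G) (i : ℕ) :
      IntervalIntegrable (fun t : ℝ => (t : ℂ) ^ i * G (t • z)) volume 0 1 :=
    Continuous.intervalIntegrable (by fun_prop) _ _
  have hd (t : ℝ) : HasDerivAt (fun t : ℝ => (t : ℂ) ^ 2 * F (t • z))
      (2 * ((t : ℂ) ^ 1 * F (t • z)) + ∑ j, (z j * ((t : ℂ) ^ 2 * dz j F (t • z)) +
        star (z j) * ((t : ℂ) ^ 2 * dzbar j F (t • z)))) t := by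
    have h1 : HasDerivAt (fun t : ℝ => t • z) z t := by
      simpa using (hasDerivAt_id t).smul_const z
    have h2 : HasDerivAt (fun t : ℝ => F (t • z)) (fderiv ℝ F (t • z) z) t :=
      ((hF1.differentiable (by simp) _).hasFDerivAt).comp_hasDerivAt t h1
    have h3 : HasDerivAt (fun t : ℝ => (t : ℂ) ^ 2) (2 * (t : ℂ)) t := by
      simpa using (Complex.ofRealCLM.hasDerivAt (x := t)).fun_pow 2
    refine (h3.mul h2).congr_deriv ?_
    rw [fderiv_eq_sum_wirtinger, Finset.mul_sum, pow_one, mul_assoc]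
    congr 1
    refine Finset.sum_congr rfl fun j _ => ?_
    ring
  have hcz (j : Fin n) : Continuous fun y => dz j F y := (contDiff_dz hF j).continuous
  have hczb (j : Fin n) : Continuous fun y => dzbar j F y := (contDiff_dzbar hF j).continuous
  have hi1 := (hc F hF.continuous 1).const_mul 2
  have hi2 (j : Fin n) := ((hc _ (hcz j) 2).const_mul (z j)).add
    ((hc _ (hczb j) 2).const_mul (star (z j)))
  have hi3 : IntervalIntegrable (fun t : ℝ => ∑ j, (z j * ((t : ℂ) ^ 2 * dz j F (t • z)) +
      star (z j) * ((t : ℂ) ^ 2 * dzbar j F (t • z)))) volume 0 1 := by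
    refine Continuous.intervalIntegrable (continuous_finsetSum _ fun j _ => ?_) _ _
    have h1 : Continuous fun t : ℝ => dz j F (t • z) := (hcz j).comp (by fun_prop)
    have h2 : Continuous fun t : ℝ => dzbar j F (t • z) := (hczb j).comp (by fun_prop)
    fun_prop
  have key := intervalIntegral.integral_eq_sub_of_hasDerivAt (a := 0) (b := 1) (fun t _ => hd t)
    (hi1.add hi3)
  rw [intervalIntegral.integral_add hi1 hi3,
    intervalIntegral.integral_const_mul, intervalIntegral.integral_finsetSum fun j _ => hi2 j,
    ← rayMoment_apply] at key
  have h4 (j : Fin n) : ∫ t in (0 : ℝ)..1, (z j * ((t : ℂ) ^ 2 * dz j F (t • z)) +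
        star (z j) * ((t : ℂ) ^ 2 * dzbar j F (t • z))) =
      z j * rayMoment 2 (fun y => dz j F y) z +
        star (z j) * rayMoment 2 (fun y => dzbar j F y) z := by
    rw [intervalIntegral.integral_add ((hc _ (hcz j) 2).const_mul (z j))
      ((hc _ (hczb j) 2).const_mul (star (z j))), intervalIntegral.integral_const_mul,
      intervalIntegral.integral_const_mul, ← rayMoment_apply, ← rayMoment_apply]
  simp_rw [h4] at key
  simpa using key

/-- A smooth closed real `(1,1)`-form on a ball has a smooth potential near the centre. -/
lemma exists_potential_ball {R : ℝ} (hR : 0 < R) {G : Cn n → Matrix (Fin n) (Fin n) ℂ}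
    (hG : ∀ j k, ContDiff ℝ ∞ fun z => G z j k) (hGc : ∀ j k, HasCompactSupport fun z => G z j k)
    (hherm : ∀ z ∈ Metric.ball (0 : Cn n) R, ∀ j k, star (G z j k) = G z k j)
    (hclosed : ∀ z ∈ Metric.ball (0 : Cn n) R, ∀ l j k,
      dz l (fun y => G y j k) z = dz j (fun y => G y l k) z) :
    ∃ ψ : Cn n → ℝ, ContDiff ℝ ∞ ψ ∧ ∃ R', 0 < R' ∧
      ∀ z ∈ Metric.ball (0 : Cn n) R', levi ψ z = G z := by
  have hGd (j k : Fin n) (z : Cn n) : DifferentiableAt ℝ (fun z => G z j k) z :=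
    (hG j k).differentiable (by simp) z
  have hconj (l j k : Fin n) : ∀ z ∈ Metric.ball (0 : Cn n) R,
      star (dz l (fun y => G y k j) z) = dzbar l (fun y => G y j k) z := fun z hz => by
    rw [← dzbar_star (hGd k j z)]
    exact dzbar_congr (Filter.eventually_of_mem (Metric.isOpen_ball.mem_nhds hz)
      fun y hy => hherm y hy k j) l
  have hclosed' (l j k : Fin n) : ∀ z ∈ Metric.ball (0 : Cn n) R,
      dzbar l (fun y => G y j k) z = dzbar k (fun y => G y j l) z := fun z hz => by
    rw [← hconj l j k z hz, ← hconj k j l z hz, hclosed z hz l k j]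
  -- The (0,1)-part of the Poincaré homotopy along rays. It is ∂̄-closed because G is closed, and if
  -- ∂̄f = b then 2 Re f is a potential of G.
  set b : Fin n → Cn n → ℂ := fun k z => ∑ j, z j * rayMoment 1 (fun y => G y j k) z with hb
  have hcoord (j : Fin n) : ContDiff ℝ ∞ fun z : Cn n => z j :=
    ((EuclideanSpace.proj j : Cn n →L[ℂ] ℂ).restrictScalars ℝ).contDiff
  have hm (j k : Fin n) := contDiff_rayMoment (hG j k) (hGc j k) 1
  have hbs (k : Fin n) : ContDiff ℝ ∞ (b k) :=
    ContDiff.sum fun j _ => (hcoord j).mul (hm j k)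
  have hdzbar (l k : Fin n) (z : Cn n) : dzbar l (b k) z =
      ∑ j, z j * rayMoment 2 (fun y => dzbar l (fun y => G y j k) y) z := by
    rw [hb]
    simp only
    rw [dzbar_sum _ fun j _ => ((hcoord j).mul (hm j k)).differentiable (by simp) z]
    refine Finset.sum_congr rfl fun j _ => ?_
    rw [dzbar_mul ((hcoord j).differentiable (by simp) z) ((hm j k).differentiable (by simp) z),
      dzbar_coord, dzbar_rayMoment (hG j k) (hGc j k)]
    simp
  have hdz (l k : Fin n) (z : Cn n) : dz l (b k) z = rayMoment 1 (fun y => G y l k) z +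
      ∑ j, z j * rayMoment 2 (fun y => dz l (fun y => G y j k) y) z := by
    rw [hb]
    simp only
    rw [dz_sum _ fun j _ => ((hcoord j).mul (hm j k)).differentiable (by simp) z]
    have (j : Fin n) : dz l (fun y => y j * rayMoment 1 (fun y => G y j k) y) z =
        (if j = l then rayMoment 1 (fun y => G y j k) z else 0) +
          z j * rayMoment 2 (fun y => dz l (fun y => G y j k) y) z := by
      rw [dz_mul ((hcoord j).differentiable (by simp) z) ((hm j k).differentiable (by simp) z),
        dz_coord, dz_rayMoment (hG j k) (hGc j k)]
      split_ifs <;> ring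
    simp_rw [this]
    rw [Finset.sum_add_distrib]
    simp
  obtain ⟨f, hf, R', hR', hle, hfb⟩ := exists_dbar_primitive hR hbs fun l k z hz => by
    rw [hdzbar, hdzbar]
    exact Finset.sum_congr rfl fun j _ => by rw [rayMoment_congr (hclosed' l j k) 2 hz]
  have hre (z : Cn n) : ((2 * (f z).re : ℝ) : ℂ) = f z + star (f z) := by
    rw [Complex.star_def, Complex.add_conj]
  refine ⟨fun z => 2 * (f z).re, contDiff_const.mul (Complex.reCLM.contDiff.comp hf), R', hR',
    fun z hz => ?_⟩
  have hzR := Metric.ball_subset_ball hle hz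
  have hfs : ContDiff ℝ ∞ fun y => star (f y) :=
    Complex.conjCLE.toContinuousLinearMap.contDiff.comp hf
  ext m k
  show dz m (fun y => dzbar k (fun y => ((2 * (f y).re : ℝ) : ℂ)) y) z = _
  simp_rw [hre]
  have h1 : (fun y => dzbar k (fun y => f y + star (f y)) y) =
      fun y => dzbar k f y + dzbar k (fun y => star (f y)) y := by
    ext y
    exact dzbar_add (hf.differentiable (by simp) y) (hfs.differentiable (by simp) y) k
  have h2 : dz m (fun y => dzbar k f y) z = dz m (b k) z :=
    dz_congr (Filter.eventually_of_mem (Metric.isOpen_ball.mem_nhds hz) fun y hy => hfb k y hy) m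
  have h3 : dz m (fun y => dzbar k (fun y => star (f y)) y) z = star (dz k (b m) z) := by
    rw [dz_dzbar_comm (hfs.of_le (by norm_cast)).contDiffAt,
      ← dzbar_star ((hbs m).differentiable (by simp) z)]
    refine dzbar_congr (Filter.eventually_of_mem (Metric.isOpen_ball.mem_nhds hz) fun y hy => ?_) k
    rw [dz_star (hf.differentiable (by simp) y), hfb m y hy]
  -- The sum of ∂b_k/∂z_m and the conjugate of ∂b_m/∂z_k becomes, after closedness and the Hermitian
  -- symmetry are used, the left side of `rayMoment_euler` for G m k.
  rw [h1, dz_add ((contDiff_dzbar hf k).differentiable (by simp) z)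
    ((contDiff_dzbar hfs k).differentiable (by simp) z), h2, h3, hdz, hdz, star_add, star_sum,
    star_rayMoment, ← rayMoment_euler (hG m k) z]
  have h4 : rayMoment 1 (fun y => star (G y k m)) z = rayMoment 1 (fun y => G y m k) z :=
    rayMoment_congr (fun y hy => hherm y hy k m) 1 hzR
  have h5 (j : Fin n) : rayMoment 2 (fun y => dz m (fun y => G y j k) y) z =
      rayMoment 2 (fun y => dz j (fun y => G y m k) y) z :=
    rayMoment_congr (fun y hy => hclosed y hy m j k) 2 hzR
  have h6 (j : Fin n) : star (z j * rayMoment 2 (fun y => dz k (fun y => G y j m) y) z) =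
      star (z j) * rayMoment 2 (fun y => dzbar j (fun y => G y m k) y) z := by
    rw [star_mul', star_rayMoment]
    congr 1
    refine rayMoment_congr (fun y hy => ?_) 2 hzR
    rw [hclosed y hy k j m, hconj j m k y hy]
  simp_rw [h4, h5, h6]
  rw [Finset.sum_add_distrib]
  ring

lemma levi_comp_add_const (q : Cn n → ℝ) (c z : Cn n) :
    levi (fun y => q (y + c)) z = levi q (z + c) := by
  ext j k
  simp only [levi, Matrix.of_apply]
  rw [← dz_comp_add_const]
  congr 1
  ext y
  exact dzbar_comp_add_const (fun y => (q y : ℂ)) c y k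

variable {X : Type*} [TopologicalSpace X] [ChartedSpace (Cn n) X]

/-- A Kähler form has smooth local potentials. -/
lemma KahlerForm.exists_potential (κ : KahlerForm n X) {e : OpenPartialHomeomorph X (Cn n)}
    (he : e ∈ holCharts n X) {x : Cn n} (hx : x ∈ e.target) :
    ∃ ψ : Cn n → ℝ, ContDiff ℝ ∞ ψ ∧ ∃ R, 0 < R ∧ Metric.ball x R ⊆ e.target ∧
      ∀ z ∈ Metric.ball x R, levi ψ z = κ.coeff e z := by
  obtain ⟨R, hR, hball⟩ := Metric.isOpen_iff.1 e.open_target x hx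
  -- The cutoff makes the coefficients globally smooth with compact support; closedness is needed,
  -- and survives, only on the ball where χ = 1.
  let χ : ContDiffBump x := ⟨R / 4, R / 2, by positivity, by linarith⟩
  have hχs : tsupport χ ⊆ e.target := by
    rw [χ.tsupport_eq]
    exact (Metric.closedBall_subset_ball (show R / 2 < R by linarith)).trans hball
  set G₀ : Cn n → Matrix (Fin n) (Fin n) ℂ := fun z => (χ z : ℂ) • κ.coeff e z with hG₀
  have hG₀z (z : Cn n) (hz : z ∉ tsupport χ) : G₀ z = 0 := by
    simp [hG₀, image_eq_zero_of_notMem_tsupport hz]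
  have hχ : ContDiff ℝ ∞ fun z => (χ z : ℂ) := Complex.ofRealCLM.contDiff.comp χ.contDiff
  have hG₀s (j k : Fin n) : ContDiff ℝ ∞ fun z => G₀ z j k := by
    rw [contDiff_iff_contDiffAt]
    intro z
    by_cases hz : z ∈ tsupport χ
    · have := (κ.smooth e he j k).contDiffAt (e.open_target.mem_nhds (hχs hz))
      exact hχ.contDiffAt.mul this
    · refine contDiffAt_const (c := (0 : ℂ)) |>.congr_of_eventuallyEq ?_
      filter_upwards [(isClosed_tsupport χ).isOpen_compl.mem_nhds hz] with y hy
      rw [hG₀z y hy]; rfl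
  have hG₀1 (z : Cn n) (hz : z ∈ Metric.ball x (R / 4)) : G₀ z = κ.coeff e z := by
    have : χ z = 1 := χ.one_of_mem_closedBall (Metric.ball_subset_closedBall hz)
    simp [hG₀, this]
  have hsub : Metric.ball x (R / 4) ⊆ e.target :=
    (Metric.ball_subset_ball (by linarith)).trans hball
  have hmem (z : Cn n) (hz : z ∈ Metric.ball (0 : Cn n) (R / 4)) :
      z + x ∈ Metric.ball x (R / 4) := by simpa [dist_eq_norm] using hz
  obtain ⟨ψ, hψ, R', hR', h⟩ := exists_potential_ball (R := R / 4) (by positivity)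
    (G := fun z => G₀ (z + x)) (fun j k => (hG₀s j k).comp (contDiff_id.add contDiff_const))
    (fun j k => by
      refine HasCompactSupport.intro (isCompact_closedBall (0 : Cn n) R) fun y hy => ?_
      rw [hG₀z]
      · rfl
      · rw [χ.tsupport_eq]
        intro h
        have h2 : ‖y‖ ≤ R / 2 := by simpa [dist_eq_norm] using h
        exact hy (by rw [mem_closedBall_zero_iff]; linarith))
    (fun z hz j k => by
      rw [hG₀1 _ (hmem z hz)]
      exact (κ.posDef e he _ (hsub (hmem z hz))).isHermitian.apply k j)
    (fun z hz l j k => by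
      have hloc (j k : Fin n) : (fun y => G₀ y j k) =ᶠ[𝓝 (z + x)] fun y => κ.coeff e y j k :=
        Filter.eventually_of_mem (Metric.isOpen_ball.mem_nhds (hmem z hz)) fun y hy => by
          show G₀ y j k = κ.coeff e y j k
          rw [hG₀1 y hy]
      rw [dz_comp_add_const (fun y => G₀ y j k), dz_comp_add_const (fun y => G₀ y l k),
        dz_congr (hloc j k), dz_congr (hloc l k)]
      exact κ.closed e he _ (hsub (hmem z hz)) l j k)
  refine ⟨fun z => ψ (z + -x), hψ.comp (contDiff_id.add contDiff_const), min R' (R / 4),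
    by positivity, (Metric.ball_subset_ball (min_le_right _ _)).trans hsub, fun z hz => ?_⟩
  rw [levi_comp_add_const, h]
  · rw [neg_add_cancel_right, hG₀1 z (Metric.ball_subset_ball (min_le_right _ _) hz)]
  · have := Metric.ball_subset_ball (min_le_left _ _) hz
    simpa [dist_eq_norm, sub_eq_add_neg] using this

end LocalPotential

/-! ### Linearization of the operator -/

section Linearization

open Matrix

variable {n : ℕ}

lemma angleSet_nonempty {θ : ℝ} (h0 : 0 < θ) : (angleSet n θ).Nonempty := by
  rcases Nat.eq_zero_or_pos n with rfl | hn
  · exact ⟨0, fun k => k.elim0⟩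
  · have hn' : (0 : ℝ) < n := by exact_mod_cast hn
    obtain ⟨t, ht⟩ := (tendsto_arccot_atTop.eventually (gt_mem_nhds (div_pos h0 hn'))).exists
    refine ⟨fun _ => t, fun k => ?_⟩
    have h1 : ∑ j ∈ Finset.univ.erase k, arccot t ≤ ∑ _j : Fin n, arccot t :=
      Finset.sum_le_sum_of_subset_of_nonneg (Finset.erase_subset _ _)
        fun _ _ _ => (arccot_pos t).le
    rw [Finset.sum_const (s := Finset.univ), Finset.card_univ, Fintype.card_fin, nsmul_eq_mul] at h1
    have h2 : (n : ℝ) * arccot t < n * (θ / n) := mul_lt_mul_of_pos_left ht hn'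
    rw [mul_div_cancel₀ _ hn'.ne'] at h2
    linarith

/-- A point outside of `angleSet n θ` is separated from it by a linear form with nonnegative
coefficients. -/
lemma exists_separating_weights {θ : ℝ} (h0 : 0 < θ) (hθ : θ < Real.pi) {x : Fin n → ℝ}
    (hx : x ∉ angleSet n θ) : ∃ (w : Fin n → ℝ) (b : ℝ), (∀ j, 0 ≤ w j) ∧ (∃ j, w j ≠ 0) ∧
      ∑ j, w j * x j < b ∧ ∀ y ∈ angleSet n θ, b ≤ ∑ j, w j * y j := by
  obtain ⟨f, b, hfx, hfb⟩ := geometric_hahn_banach_point_closed (angleSet_convex hθ)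
    angleSet_isClosed hx
  have hf (y : Fin n → ℝ) : f y = ∑ j, f (Pi.single j 1) * y j := by
    conv_lhs => rw [pi_eq_sum_univ' y, map_sum]
    refine Finset.sum_congr rfl fun j _ => ?_
    rw [map_smul, smul_eq_mul, mul_comm]
  obtain ⟨y, hy⟩ := angleSet_nonempty (n := n) h0
  refine ⟨fun j => f (Pi.single j 1), b, fun j => ?_, ?_, by rwa [← hf], fun y hy => by
    rw [← hf]; exact (hfb y hy).le⟩
  -- A negative weight would let the linear form decrease below b along a coordinate direction in
  -- which `angleSet` is unbounded upwards.
  · by_contra! hj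
    have hmem (t : ℝ) (ht : 0 ≤ t) : y + t • Pi.single j (1 : ℝ) ∈ angleSet n θ := by
      refine angleSet_upper hy (le_add_of_nonneg_right ?_)
      exact smul_nonneg ht (Pi.single_nonneg.2 zero_le_one)
    have h1 := hfb y hy
    have h2 := hfb _ (hmem ((f y - b) / -f (Pi.single j 1))
      (div_nonneg (by linarith) (by linarith)))
    rw [map_add, map_smul, smul_eq_mul, div_mul_eq_mul_div, div_neg, mul_div_assoc,
      div_self hj.ne] at h2
    linarith
  · by_contra! h
    have h1 := hfb y hy
    rw [hf] at h1 hfx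
    simp only [h, zero_mul, Finset.sum_const_zero] at h1 hfx
    linarith

lemma fderiv_fderiv_ofReal {q : Cn n → ℝ} {z : Cn n} (hq : ContDiffAt ℝ 2 q z) (v w : Cn n) :
    fderiv ℝ (fderiv ℝ fun y => (q y : ℂ)) z v w = (fderiv ℝ (fderiv ℝ q) z v w : ℂ) := by
  have h1 : (fderiv ℝ fun y => (q y : ℂ)) =ᶠ[𝓝 z]
      fun y => Complex.ofRealCLM ∘L fderiv ℝ q y := by
    filter_upwards [ContDiffAt.eventually_differentiableAt_of_two hq] with y hy
    exact (Complex.ofRealCLM.hasFDerivAt.comp y hy.hasFDerivAt).fderiv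
  have h2 : HasFDerivAt (fun y => Complex.ofRealCLM ∘L fderiv ℝ q y)
      (((ContinuousLinearMap.compL ℝ (Cn n) ℝ ℂ) Complex.ofRealCLM) ∘L
        fderiv ℝ (fderiv ℝ q) z) z :=
    ((ContinuousLinearMap.compL ℝ (Cn n) ℝ ℂ) Complex.ofRealCLM).hasFDerivAt.comp z
      (ContDiffAt.differentiableAt_fderiv_of_two hq).hasFDerivAt
  rw [h1.fderiv_eq, h2.fderiv]
  simp

lemma contDiffAt_ofReal {q : Cn n → ℝ} {z : Cn n} {m : WithTop ℕ∞} (hq : ContDiffAt ℝ m q z) :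
    ContDiffAt ℝ m (fun y => (q y : ℂ)) z :=
  Complex.ofRealCLM.contDiff.contDiffAt.comp z hq

lemma levi_apply {q : Cn n → ℝ} {z : Cn n} (hq : ContDiffAt ℝ 2 q z) (j k : Fin n) :
    levi q z j k = ((fderiv ℝ (fderiv ℝ q) z (ex j) (ex k) + fderiv ℝ (fderiv ℝ q) z (ey j) (ey k) :
        ℝ) + Complex.I * (fderiv ℝ (fderiv ℝ q) z (ex j) (ey k)
          - fderiv ℝ (fderiv ℝ q) z (ey j) (ex k) : ℝ)) / 4 := by
  have := dz_dzbar (contDiffAt_ofReal hq) j k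
  simp only [fderiv_fderiv_ofReal hq] at this
  rw [levi, of_apply]
  push_cast
  exact this

lemma levi_isHermitian {q : Cn n → ℝ} {z : Cn n} (hq : ContDiffAt ℝ 2 q z) :
    (levi q z).IsHermitian := by
  refine Matrix.IsHermitian.ext fun j k => ?_
  rw [levi_apply hq, levi_apply hq, fderiv_fderiv_symm hq (ex k) (ex j),
    fderiv_fderiv_symm hq (ex k) (ey j), fderiv_fderiv_symm hq (ey k) (ey j),
    fderiv_fderiv_symm hq (ey k) (ex j)]
  simp only [star_div₀, star_add, star_mul', Complex.star_def, Complex.conj_ofReal, Complex.conj_I]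
  push_cast
  simp only [map_ofNat]
  ring

/-- The vector whose coordinates are the conjugates of the `j`-th column of `S`. -/
def conjCol (S : Matrix (Fin n) (Fin n) ℂ) (j : Fin n) : Cn n := WithLp.toLp 2 fun a => star (S a j)

/-- The Levi form in a direction v is a quarter of the real Hessian summed over v and i v. The
column is conjugated because the first index of `levi` is the holomorphic derivative. -/
lemma re_frame_levi {q : Cn n → ℝ} {z : Cn n} (hq : ContDiffAt ℝ 2 q z)
    (S : Matrix (Fin n) (Fin n) ℂ) (j : Fin n) :
    ((Sᴴ * levi q z * S) j j).re =
      (fderiv ℝ (fderiv ℝ q) z (conjCol S j) (conjCol S j) +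
        fderiv ℝ (fderiv ℝ q) z (Complex.I • conjCol S j) (Complex.I • conjCol S j)) / 4 := by
  set D := fderiv ℝ (fderiv ℝ q) z with hD
  set v := conjCol S j with hv
  have hexp (u : Cn n) : D u u = ∑ a, ∑ b, ((u a).re * (u b).re * D (ex a) (ex b) +
      (u a).re * (u b).im * D (ex a) (ey b) + (u a).im * (u b).re * D (ey a) (ex b) +
      (u a).im * (u b).im * D (ey a) (ey b)) := by
    conv_lhs => rw [eq_sum_ex_ey u, map_sum]
    refine (Finset.sum_congr rfl fun b _ => ?_).trans Finset.sum_comm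
    rw [map_sum, _root_.sum_apply]
    refine Finset.sum_congr rfl fun a _ => ?_
    simp only [map_add, map_smul, _root_.add_apply, _root_.smul_apply, smul_eq_mul]
    ring
  rw [hexp, hexp, ← Finset.sum_add_distrib, Finset.sum_div, Matrix.mul_assoc, mul_apply,
    Complex.re_sum]
  refine Finset.sum_congr rfl fun a _ => ?_
  rw [← Finset.sum_add_distrib, Finset.sum_div, mul_apply, Finset.mul_sum, Complex.re_sum]
  refine Finset.sum_congr rfl fun b _ => ?_
  have h1 (c : Fin n) : v c = star (S c j) := rfl
  have h2 (c : Fin n) : (Complex.I • v) c = Complex.I * v c := rfl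
  rw [levi_apply hq, conjTranspose_apply, h2, h2, h1, h1]
  simp only [Complex.mul_re, Complex.mul_im, Complex.I_re, Complex.I_im, Complex.star_def,
    Complex.conj_re, Complex.conj_im, Complex.div_ofNat_re, Complex.div_ofNat_im, Complex.add_re,
    Complex.add_im, Complex.ofReal_re, Complex.ofReal_im]
  ring

/-- The directions of the linear operator `∑ w_j (Sᴴ (∂²/∂z∂z̄) S)_{jj}`. -/
def weightedFrame (w : Fin n → ℝ) (S : Matrix (Fin n) (Fin n) ℂ) : Fin n ⊕ Fin n → Cn n :=
  Sum.elim (fun j => (Real.sqrt (w j) / 2) • conjCol S j)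
    (fun j => (Real.sqrt (w j) / 2) • Complex.I • conjCol S j)

lemma sumSq_weightedFrame {w : Fin n → ℝ} (hw : ∀ j, 0 ≤ w j) (S : Matrix (Fin n) (Fin n) ℂ)
    {q : Cn n → ℝ} {z : Cn n} (hq : ContDiffAt ℝ 2 q z) :
    sumSq (weightedFrame w S) q z = ∑ j, w j * ((Sᴴ * levi q z * S) j j).re := by
  simp only [sumSq, weightedFrame, Fintype.sum_sum_type, Sum.elim_inl, Sum.elim_inr]
  rw [← Finset.sum_add_distrib]
  refine Finset.sum_congr rfl fun j _ => ?_
  rw [re_frame_levi hq]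
  simp only [map_smul, _root_.smul_apply, smul_eq_mul]
  linear_combination (fderiv ℝ (fderiv ℝ q) z (conjCol S j) (conjCol S j) +
    fderiv ℝ (fderiv ℝ q) z (Complex.I • conjCol S j) (Complex.I • conjCol S j)) / 4 *
    Real.mul_self_sqrt (hw j)

lemma weightedFrame_ne_zero {w : Fin n → ℝ} (hw : ∀ j, 0 ≤ w j) (hw0 : ∃ j, w j ≠ 0)
    {H S : Matrix (Fin n) (Fin n) ℂ} (hS : Sᴴ * H * S = 1) : ∃ i, weightedFrame w S i ≠ 0 := by
  obtain ⟨j, hj⟩ := hw0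
  refine ⟨Sum.inl j, ?_⟩
  have hs : Real.sqrt (w j) / 2 ≠ 0 := by
    have := Real.sqrt_pos.2 (lt_of_le_of_ne (hw j) hj.symm)
    positivity
  refine smul_ne_zero hs fun h => ?_
  have hcol (a : Fin n) : S a j = 0 := by
    have : star (S a j) = 0 := congrArg (fun v : Cn n => v a) h
    simpa using this
  have := congrFun (congrFun hS j) j
  rw [mul_apply] at this
  simp [hcol] at this

end Linearization

/-! ### Regularization of viscosity subsolutions -/

section Regularization

open Matrix

variable {n : ℕ}

/-- The mollifier at scale `δ`. -/
def scaledMollifier (ρ : Cn n → ℝ) (δ : ℝ) (v : Cn n) : ℝ :=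
  |(δ ^ Module.finrank ℝ (Cn n))⁻¹| * ρ (δ⁻¹ • v)

variable {ρ : Cn n → ℝ} {δ : ℝ}

lemma scaledMollifier_contDiff (hρ : IsMollifier ρ) : ContDiff ℝ ∞ (scaledMollifier ρ δ) :=
  contDiff_const.mul (hρ.smooth.comp (contDiff_const_smul _))

lemma scaledMollifier_nonneg (hρ : IsMollifier ρ) (v : Cn n) : 0 ≤ scaledMollifier ρ δ v :=
  mul_nonneg (abs_nonneg _) (hρ.nonneg _)

lemma scaledMollifier_eq_zero (hρ : IsMollifier ρ) (hδ : 0 < δ) {v : Cn n} (hv : δ < ‖v‖) :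
    scaledMollifier ρ δ v = 0 := by
  rw [scaledMollifier, hρ.zero_of_one_lt, mul_zero]
  rw [norm_smul, norm_inv, Real.norm_eq_abs, abs_of_pos hδ, inv_mul_eq_div, one_lt_div hδ]
  exact hv

lemma hasCompactSupport_scaledMollifier (hρ : IsMollifier ρ) (hδ : 0 < δ) :
    HasCompactSupport (scaledMollifier ρ δ) :=
  HasCompactSupport.intro (isCompact_closedBall (0 : Cn n) δ) fun v hv =>
    scaledMollifier_eq_zero hρ hδ (by simpa using hv)

/-- Rescaling the variable in the integral defining the regularization. -/
lemma integral_mul_mollifier (ρ : Cn n → ℝ) (hδ : 0 < δ) (f : Cn n → ℝ) (z : Cn n) :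
    ∫ w, f (z - δ • w) * ρ w = ∫ y, f y * scaledMollifier ρ δ (z - y) := by
  have h1 := Measure.integral_comp_smul (volume : Measure (Cn n))
    (fun y => f (z - y) * ρ (δ⁻¹ • y)) δ
  have h2 (w : Cn n) : δ⁻¹ • δ • w = w := inv_smul_smul₀ hδ.ne' w
  simp only [h2] at h1
  rw [h1, ← integral_sub_left_eq_self (fun y => f y * scaledMollifier ρ δ (z - y)) volume z,
    ← integral_smul]
  refine integral_congr_ae (Filter.Eventually.of_forall fun y => ?_)
  simp only [scaledMollifier, sub_sub_cancel, smul_eq_mul]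
  ring

lemma integral_scaledMollifier_sub (hρ : IsMollifier ρ) (hδ : 0 < δ) (z : Cn n) :
    ∫ y, scaledMollifier ρ δ (z - y) = 1 := by
  have := integral_mul_mollifier ρ hδ (fun _ => 1) z
  simp only [one_mul] at this
  rw [← this, hρ.integral_eq_one]

lemma scaledMollifier_sub_eq_zero (hρ : IsMollifier ρ) (hδ : 0 < δ) {z y : Cn n}
    (hy : y ∉ Metric.closedBall z δ) : scaledMollifier ρ δ (z - y) = 0 :=
  scaledMollifier_eq_zero hρ hδ (by
    rw [Metric.mem_closedBall, dist_comm, dist_eq_norm] at hy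
    exact not_le.1 hy)

lemma exists_closedBall_subset_of_mem_shrink {O : Set (Cn n)} (hO : IsOpen O) (hδ : 0 < δ) {z : Cn n} (hz : z ∈ shrink O δ) :
    ∃ s, 0 < s ∧ Metric.closedBall z (s + δ) ⊆ O := by
  obtain ⟨s, hs, h⟩ := (isCompact_closedBall z δ).exists_cthickening_subset_open hO hz
  exact ⟨s, hs, by rwa [cthickening_closedBall hs.le hδ.le] at h⟩

/-- Near a point of `O_δ` the regularization is the real part of an integral over translates of the
mollifier. -/
lemma regularize_eventuallyEq (hρ : IsMollifier ρ) (hδ : 0 < δ) {φ : Cn n → EReal} {z : Cn n}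
    {s : ℝ} (hs : 0 < s) :
    regularize ρ δ φ =ᶠ[𝓝 z] fun x => (paramInt volume
      (fun y => (((Metric.closedBall z (s + δ)).indicator (fun y => (φ y).toReal) y : ℝ) : ℂ))
      (fun _ => 1) (fun y => -y) (fun v => (scaledMollifier ρ δ v : ℂ)) x).re := by
  filter_upwards [Metric.ball_mem_nhds z hs] with x hx
  have h1 : paramInt volume
      (fun y => (((Metric.closedBall z (s + δ)).indicator (fun y => (φ y).toReal) y : ℝ) : ℂ))
      (fun _ => 1) (fun y => -y) (fun v => (scaledMollifier ρ δ v : ℂ)) x =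
      ((∫ y, (φ y).toReal * scaledMollifier ρ δ (x - y) : ℝ) : ℂ) := by
    rw [paramInt, ← integral_complex_ofReal]
    refine integral_congr_ae (Filter.Eventually.of_forall fun y => ?_)
    simp only [one_smul, ← sub_eq_add_neg]
    by_cases hy : y ∈ Metric.closedBall z (s + δ)
    · simp [Set.indicator_of_mem hy]
    · rw [scaledMollifier_sub_eq_zero hρ hδ]
      · simp
      · intro h
        refine hy ?_
        have h1 := dist_triangle y x z
        rw [Metric.mem_closedBall] at h ⊢
        rw [Metric.mem_ball] at hx
        linarith
  rw [h1, Complex.ofReal_re]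
  exact integral_mul_mollifier ρ hδ (fun y => (φ y).toReal) x

/-- All derivatives fall on the mollifier. In second order the sign from y ↦ z - y disappears, so
derivatives in z equal those in y and the regularized operator is the distributional one tested with
a mollifier. -/
lemma regularize_contDiffAt_and_sumSq (hρ : IsMollifier ρ) (hδ : 0 < δ) {φ : Cn n → EReal}
    {O : Set (Cn n)} (hO : IsOpen O)
    (hint : LocallyIntegrableOn (fun x => (φ x).toReal) O volume) {z : Cn n} (hz : z ∈ shrink O δ) :
    ContDiffAt ℝ ∞ (regularize ρ δ φ) z ∧
      ∀ {ι : Type} [Fintype ι] (m : ι → Cn n), sumSq m (regularize ρ δ φ) z =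
        ∫ y, (φ y).toReal * sumSq m (fun y => scaledMollifier ρ δ (z - y)) y := by
  obtain ⟨s, hs, hball⟩ := exists_closedBall_subset_of_mem_shrink hO hδ hz
  have hev := regularize_eventuallyEq (φ := φ) (z := z) hρ hδ hs
  set g : Cn n → ℝ := (Metric.closedBall z (s + δ)).indicator fun y => (φ y).toReal with hg
  have hgi : Integrable g := (integrable_indicator_iff Metric.isClosed_closedBall.measurableSet).2
    (hint.integrableOn_compact_subset hball (isCompact_closedBall _ _))
  have hk : Integrable (fun y => (g y : ℂ)) := hgi.ofReal
  set F : Cn n → ℂ := fun v => (scaledMollifier ρ δ v : ℂ) with hFdef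
  have hF : ContDiff ℝ ∞ F := Complex.ofRealCLM.contDiff.comp (scaledMollifier_contDiff hρ)
  have hFc : HasCompactSupport F :=
    (hasCompactSupport_scaledMollifier hρ hδ).comp_left (g := fun r : ℝ => (r : ℂ)) rfl
  have ht : Measurable fun _ : Cn n => (1 : ℝ) := measurable_const
  have ht1 : ∀ᵐ _y : Cn n, |(1 : ℝ)| ≤ 1 := by simp
  have hp : Measurable fun y : Cn n => -y := measurable_neg
  set U := paramInt volume (fun y => (g y : ℂ)) (fun _ => 1) (fun y => -y) F with hU
  have hUs : ContDiff ℝ ∞ U := contDiff_paramInt hk ht ht1 hp hF hFc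
  have hUr : ContDiff ℝ ∞ fun x => (U x).re := Complex.reCLM.contDiff.comp hUs
  refine ⟨hUr.contDiffAt.congr_of_eventuallyEq hev, fun m => ?_⟩
  have hD1 (x v : Cn n) : fderiv ℝ (fun x => (U x).re) x v = (fderiv ℝ U x v).re := by
    have : HasFDerivAt (fun x => (U x).re) (Complex.reCLM ∘L fderiv ℝ U x) x :=
      Complex.reCLM.hasFDerivAt.comp x (hUs.differentiable (by simp) x).hasFDerivAt
    rw [this.fderiv]; rfl
  have hk1 : (fun y => (g y : ℂ) * ((1 : ℝ) : ℂ)) = fun y => (g y : ℂ) := by ext; simp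
  have hD2 (v : Cn n) : fderiv ℝ (fderiv ℝ fun x => (U x).re) z v v =
      ∫ y, g y * fderiv ℝ (fderiv ℝ (scaledMollifier ρ δ)) (z - y) v v := by
    have hFv := contDiff_fderiv_apply_const hF v
    have hFvc : HasCompactSupport fun y => fderiv ℝ F y v := hFc.fderiv_apply (𝕜 := ℝ) v
    have hUv : ContDiff ℝ ∞ (paramInt volume (fun y => (g y : ℂ)) (fun _ => 1) (fun y => -y)
      fun y => fderiv ℝ F y v) := contDiff_paramInt hk ht ht1 hp hFv hFvc
    have hC2 : ContDiffAt ℝ 2 (fun x => (U x).re) z := (hUr.of_le (by norm_cast)).contDiffAt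
    rw [← fderiv_fderiv_apply (ContDiffAt.differentiableAt_fderiv_of_two hC2)]
    simp_rw [hD1]
    have h1 (x : Cn n) : fderiv ℝ U x v = paramInt volume (fun y => (g y : ℂ)) (fun _ => 1)
        (fun y => -y) (fun y => fderiv ℝ F y v) x := by
      rw [hU, fderiv_paramInt hk ht ht1 hp hF hFc, hk1]
    simp_rw [h1]
    have h2 : HasFDerivAt (fun x => (paramInt volume (fun y => (g y : ℂ)) (fun _ => 1)
        (fun y => -y) (fun y => fderiv ℝ F y v) x).re) (Complex.reCLM ∘L fderiv ℝ _ z) z :=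
      Complex.reCLM.hasFDerivAt.comp z (hUv.differentiable (by simp) z).hasFDerivAt
    rw [h2.fderiv]
    rw [ContinuousLinearMap.comp_apply, Complex.reCLM_apply, fderiv_paramInt hk ht ht1 hp hFv hFvc, hk1, paramInt]
    have h3 (x : Cn n) : fderiv ℝ (fun y => fderiv ℝ F y v) x v =
        (fderiv ℝ (fderiv ℝ (scaledMollifier ρ δ)) x v v : ℂ) := by
      have hc : ContDiffAt ℝ 2 F x := (hF.of_le (by norm_cast)).contDiffAt
      rw [fderiv_fderiv_apply hc.differentiableAt_fderiv_complex]
      exact fderiv_fderiv_ofReal ((scaledMollifier_contDiff hρ).of_le (by norm_cast)).contDiffAt v v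
    simp_rw [h3, ← Complex.ofReal_mul]
    rw [integral_complex_ofReal, Complex.ofReal_re]
    simp [sub_eq_add_neg]
  have hcont : ContDiff ℝ 2 (scaledMollifier ρ δ) :=
    (scaledMollifier_contDiff hρ).of_le (by norm_cast)
  have hD3 (v y : Cn n) : fderiv ℝ (fderiv ℝ fun y => scaledMollifier ρ δ (z - y)) y v v =
      fderiv ℝ (fderiv ℝ (scaledMollifier ρ δ)) (z - y) v v := by
    have h1 (y : Cn n) : HasFDerivAt (fun y => z - y) (-ContinuousLinearMap.id ℝ (Cn n)) y :=
      (hasFDerivAt_id y).const_sub z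
    have hz2 : ContDiffAt ℝ 2 (fun y => scaledMollifier ρ δ (z - y)) y :=
      (hcont.comp (contDiff_const.sub contDiff_id)).contDiffAt
    rw [← fderiv_fderiv_apply (ContDiffAt.differentiableAt_fderiv_of_two hz2),
      ← fderiv_fderiv_apply (ContDiffAt.differentiableAt_fderiv_of_two hcont.contDiffAt)]
    have h2 (y : Cn n) : fderiv ℝ (fun y => scaledMollifier ρ δ (z - y)) y v =
        -fderiv ℝ (scaledMollifier ρ δ) (z - y) v := by
      have : HasFDerivAt (fun y => scaledMollifier ρ δ (z - y)) _ y :=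
        ((hcont.differentiable (by simp) _).hasFDerivAt).comp y (h1 y)
      rw [this.fderiv]; simp
    simp_rw [h2]
    have h3 : DifferentiableAt ℝ (fun x => fderiv ℝ (scaledMollifier ρ δ) x v) (z - y) :=
      (((hcont.fderiv_right (m := 1) (by norm_num)).clm_apply contDiff_const).differentiable
        (by simp)) _
    have h4 : HasFDerivAt (fun y => -fderiv ℝ (scaledMollifier ρ δ) (z - y) v) _ y :=
      (h3.hasFDerivAt.comp y (h1 y)).neg
    rw [h4.fderiv]; simp
  have hint2 (v : Cn n) :
      Integrable fun y => g y * fderiv ℝ (fderiv ℝ (scaledMollifier ρ δ)) (z - y) v v := by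
    have hc : Continuous fun x => fderiv ℝ (fderiv ℝ (scaledMollifier ρ δ)) x v v := by
      have := ((hcont.fderiv_right (m := 1) (by norm_num)).continuous_fderiv (by simp))
      fun_prop
    have hcs : HasCompactSupport fun x => fderiv ℝ (fderiv ℝ (scaledMollifier ρ δ)) x v v :=
      (((hasCompactSupport_scaledMollifier hρ hδ).fderiv (𝕜 := ℝ)).fderiv (𝕜 := ℝ)).comp_left
        (g := fun L : Cn n →L[ℝ] Cn n →L[ℝ] ℝ => L v v) rfl
    obtain ⟨C, hC⟩ := hc.bounded_above_of_compact_support hcs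
    exact hgi.mul_bdd (c := C) (hc.comp (by fun_prop)).aestronglyMeasurable
      (Filter.Eventually.of_forall fun y => hC _)
  rw [sumSq_congr hev, sumSq]
  simp_rw [hD2]
  rw [← integral_finsetSum _ fun i _ => hint2 (m i)]
  refine integral_congr_ae (Filter.Eventually.of_forall fun y => ?_)
  simp only [sumSq, hD3]
  rw [← Finset.mul_sum]
  by_cases hy : y ∈ Metric.closedBall z (s + δ)
  · rw [hg, Set.indicator_of_mem hy]
  · have h0 := sumSq_eq_zero_of_notMem_closedBall (m := m) (z := z) (δ := δ)
      (η := fun y => scaledMollifier ρ δ (z - y)) (x := y)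
      (fun x hx => scaledMollifier_sub_eq_zero hρ hδ hx)
      (fun h => hy (Metric.closedBall_subset_closedBall (by linarith) h))
    simp only [sumSq, hD3] at h0
    rw [h0, mul_zero, mul_zero]

/-- Regularization preserves admissibility of the complex Hessian, in the viscosity sense for the
given function and in the classical sense for its regularization. -/
theorem admissible_regularize {θ : ℝ} (h0 : 0 < θ) (hθ : θ < Real.pi)
    {H : Matrix (Fin n) (Fin n) ℂ} (hH : H.PosDef) (hρ : IsMollifier ρ) (hδ : 0 < δ)
    {u : Cn n → EReal} {O : Set (Cn n)} (hO : IsOpen O) (husc : UpperSemicontinuousOn u O)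
    (htop : ∀ x ∈ O, u x ≠ ⊤) (hbot : ∀ᵐ x ∂(volume.restrict O), u x ≠ ⊥)
    (hint : LocallyIntegrableOn (fun x => (u x).toReal) O volume)
    (hu : ∀ x ∈ O, ∀ q : Cn n → ℝ, ContDiff ℝ 2 q → (q x : EReal) = u x →
      (∀ᶠ y in 𝓝 x, u y ≤ (q y : EReal)) → Admissible θ H (levi q x))
    {z : Cn n} (hz : z ∈ shrink O δ) : Admissible θ H (levi (regularize ρ δ u) z) := by
  obtain ⟨hs, hsum⟩ := regularize_contDiffAt_and_sumSq hρ hδ hO hint hz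
  have hs2 : ContDiffAt ℝ 2 (regularize ρ δ u) z := hs.of_le (by norm_cast)
  obtain ⟨S, d, hSH, hSA⟩ := exists_frame hH (levi_isHermitian hs2)
  -- The frame diagonalizes the Hessian at the single point z. Since H is constant, it is
  -- orthonormal at every point of O, and the separating functional becomes an operator with
  -- constant coefficients.
  refine ⟨S, d, hSH, hSA, by_contra fun hd => ?_⟩
  obtain ⟨w, b, hw, hw0, hlt, hge⟩ := exists_separating_weights h0 hθ hd
  have hlin : IsLinearSubsolution (weightedFrame w S) b u O := by
    intro x hx q hq hqx hqu
    rw [sumSq_weightedFrame hw S hq.contDiffAt]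
    exact hge _ ((hu x hx q hq hqx hqu).diag_mem hθ hH.isHermitian hSH)
  have key := hlin.integral_ge (weightedFrame_ne_zero hw hw0 hSH) hO husc htop hbot hint hδ hz
    (η := fun y => scaledMollifier ρ δ (z - y))
    ((scaledMollifier_contDiff hρ).comp (contDiff_const.sub contDiff_id))
    (fun y => scaledMollifier_nonneg hρ _) (fun y hy => scaledMollifier_sub_eq_zero hρ hδ hy)
  rw [integral_scaledMollifier_sub hρ hδ, mul_one, ← hsum,
    sumSq_weightedFrame hw S hs2] at key
  simp only [hSA, diagonal_apply_eq, Complex.ofReal_re] at key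
  linarith

end Regularization

/-! ### Algebra of the complex Hessian -/

section LeviAlgebra

open Matrix

variable {n : ℕ}

lemma levi_add {q p : Cn n → ℝ} {z : Cn n} (hq : ContDiffAt ℝ 2 q z) (hp : ContDiffAt ℝ 2 p z) :
    levi (q + p) z = levi q z + levi p z := by
  ext j k
  have hqp : ContDiffAt ℝ 2 (q + p) z := hq.add hp
  rw [levi_apply hqp, Matrix.add_apply, levi_apply hq, levi_apply hp,
    fderiv_fderiv_add hq hp]
  simp only [_root_.add_apply]
  push_cast
  ring

lemma levi_const_smul {q : Cn n → ℝ} {z : Cn n} (hq : ContDiffAt ℝ 2 q z) (c : ℝ) :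
    levi (c • q) z = (c : ℂ) • levi q z := by
  ext j k
  have hcq : ContDiffAt ℝ 2 (c • q) z := contDiffAt_const.smul hq
  rw [levi_apply hcq, Matrix.smul_apply,
    levi_apply hq, fderiv_fderiv_const_smul hq]
  simp only [_root_.smul_apply, smul_eq_mul]
  push_cast
  ring

lemma levi_sub {q p : Cn n → ℝ} {z : Cn n} (hq : ContDiffAt ℝ 2 q z) (hp : ContDiffAt ℝ 2 p z) :
    levi (q - p) z = levi q z - levi p z := by
  have h : q - p = q + (-1 : ℝ) • p := by ext; simp [sub_eq_add_neg]
  have hp' : ContDiffAt ℝ 2 ((-1 : ℝ) • p) z := contDiffAt_const.smul hp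
  rw [h, levi_add hq hp', levi_const_smul hp]
  simp [sub_eq_add_neg]

lemma levi_posSemidef_of_isLocalMin {q : Cn n → ℝ} {z : Cn n} (h : IsLocalMin q z)
    (hq : ContDiffAt ℝ 2 q z) : (levi q z).PosSemidef := by
  have hH := levi_isHermitian hq
  refine PosSemidef.of_dotProduct_mulVec_nonneg hH fun v => ?_
  rcases isEmpty_or_nonempty (Fin n) with he | ⟨⟨j⟩⟩
  · simp [dotProduct]
  -- A matrix with all columns equal to v expresses the Levi form at v through real second
  -- derivatives.
  have h1 := re_frame_levi hq (of fun a _ => v a) j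
  have h2 := h.fderiv_fderiv_nonneg hq (conjCol (of fun a _ => v a) j)
  have h3 := h.fderiv_fderiv_nonneg hq (Complex.I • conjCol (of fun a _ => v a) j)
  have h4 : ((of fun a (_ : Fin n) => v a)ᴴ * levi q z * of fun a (_ : Fin n) => v a) j j =
      star v ⬝ᵥ (levi q z).mulVec v := by
    rw [Matrix.mul_assoc, mul_apply]
    simp only [dotProduct, mulVec, mul_apply, conjTranspose_apply, of_apply, Pi.star_apply]
  rw [h4] at h1
  have him : (star v ⬝ᵥ (levi q z).mulVec v).im = 0 := by
    have := hH.im_star_dotProduct_mulVec_self v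
    simpa using this
  rw [Complex.le_def]
  exact ⟨by rw [h1]; simp only [Complex.zero_re]; linarith, him.symm⟩

lemma levi_le_of_touching {q p : Cn n → ℝ} {z : Cn n} (hq : ContDiffAt ℝ 2 q z)
    (hp : ContDiffAt ℝ 2 p z) (h : IsLocalMin (q - p) z) :
    (levi q z - levi p z).PosSemidef := by
  rw [← levi_sub hq hp]
  exact levi_posSemidef_of_isLocalMin h (hq.sub hp)

/-- The Hermitian quadratic form with coefficients `K`, centred at `x`. -/
def hermQuad (K : Matrix (Fin n) (Fin n) ℂ) (x y : Cn n) : ℝ :=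
  (∑ j, ∑ k, K j k * ((y j - x j) * star (y k - x k))).re

lemma ofReal_hermQuad {K : Matrix (Fin n) (Fin n) ℂ} (hK : K.IsHermitian) (x y : Cn n) :
    (hermQuad K x y : ℂ) = ∑ j, ∑ k, K j k * ((y j - x j) * star (y k - x k)) := by
  rw [hermQuad]
  refine Complex.conj_eq_iff_re.1 ?_
  rw [← Complex.star_def, star_sum, Finset.sum_comm]
  simp_rw [star_sum]
  rw [Finset.sum_comm]
  rw [Finset.sum_comm]
  refine Finset.sum_congr rfl fun j _ => Finset.sum_congr rfl fun k _ => ?_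
  rw [star_mul', star_mul', star_star, hK.apply]
  ring

lemma contDiff_coord_sub (x : Cn n) (j : Fin n) :
    ContDiff ℝ ∞ fun y : Cn n => y j - x j :=
  ((EuclideanSpace.proj j : Cn n →L[ℂ] ℂ).restrictScalars ℝ).contDiff.sub contDiff_const

lemma contDiff_star_coord_sub (x : Cn n) (j : Fin n) :
    ContDiff ℝ ∞ fun y : Cn n => star (y j - x j) :=
  Complex.conjCLE.toContinuousLinearMap.contDiff.comp (contDiff_coord_sub x j)

lemma hermQuad_contDiff (K : Matrix (Fin n) (Fin n) ℂ) (x : Cn n) :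
    ContDiff ℝ ∞ (hermQuad K x) :=
  Complex.reCLM.contDiff.comp (ContDiff.sum fun j _ => ContDiff.sum fun k _ =>
    contDiff_const.mul ((contDiff_coord_sub x j).mul (contDiff_star_coord_sub x k)))

lemma hermQuad_self (K : Matrix (Fin n) (Fin n) ℂ) (x : Cn n) : hermQuad K x x = 0 := by
  simp [hermQuad]

lemma hermQuad_nonneg {K : Matrix (Fin n) (Fin n) ℂ} (hK : K.PosSemidef) (x y : Cn n) :
    0 ≤ hermQuad K x y := by
  have h := hK.dotProduct_mulVec_nonneg (fun j => star (y j - x j))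
  rw [Complex.le_def] at h
  refine h.1.trans (le_of_eq ?_)
  rw [hermQuad]
  congr 1
  simp only [dotProduct, mulVec, Pi.star_apply, star_star, Finset.mul_sum]
  exact Finset.sum_congr rfl fun j _ => Finset.sum_congr rfl fun k _ => by ring

lemma hermQuad_one (x y : Cn n) : hermQuad 1 x y = ‖y - x‖ ^ 2 := by
  rw [EuclideanSpace.norm_sq_eq, hermQuad]
  simp only [one_apply, ite_mul, one_mul, zero_mul, Finset.sum_ite_eq, Finset.mem_univ, if_true,
    Complex.star_def, Complex.mul_conj, Complex.re_sum, Complex.ofReal_re, PiLp.sub_apply,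
    Complex.normSq_eq_norm_sq]

lemma dz_const_mul {f : Cn n → ℂ} {z : Cn n} (hf : DifferentiableAt ℝ f z) (c : ℂ) (j : Fin n) :
    dz j (fun y => c * f y) z = c * dz j f z := by
  rw [dz_mul (differentiableAt_const c) hf]; simp [dz]

lemma dzbar_const_mul {f : Cn n → ℂ} {z : Cn n} (hf : DifferentiableAt ℝ f z) (c : ℂ)
    (j : Fin n) : dzbar j (fun y => c * f y) z = c * dzbar j f z := by
  rw [dzbar_mul (differentiableAt_const c) hf]; simp [dzbar]

lemma dz_coord_sub (x : Cn n) (j k : Fin n) (z : Cn n) :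
    dz j (fun y => y k - x k) z = if k = j then 1 else 0 := by
  rw [((hasFDerivAt_coord k z).sub_const (x k)).dz, ← (hasFDerivAt_coord k z).dz, dz_coord]

lemma dzbar_coord_sub (x : Cn n) (j k : Fin n) (z : Cn n) :
    dzbar j (fun y => y k - x k) z = 0 := by
  rw [((hasFDerivAt_coord k z).sub_const (x k)).dzbar, ← (hasFDerivAt_coord k z).dzbar,
    dzbar_coord]

lemma levi_hermQuad {K : Matrix (Fin n) (Fin n) ℂ} (hK : K.IsHermitian) (x z : Cn n) :
    levi (hermQuad K x) z = K := by
  ext a b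
  show dz a (fun y => dzbar b (fun y => (hermQuad K x y : ℂ)) y) z = K a b
  simp_rw [ofReal_hermQuad hK]
  have hd (j : Fin n) (y : Cn n) : DifferentiableAt ℝ (fun y : Cn n => y j - x j) y :=
    (contDiff_coord_sub x j).differentiable (by simp) y
  have hds (j : Fin n) (y : Cn n) : DifferentiableAt ℝ (fun y : Cn n => star (y j - x j)) y :=
    (contDiff_star_coord_sub x j).differentiable (by simp) y
  have hp (j k : Fin n) (y : Cn n) :
      DifferentiableAt ℝ (fun y : Cn n => (y j - x j) * star (y k - x k)) y :=
    (hd j y).mul (hds k y)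
  have h1 (y : Cn n) : dzbar b (fun y => ∑ j, ∑ k, K j k * ((y j - x j) * star (y k - x k))) y =
      ∑ j, K j b * (y j - x j) := by
    rw [dzbar_sum Finset.univ (f := fun j (y : Cn n) =>
      ∑ k, K j k * ((y j - x j) * star (y k - x k))) fun j _ =>
        DifferentiableAt.fun_sum fun k _ => (hp j k y).const_mul _]
    refine Finset.sum_congr rfl fun j _ => ?_
    rw [dzbar_sum Finset.univ (f := fun k (y : Cn n) => K j k * ((y j - x j) * star (y k - x k)))
      fun k _ => (hp j k y).const_mul _]
    simp_rw [dzbar_const_mul (hp j _ y), dzbar_mul (hd j y) (hds _ y),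
      dzbar_coord_sub, dzbar_star (hd _ y), dz_coord_sub]
    rw [Finset.sum_eq_single b]
    · simp
    · intro k _ hk; simp [hk]
    · simp
  simp_rw [h1]
  rw [dz_sum Finset.univ (f := fun j (y : Cn n) => K j b * (y j - x j))
    fun j _ => (hd j z).const_mul _]
  simp_rw [dz_const_mul (hd _ z), dz_coord_sub]
  simp

end LeviAlgebra

/-! ### Integration by parts -/

section ByParts

variable {n : ℕ}

lemma integrable_mul_of_hasCompactSupport {f g : Cn n → ℂ} (hf : Continuous f) (hg : Continuous g)
    (hgc : HasCompactSupport g) : Integrable (fun x => f x * g x) :=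
  (hf.mul hg).integrable_of_hasCompactSupport hgc.mul_left

lemma integral_mul_fderiv_by_parts {f g : Cn n → ℂ} (hf : ContDiff ℝ ∞ f) (hg : ContDiff ℝ ∞ g)
    (hgc : HasCompactSupport g) (v : Cn n) :
    ∫ x, f x * fderiv ℝ g x v = -∫ x, fderiv ℝ f x v * g x :=
  integral_mul_fderiv_eq_neg_fderiv_mul_of_integrable
    (integrable_mul_of_hasCompactSupport (contDiff_fderiv_apply_const hf v).continuous
      hg.continuous hgc)
    (integrable_mul_of_hasCompactSupport hf.continuous (contDiff_fderiv_apply_const hg v).continuous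
      (hgc.fderiv_apply (𝕜 := ℝ) v))
    (integrable_mul_of_hasCompactSupport hf.continuous hg.continuous hgc)
    (fun x _ => hf.differentiable (by simp) x) (fun x _ => hg.differentiable (by simp) x)

lemma integral_mul_dz {f g : Cn n → ℂ} (hf : ContDiff ℝ ∞ f) (hg : ContDiff ℝ ∞ g)
    (hgc : HasCompactSupport g) (j : Fin n) :
    ∫ x, f x * dz j g x = -∫ x, dz j f x * g x := by
  have h1 (v : Cn n) := integrable_mul_of_hasCompactSupport hf.continuous
    (contDiff_fderiv_apply_const hg v).continuous (hgc.fderiv_apply (𝕜 := ℝ) v)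
  have h2 (v : Cn n) := integrable_mul_of_hasCompactSupport
    (contDiff_fderiv_apply_const hf v).continuous hg.continuous hgc
  have e1 : (fun x => f x * dz j g x) = fun x =>
      (2 : ℂ)⁻¹ * (f x * fderiv ℝ g x (ex j) - Complex.I * (f x * fderiv ℝ g x (ey j))) := by
    ext x; simp only [dz]; ring
  have e2 : (fun x => dz j f x * g x) = fun x =>
      (2 : ℂ)⁻¹ * (fderiv ℝ f x (ex j) * g x - Complex.I * (fderiv ℝ f x (ey j) * g x)) := by
    ext x; simp only [dz]; ring
  rw [e1, e2, integral_const_mul, integral_const_mul, integral_sub (h1 _) ((h1 _).const_mul _),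
    integral_sub (h2 _) ((h2 _).const_mul _), integral_const_mul, integral_const_mul,
    integral_mul_fderiv_by_parts hf hg hgc, integral_mul_fderiv_by_parts hf hg hgc]
  ring

lemma integral_mul_dzbar {f g : Cn n → ℂ} (hf : ContDiff ℝ ∞ f) (hg : ContDiff ℝ ∞ g)
    (hgc : HasCompactSupport g) (j : Fin n) :
    ∫ x, f x * dzbar j g x = -∫ x, dzbar j f x * g x := by
  have h1 (v : Cn n) := integrable_mul_of_hasCompactSupport hf.continuous
    (contDiff_fderiv_apply_const hg v).continuous (hgc.fderiv_apply (𝕜 := ℝ) v)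
  have h2 (v : Cn n) := integrable_mul_of_hasCompactSupport
    (contDiff_fderiv_apply_const hf v).continuous hg.continuous hgc
  have e1 : (fun x => f x * dzbar j g x) = fun x =>
      (2 : ℂ)⁻¹ * (f x * fderiv ℝ g x (ex j) + Complex.I * (f x * fderiv ℝ g x (ey j))) := by
    ext x; simp only [dzbar]; ring
  have e2 : (fun x => dzbar j f x * g x) = fun x =>
      (2 : ℂ)⁻¹ * (fderiv ℝ f x (ex j) * g x + Complex.I * (fderiv ℝ f x (ey j) * g x)) := by
    ext x; simp only [dzbar]; ring
  rw [e1, e2, integral_const_mul, integral_const_mul, integral_add (h1 _) ((h1 _).const_mul _),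
    integral_add (h2 _) ((h2 _).const_mul _), integral_const_mul, integral_const_mul,
    integral_mul_fderiv_by_parts hf hg hgc, integral_mul_fderiv_by_parts hf hg hgc]
  ring

/-- For smooth ψ the distributional and classical i∂∂̄ψ agree; this is how adding a smooth potential
changes the current. -/
lemma integral_mul_dz_dzbar {ψ : Cn n → ℝ} (hψ : ContDiff ℝ ∞ ψ) {η : Cn n → ℝ}
    (hη : ContDiff ℝ ∞ η) (hηc : HasCompactSupport η) (j k : Fin n) :
    ∫ x, (ψ x : ℂ) * dz j (dzbar k fun y => (η y : ℂ)) x = ∫ x, levi ψ x j k * (η x : ℂ) := by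
  have hψ' : ContDiff ℝ ∞ fun y => (ψ y : ℂ) := Complex.ofRealCLM.contDiff.comp hψ
  have hη' : ContDiff ℝ ∞ fun y => (η y : ℂ) := Complex.ofRealCLM.contDiff.comp hη
  have hηc' : HasCompactSupport fun y => (η y : ℂ) :=
    hηc.comp_left (g := fun r : ℝ => (r : ℂ)) rfl
  rw [integral_mul_dz hψ' (contDiff_dzbar hη' k) (hasCompactSupport_dzbar hηc' k),
    integral_mul_dzbar (contDiff_dz hψ' j) hη' hηc', neg_neg]
  refine integral_congr_ae (Filter.Eventually.of_forall fun x => ?_)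
  simp only
  rw [← dz_dzbar_comm (hψ'.of_le (by norm_cast)).contDiffAt]
  rfl

end ByParts

/-! ### Potentials and upper tests under addition of a smooth function -/

section Transport

variable {n : ℕ}

lemma isUpperTest_of_eventually {φ : Cn n → EReal} {x : Cn n} {q : Cn n → ℝ}
    (hqx : (q x : EReal) = φ x) (hq : ContDiffAt ℝ 2 q x)
    (h : ∀ᶠ y in 𝓝 x, φ y ≤ (q y : EReal)) : IsUpperTest φ x q := by
  obtain ⟨U, hU, hUo, hxU⟩ := eventually_nhds_iff.1 ((hq.eventually (by simp)).and h)
  exact ⟨hqx, U, hUo, hxU, fun y hy => (hU y hy).1.contDiffWithinAt, fun y hy => (hU y hy).2⟩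

lemma IsUpperTest.contDiffAt {φ : Cn n → EReal} {x : Cn n} {q : Cn n → ℝ}
    (h : IsUpperTest φ x q) : ContDiffAt ℝ 2 q x := by
  obtain ⟨-, U, hU, hx, hq, -⟩ := h
  exact hq.contDiffAt (hU.mem_nhds hx)

lemma IsUpperTest.eventually_le {φ : Cn n → EReal} {x : Cn n} {q : Cn n → ℝ}
    (h : IsUpperTest φ x q) : ∀ᶠ y in 𝓝 x, φ y ≤ (q y : EReal) := by
  obtain ⟨-, U, hU, hx, -, hle⟩ := h
  exact Filter.eventually_of_mem (hU.mem_nhds hx) hle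

lemma IsUpperTest.add {φ : Cn n → EReal} {x : Cn n} {q p : Cn n → ℝ}
    (h : IsUpperTest φ x q) (hp : ContDiffAt ℝ 2 p x) :
    IsUpperTest (fun y => φ y + (p y : EReal)) x (q + p) := by
  refine isUpperTest_of_eventually ?_ (h.contDiffAt.add hp) ?_
  · rw [Pi.add_apply, EReal.coe_add, h.1]
  · filter_upwards [h.eventually_le] with y hy
    rw [Pi.add_apply, EReal.coe_add]
    exact add_le_add_left hy _

lemma IsUpperTest.add_nonneg {φ : Cn n → EReal} {x : Cn n} {q p : Cn n → ℝ}
    (h : IsUpperTest φ x q) (hp : ContDiffAt ℝ 2 p x) (hp0 : p x = 0) (hp1 : ∀ y, 0 ≤ p y) :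
    IsUpperTest φ x (q + p) := by
  refine isUpperTest_of_eventually ?_ (h.contDiffAt.add hp) ?_
  · rw [Pi.add_apply, hp0, add_zero, h.1]
  · filter_upwards [h.eventually_le] with y hy
    refine hy.trans (EReal.coe_le_coe_iff.2 ?_)
    rw [Pi.add_apply]
    linarith [hp1 y]

lemma ereal_add_coe_ne_bot {a : EReal} (ha : a ≠ ⊥) (r : ℝ) : a + (r : EReal) ≠ ⊥ := by
  simp [EReal.add_eq_bot_iff, ha]

/-- `EReal.toReal` respects the sum only where φ is finite, hence almost everywhere. -/
lemma locallyIntegrableOn_add_coe {φ : Cn n → EReal} {O : Set (Cn n)} (hO : IsOpen O)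
    (htop : ∀ x ∈ O, φ x ≠ ⊤) (hbot : ∀ᵐ x ∂(volume.restrict O), φ x ≠ ⊥)
    (hint : LocallyIntegrableOn (fun x => (φ x).toReal) O volume) {p : Cn n → ℝ}
    (hp : Continuous p) :
    LocallyIntegrableOn (fun x => (φ x + (p x : EReal)).toReal) O volume := by
  rw [locallyIntegrableOn_iff hO.isLocallyClosed]
  intro K hK hKc
  refine ((hint.integrableOn_compact_subset hK hKc).add
    (hp.continuousOn.integrableOn_compact hKc)).congr_fun_ae ?_
  filter_upwards [ae_restrict_of_ae_restrict_of_subset hK hbot,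
    ae_restrict_mem hKc.measurableSet] with x hx hxK
  rw [EReal.toReal_add (htop x (hK hxK)) hx (EReal.coe_ne_top _) (EReal.coe_ne_bot _),
    EReal.toReal_coe]
  rfl

variable {X : Type*} [TopologicalSpace X] [ChartedSpace (Cn n) X]

/-- Adding a smooth potential of `s κ` to a potential. -/
lemma IsUscPotential.add_smooth {e : OpenPartialHomeomorph X (Cn n)}
    {T T' : Fin n → Fin n → 𝓓(tgt e, ℝ) → ℂ} {O O' : Set (Cn n)} {φ : Cn n → EReal}
    (h : IsUscPotential e T O φ) (hO' : IsOpen O') (hsub : O' ⊆ O) {ψ : Cn n → ℝ}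
    (hψ : ContDiff ℝ ∞ ψ) {κ : KahlerForm n X} (hlevi : ∀ z ∈ O', levi ψ z = κ.coeff e z) (s : ℝ)
    (hT : ∀ j k η, T' j k η = T j k η + (s : ℂ) * ∫ z, κ.coeff e z j k * (η z : ℂ)) :
    IsUscPotential e T' O' (fun y => φ y + ((s • ψ) y : ℝ)) := by
  have hp : Continuous (s • ψ) := hψ.continuous.const_smul s
  have htop : ∀ x ∈ O', φ x ≠ ⊤ := fun x hx => h.ne_top x (hsub hx)
  have hbot : ∀ᵐ x ∂(volume.restrict O'), φ x ≠ ⊥ :=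
    ae_restrict_of_ae_restrict_of_subset hsub h.ae_ne_bot
  have hint : LocallyIntegrableOn (fun x => (φ x).toReal) O' volume :=
    h.locallyIntegrable.mono_set hsub
  refine ⟨hO', hsub.trans h.subset, ?_, ?_, ?_, ?_, ?_, ?_⟩
  · refine UpperSemicontinuousOn.add' (fun x hx => (h.usc x (hsub hx)).mono hsub) ?_ ?_
    · exact (continuous_coe_real_ereal.comp hp).continuousOn.upperSemicontinuousOn
    · exact fun x _ => EReal.continuousAt_add (Or.inr (EReal.coe_ne_bot _))
        (Or.inr (EReal.coe_ne_top _))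
  · exact fun x hx => EReal.add_ne_top (htop x hx) (EReal.coe_ne_top _)
  · exact hbot.mono fun x hx => ereal_add_coe_ne_bot hx _
  · exact locallyIntegrableOn_add_coe hO' htop hbot hint hp
  · intro x hx c hc U hU
    -- A real level c₁ strictly between the two sides leaves room for ψ to vary near x.
    have hc' : c - ((s • ψ) x : ℝ) < φ x :=
      (EReal.sub_lt_iff (Or.inl (EReal.coe_ne_bot _)) (Or.inl (EReal.coe_ne_top _))).2 hc
    obtain ⟨c₁, hc₁, hc₂⟩ := exists_between hc'
    lift c₁ to ℝ using ⟨(hc₂.trans_le le_top).ne, (bot_le.trans_lt hc₁).ne'⟩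
    have hc₃ : c < ((c₁ + (s • ψ) x : ℝ) : EReal) := by
      rw [EReal.coe_add]
      exact (EReal.sub_lt_iff (Or.inl (EReal.coe_ne_bot _)) (Or.inl (EReal.coe_ne_top _))).1 hc₁
    have hev : ∀ᶠ y in 𝓝 x, c < ((c₁ + (s • ψ) y : ℝ) : EReal) :=
      (continuous_coe_real_ereal.comp (continuous_const.add hp)).continuousAt.eventually
        (lt_mem_nhds hc₃)
    refine (h.normalized x (hsub hx) c₁ hc₂ _ (Filter.inter_mem hU hev)).trans_le
      (measure_mono ?_)
    rintro y ⟨⟨hyU, hy⟩, hy2⟩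
    refine ⟨hyU, lt_of_lt_of_le hy ?_⟩
    rw [EReal.coe_add]
    exact add_le_add_left hy2.le _
  · intro j k η hη
    set g : Cn n → ℂ := fun z => dz j (dzbar k fun y => (η y : ℂ)) z with hg
    have hηs : ContDiff ℝ ∞ fun y => (η y : ℂ) := Complex.ofRealCLM.contDiff.comp η.contDiff
    have hηc : HasCompactSupport fun y => (η y : ℂ) :=
      η.hasCompactSupport.comp_left (g := fun r : ℝ => (r : ℂ)) rfl
    have hgs : Continuous g := (contDiff_dz (contDiff_dzbar hηs k) j).continuous
    have hgc : HasCompactSupport g :=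
      hasCompactSupport_dz (hasCompactSupport_dzbar hηc k) j
    have hg0 (z : Cn n) (hz : z ∉ tsupport η) : g z = 0 := by
      have h0 : (fun y => (η y : ℂ)) =ᶠ[𝓝 z] fun _ => 0 := by
        filter_upwards [(isClosed_tsupport η).isOpen_compl.mem_nhds hz] with y hy
        rw [image_eq_zero_of_notMem_tsupport hy]; simp
      have h1 : (dzbar k fun y => (η y : ℂ)) =ᶠ[𝓝 z] fun _ => 0 := by
        filter_upwards [h0.eventually_nhds] with y hy
        rw [dzbar_congr hy, dzbar_zero]
      rw [hg]
      simp only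
      rw [dz_congr h1]
      simp [dz]
    have hK : IsCompact (tsupport η) := η.hasCompactSupport
    have hφi : Integrable fun z => ((φ z).toReal : ℂ) * g z := by
      have h1 : IntegrableOn (fun z => ((φ z).toReal : ℂ)) (tsupport η) :=
        (hint.integrableOn_compact_subset hη hK).ofReal
      obtain ⟨C, hC⟩ := hgs.bounded_above_of_compact_support hgc
      have h2 : IntegrableOn (fun z => ((φ z).toReal : ℂ) * g z) (tsupport η) :=
        h1.mul_bdd (c := C) hgs.aestronglyMeasurable (Filter.Eventually.of_forall hC)
      refine (integrableOn_iff_integrable_of_support_subset fun z hz => ?_).1 h2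
      by_contra hzη
      exact hz (by simp [hg0 z hzη])
    have hψi : Integrable fun z => (ψ z : ℂ) * g z :=
      integrable_mul_of_hasCompactSupport (Complex.continuous_ofReal.comp hψ.continuous) hgs hgc
    have hκ : ∫ z, κ.coeff e z j k * (η z : ℂ) = ∫ z, (ψ z : ℂ) * g z := by
      rw [hg, integral_mul_dz_dzbar hψ η.contDiff η.hasCompactSupport]
      refine integral_congr_ae (Filter.Eventually.of_forall fun z => ?_)
      by_cases hz : z ∈ tsupport η
      · simp only [hlevi z (hη hz)]
      · simp [image_eq_zero_of_notMem_tsupport hz]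
    rw [hT, h.potential j k η (hη.trans hsub), hκ, ← integral_const_mul,
      ← integral_add hφi (hψi.const_mul _)]
    refine integral_congr_ae ?_
    filter_upwards [(ae_restrict_iff' hO'.measurableSet).1 hbot] with z hz
    by_cases hzη : z ∈ tsupport η
    · have hzO := hη hzη
      rw [EReal.toReal_add (htop z hzO) (hz hzO) (EReal.coe_ne_top _) (EReal.coe_ne_bot _),
        EReal.toReal_coe]
      simp only [Pi.smul_apply, smul_eq_mul]
      push_cast
      ring
    · have := hg0 z hzη
      simp only [hg] at this
      simp [hg, this]

end Transport

/-! ### Recovering a viscosity subsolution from its regularizations -/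

section Recovery

variable {n : ℕ} {ρ : Cn n → ℝ} {δ : ℝ}

lemma regularize_eq_integral (ρ : Cn n → ℝ) (hδ : 0 < δ) (u : Cn n → EReal) (z : Cn n) :
    regularize ρ δ u z = ∫ y, (u y).toReal * scaledMollifier ρ δ (z - y) :=
  integral_mul_mollifier ρ hδ (fun y => (u y).toReal) z

lemma hasCompactSupport_mollifier (hρ : IsMollifier ρ) : HasCompactSupport ρ :=
  HasCompactSupport.intro (isCompact_closedBall (0 : Cn n) 1) fun w hw =>
    hρ.zero_of_one_lt w (by simpa using hw)

lemma integrable_mul_scaledMollifier (hρ : IsMollifier ρ) (hδ : 0 < δ) {f : Cn n → ℝ} {z : Cn n}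
    (hf : IntegrableOn f (Metric.closedBall z δ)) :
    Integrable fun y => f y * scaledMollifier ρ δ (z - y) := by
  have hc : Continuous fun y => scaledMollifier ρ δ (z - y) :=
    (scaledMollifier_contDiff hρ).continuous.comp (continuous_const.sub continuous_id)
  obtain ⟨C, hC⟩ := (scaledMollifier_contDiff hρ).continuous.bounded_above_of_compact_support
    (hasCompactSupport_scaledMollifier hρ hδ)
  have h2 : IntegrableOn (fun y => f y * scaledMollifier ρ δ (z - y)) (Metric.closedBall z δ) :=
    hf.mul_bdd (c := C) hc.aestronglyMeasurable (Filter.Eventually.of_forall fun y => hC _)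
  refine (integrableOn_iff_integrable_of_support_subset fun y hy => ?_).1 h2
  by_contra h
  exact hy (by simp [scaledMollifier_sub_eq_zero hρ hδ h])

lemma regularize_le (hρ : IsMollifier ρ) (hδ : 0 < δ) {u : Cn n → EReal} {z : Cn n}
    (hf : IntegrableOn (fun y => (u y).toReal) (Metric.closedBall z δ)) {c : ℝ}
    (hc : ∀ᵐ y, y ∈ Metric.closedBall z δ → (u y).toReal ≤ c) : regularize ρ δ u z ≤ c := by
  have h1 : ∫ y, c * scaledMollifier ρ δ (z - y) = c := by
    rw [integral_const_mul, integral_scaledMollifier_sub hρ hδ, mul_one]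
  rw [regularize_eq_integral ρ hδ, ← h1]
  refine integral_mono_ae (integrable_mul_scaledMollifier hρ hδ hf)
    (integrable_mul_scaledMollifier hρ hδ
      (integrableOn_const (isCompact_closedBall z δ).measure_lt_top.ne)) ?_
  filter_upwards [hc] with y hy
  by_cases h : y ∈ Metric.closedBall z δ
  · exact mul_le_mul_of_nonneg_right (hy h) (scaledMollifier_nonneg hρ _)
  · simp [scaledMollifier_sub_eq_zero hρ hδ h]

/-- The regularizations converge almost everywhere. -/
lemma ae_tendsto_regularize (hρ : IsMollifier ρ) {u : Cn n → EReal} {x : Cn n} {R : ℝ}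
    (hint : IntegrableOn (fun y => (u y).toReal) (Metric.closedBall x R)) :
    ∀ᵐ y, y ∈ Metric.ball x R →
      Filter.Tendsto (fun δ => regularize ρ δ u y) (𝓝[>] 0) (𝓝 (u y).toReal) := by
  set f : Cn n → ℝ := (Metric.closedBall x R).indicator fun y => (u y).toReal with hf
  have hfi : Integrable f :=
    (integrable_indicator_iff Metric.isClosed_closedBall.measurableSet).2 hint
  obtain ⟨M, hM⟩ := hρ.smooth.continuous.bounded_above_of_compact_support
    (hasCompactSupport_mollifier hρ)
  have hV := Measure.addHaar_closedBall (volume : Measure (Cn n))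
  set V := (volume : Measure (Cn n)).real (Metric.ball 0 1) with hVdef
  filter_upwards [IsUnifLocDoublingMeasure.ae_tendsto_average_norm_sub volume
    hfi.locallyIntegrable 1] with y hy hyR
  have hlim := hy (l := 𝓝[>] (0 : ℝ)) (fun _ => y) (fun δ => δ) Filter.tendsto_id (by
    filter_upwards [self_mem_nhdsWithin] with δ hδ
    exact Metric.mem_closedBall_self (by rw [one_mul]; exact (Set.mem_Ioi.1 hδ).le))
  have hfy : f y = (u y).toReal := Set.indicator_of_mem (Metric.ball_subset_closedBall hyR) _
  rw [← hfy, tendsto_iff_norm_sub_tendsto_zero]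
  have hlim' := hlim.const_mul (M * V)
  rw [mul_zero] at hlim'
  have hR : 0 < R - dist y x := by linarith [Metric.mem_ball.1 hyR]
  refine squeeze_zero' (Filter.Eventually.of_forall fun _ => norm_nonneg _) ?_ hlim'
  filter_upwards [Ioo_mem_nhdsGT hR] with δ hδ
  have hδ0 : 0 < δ := hδ.1
  have hsub : Metric.closedBall y δ ⊆ Metric.closedBall x R :=
    Metric.closedBall_subset_closedBall' (by linarith [hδ.2])
  have h1 : regularize ρ δ u y - f y =
      ∫ y', (f y' - f y) * scaledMollifier ρ δ (y - y') := by
    have hc : ∫ y', f y * scaledMollifier ρ δ (y - y') = f y := by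
      rw [integral_const_mul, integral_scaledMollifier_sub hρ hδ0, mul_one]
    simp_rw [sub_mul]
    rw [integral_sub (integrable_mul_scaledMollifier hρ hδ0 hfi.integrableOn)
      (integrable_mul_scaledMollifier hρ hδ0
        (integrableOn_const (isCompact_closedBall y δ).measure_lt_top.ne)), hc,
      regularize_eq_integral ρ hδ0]
    congr 1
    refine integral_congr_ae (Filter.Eventually.of_forall fun y' => ?_)
    by_cases h : y' ∈ Metric.closedBall y δ
    · simp only [hf, Set.indicator_of_mem (hsub h)]
    · simp [scaledMollifier_sub_eq_zero hρ hδ0 h]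
  set c := |(δ ^ Module.finrank ℝ (Cn n))⁻¹| with hc
  have hgi : IntegrableOn (fun y' => c * M * ‖f y' - f y‖) (Metric.closedBall y δ) :=
    ((hfi.integrableOn.sub
      (integrableOn_const (isCompact_closedBall y δ).measure_lt_top.ne)).norm).const_mul _
  -- The scaled mollifier is at most c M on a ball of volume V / c, so the error is at most M V
  -- times the mean of |f - f y|, which tends to 0 at Lebesgue points.
  have h2 : ‖regularize ρ δ u y - f y‖ ≤
      ∫ y', (Metric.closedBall y δ).indicator (fun y' => c * M * ‖f y' - f y‖) y' := by
    rw [h1]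
    refine norm_integral_le_of_norm_le
      ((integrable_indicator_iff Metric.isClosed_closedBall.measurableSet).2 hgi)
      (Filter.Eventually.of_forall fun y' => ?_)
    by_cases h : y' ∈ Metric.closedBall y δ
    · rw [Set.indicator_of_mem h, norm_mul, mul_comm]
      refine mul_le_mul_of_nonneg_right ?_ (norm_nonneg _)
      rw [scaledMollifier, norm_mul, ← hc, Real.norm_eq_abs, hc, abs_abs]
      exact mul_le_mul_of_nonneg_left (hM _) (abs_nonneg _)
    · simp [scaledMollifier_sub_eq_zero hρ hδ0 h, Set.indicator_of_notMem h]
  refine h2.trans (le_of_eq ?_)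
  rw [integral_indicator Metric.isClosed_closedBall.measurableSet, integral_const_mul, setAverage_eq,
    Measure.real, hV y hδ0.le, ENNReal.toReal_mul, ENNReal.toReal_ofReal (by positivity)]
  have hVpos : V ≠ 0 := by
    rw [hVdef, Measure.real, ENNReal.toReal_ne_zero]
    exact ⟨(Metric.measure_ball_pos volume _ one_pos).ne', measure_ball_lt_top.ne⟩
  have hVe : ((volume : Measure (Cn n)) (Metric.ball 0 1)).toReal = V := rfl
  rw [hVe, hc, abs_of_nonneg (by positivity), smul_eq_mul]
  field_simp

lemma continuousAt_levi {q : Cn n → ℝ} {x : Cn n} (hq : ContDiffAt ℝ 2 q x) :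
    ContinuousAt (levi q) x := by
  have hD : ContinuousAt (fderiv ℝ (fderiv ℝ q)) x :=
    ((hq.fderiv_right (m := 1) (by norm_num)).fderiv_right (m := 0) (by norm_num)).continuousAt
  have hD' (v w : Cn n) : ContinuousAt (fun y => fderiv ℝ (fderiv ℝ q) y v w) x :=
    (hD.clm_apply continuousAt_const).clm_apply continuousAt_const
  refine tendsto_pi_nhds.2 fun j => tendsto_pi_nhds.2 fun k => ?_
  have hev : ∀ᶠ y in 𝓝 x, ContDiffAt ℝ 2 q y := hq.eventually (by simp)
  rw [levi_apply hq]
  refine Filter.Tendsto.congr' (hev.mono fun y hy => (levi_apply hy j k).symm) ?_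
  refine Filter.Tendsto.div_const (Filter.Tendsto.add ?_ (Filter.Tendsto.mul tendsto_const_nhds ?_)) _
  · exact (Complex.continuous_ofReal.tendsto _).comp ((hD' _ _).add (hD' _ _))
  · exact (Complex.continuous_ofReal.tendsto _).comp ((hD' _ _).sub (hD' _ _))

/-- If the regularizations of `u` are close to `u` in the sense of a.e. convergence, every strict
upper test of `u` at `x` touches a regularization at a point near `x`. -/
lemma exists_touching_regularize (hρ : IsMollifier ρ) {u : Cn n → EReal} {O : Set (Cn n)}
    (hO : IsOpen O) (htop : ∀ x ∈ O, u x ≠ ⊤) (hbot : ∀ᵐ x ∂(volume.restrict O), u x ≠ ⊥)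
    (hint : LocallyIntegrableOn (fun x => (u x).toReal) O volume)
    {x : Cn n} (hx : x ∈ O)
    (hnorm : ∀ c : EReal, c < u x → ∀ U ∈ 𝓝 x, 0 < volume {y ∈ U | c < u y})
    {q : Cn n → ℝ} (hq : IsUpperTest u x q) {η : ℝ} (hη : 0 < η) {W : Set (Cn n)} (hW : W ∈ 𝓝 x) :
    ∃ z ∈ W, ∃ δ > 0, z ∈ shrink O δ ∧
      IsLocalMin (q + η • hermQuad 1 x - regularize ρ δ u) z := by
  obtain ⟨hqx, U, hU, hxU, hqU, hle⟩ := hq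
  obtain ⟨t, ht, htW⟩ := Metric.mem_nhds_iff.1
    (Filter.inter_mem hW (Filter.inter_mem (hO.mem_nhds hx) (hU.mem_nhds hxU)))
  set s := t / 3 with hs
  have hs0 : 0 < s := by positivity
  have hK : Metric.closedBall x (2 * s) ⊆ Metric.ball x t :=
    Metric.closedBall_subset_ball (by rw [hs]; linarith)
  have hKO : Metric.closedBall x (2 * s) ⊆ O := fun y hy => (htW (hK hy)).2.1
  have hKU : Metric.closedBall x (2 * s) ⊆ U := fun y hy => (htW (hK hy)).2.2
  -- The regularization minus q₂ will be at most γ - 4γ on the sphere of radius s and above -2γ at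
  -- some point y₀ inside, so its maximum is attained in the open ball.
  set γ := η * s ^ 2 / 4 with hγ
  have hγ0 : 0 < γ := by positivity
  have hqc : ContinuousOn q (Metric.closedBall x (2 * s)) := hqU.continuousOn.mono hKU
  obtain ⟨δ₁, hδ₁, huc⟩ := Metric.uniformContinuousOn_iff.1
    ((isCompact_closedBall x (2 * s)).uniformContinuousOn_of_continuous hqc) γ hγ0
  have hiK : IntegrableOn (fun y => (u y).toReal) (Metric.closedBall x (2 * s)) :=
    hint.integrableOn_compact_subset hKO (isCompact_closedBall _ _)
  have hqx' : ContinuousAt q x := (hqU.contDiffAt (hU.mem_nhds hxU)).continuousAt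
  have hp : ContDiff ℝ ∞ (η • hermQuad (1 : Matrix (Fin n) (Fin n) ℂ) x) :=
    contDiff_const.smul (hermQuad_contDiff 1 x)
  have hpv (y : Cn n) : (η • hermQuad (1 : Matrix (Fin n) (Fin n) ℂ) x) y = η * ‖y - x‖ ^ 2 := by
    rw [Pi.smul_apply, hermQuad_one, smul_eq_mul]
  set q₂ := q + η • hermQuad (1 : Matrix (Fin n) (Fin n) ℂ) x with hq₂
  have hq₂x : q₂ x = q x := by simp [hq₂, hermQuad_self]
  have hq₂c : ContinuousAt q₂ x := hqx'.add hp.continuous.continuousAt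
  have hev : {y | q₂ y < q x + γ} ∩ Metric.ball x s ∈ 𝓝 x :=
    Filter.inter_mem (hq₂c.eventually (gt_mem_nhds (by rw [hq₂x]; linarith)))
      (Metric.ball_mem_nhds x hs0)
  have hlt : ((q x - γ : ℝ) : EReal) < u x := by
    rw [← hqx, EReal.coe_lt_coe_iff]; linarith
  have hpos := hnorm _ hlt _ hev
  obtain ⟨y₀, ⟨⟨hy₁, hy₂⟩, hy₃⟩, hy₄⟩ : ∃ y, y ∈ {y ∈ {y | q₂ y < q x + γ} ∩ Metric.ball x s |
      ((q x - γ : ℝ) : EReal) < u y} ∧ (y ∈ Metric.ball x (2 * s) →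
      Filter.Tendsto (fun δ => regularize ρ δ u y) (𝓝[>] 0) (𝓝 (u y).toReal)) := by
    -- Normalization gives a set of positive measure near x where u is almost q x; it cannot lie in
    -- the null set where the regularizations fail to converge.
    by_contra! hcon
    refine hpos.ne' (measure_mono_null (fun y hy => ?_) (ae_iff.1 (ae_tendsto_regularize hρ hiK)))
    exact fun h => (hcon y hy).2 (h (hcon y hy).1)
  have hy₀ := hy₄ (Metric.ball_subset_ball (by linarith) hy₂)
  have hy₀O : y₀ ∈ O := hKO (Metric.ball_subset_closedBall
    (Metric.ball_subset_ball (by linarith) hy₂))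
  have hu₀ : q x - γ < (u y₀).toReal := by
    rw [← EReal.coe_lt_coe_iff, EReal.coe_toReal (htop y₀ hy₀O) (bot_le.trans_lt hy₃).ne']
    exact hy₃
  obtain ⟨δ, hδ, hδlt⟩ := ((hy₀.eventually (lt_mem_nhds hu₀)).and
    (Ioo_mem_nhdsGT (lt_min hδ₁ hs0))).exists
  have hδ0 : 0 < δ := hδlt.1
  have hδs : δ < s := hδlt.2.trans_le (min_le_right _ _)
  have hδ₁' : δ < δ₁ := hδlt.2.trans_le (min_le_left _ _)
  have hball (z : Cn n) (hz : z ∈ Metric.closedBall x s) :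
      Metric.closedBall z δ ⊆ Metric.closedBall x (2 * s) :=
    Metric.closedBall_subset_closedBall' (by linarith [Metric.mem_closedBall.1 hz])
  have hshr (z : Cn n) (hz : z ∈ Metric.closedBall x s) : z ∈ shrink O δ := (hball z hz).trans hKO
  have hreg (z : Cn n) (hz : z ∈ Metric.closedBall x s) : regularize ρ δ u z ≤ q z + γ := by
    refine regularize_le hρ hδ0 (hiK.mono_set (hball z hz)) ?_
    filter_upwards [(ae_restrict_iff' hO.measurableSet).1 hbot] with y hy hyz
    have hyK := hball z hz hyz
    have h1 : (u y).toReal ≤ q y := by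
      rw [← EReal.coe_le_coe_iff, EReal.coe_toReal (htop y (hKO hyK)) (hy (hKO hyK))]
      exact hle y (hKU hyK)
    have h2 := huc y hyK z (hball z hz (Metric.mem_closedBall_self hδ0.le))
      (lt_of_le_of_lt (Metric.mem_closedBall.1 hyz) hδ₁')
    rw [Real.dist_eq] at h2
    linarith [(abs_lt.1 h2).2]
  have hcont : ContinuousOn (regularize ρ δ u - q₂) (Metric.closedBall x s) := by
    intro z hz
    refine ContinuousAt.continuousWithinAt (ContinuousAt.sub ?_ (ContinuousAt.add ?_ ?_))
    · exact (regularize_contDiffAt_and_sumSq hρ hδ0 hO hint (hshr z hz)).1.continuousAt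
    · exact (hqU.contDiffAt (hU.mem_nhds (hKU (Metric.closedBall_subset_closedBall
        (by linarith) hz)))).continuousAt
    · exact hp.continuous.continuousAt
  obtain ⟨z, hz, hmax⟩ := (isCompact_closedBall x s).exists_isMaxOn
    ⟨x, Metric.mem_closedBall_self hs0.le⟩ hcont
  have hmax₀ := hmax (Metric.ball_subset_closedBall hy₂)
  simp only [Set.mem_ofPred_eq, Pi.sub_apply] at hmax₀
  have hzb : z ∈ Metric.ball x s := by
    by_contra h
    have h1 : ‖z - x‖ = s := by
      rw [← dist_eq_norm]
      exact le_antisymm (Metric.mem_closedBall.1 hz) (not_lt.1 h)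
    have h2 : q₂ z = q z + η * s ^ 2 := by rw [hq₂, Pi.add_apply, hpv, h1]
    have h3 := hreg z hz
    have h4 : q₂ y₀ < q x + γ := hy₁
    have h5 : η * s ^ 2 = 4 * γ := by rw [hγ]; ring
    linarith
  refine ⟨z, (htW (hK (Metric.closedBall_subset_closedBall (by linarith) hz))).1, δ, hδ0,
    hshr z hz, ?_⟩
  filter_upwards [Metric.isOpen_ball.mem_nhds hzb] with y hy
  have := hmax (Metric.ball_subset_closedBall hy)
  simp only [Set.mem_ofPred_eq, Pi.sub_apply] at this ⊢
  linarith

/-- If all regularizations of `u` have admissible complex Hessians, then `u` is admissible in the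
viscosity sense. -/
theorem admissible_of_regularize {θ : ℝ} (hθ : θ < Real.pi) {H : Matrix (Fin n) (Fin n) ℂ}
    (hH : H.PosDef) (hρ : IsMollifier ρ) {u : Cn n → EReal} {O : Set (Cn n)}
    (hO : IsOpen O) (htop : ∀ x ∈ O, u x ≠ ⊤) (hbot : ∀ᵐ x ∂(volume.restrict O), u x ≠ ⊥)
    (hint : LocallyIntegrableOn (fun x => (u x).toReal) O volume)
    (hreg : ∀ δ > 0, ∀ z ∈ shrink O δ, Admissible θ H (levi (regularize ρ δ u) z))
    {x : Cn n} (hx : x ∈ O)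
    (hnorm : ∀ c : EReal, c < u x → ∀ U ∈ 𝓝 x, 0 < volume {y ∈ U | c < u y})
    {q : Cn n → ℝ} (hq : IsUpperTest u x q) : Admissible θ H (levi q x) := by
  have hq2 := hq.contDiffAt
  have h1herm : (1 : Matrix (Fin n) (Fin n) ℂ).IsHermitian := Matrix.isHermitian_one
  have hp2 (x z : Cn n) : ContDiffAt ℝ 2 (hermQuad (1 : Matrix (Fin n) (Fin n) ℂ) x) z :=
    ((hermQuad_contDiff 1 x).of_le (by norm_cast)).contDiffAt
  have hsp2 (η : ℝ) (z : Cn n) :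
      ContDiffAt ℝ 2 (η • hermQuad (1 : Matrix (Fin n) (Fin n) ℂ) x) z :=
    contDiffAt_const.smul (hp2 x z)
  have key (η : ℝ) (hη : 0 < η) :
      Admissible θ H (levi (q + η • hermQuad (1 : Matrix (Fin n) (Fin n) ℂ) x) x) := by
    have hc2 : ContDiffAt ℝ 2 (q + η • hermQuad (1 : Matrix (Fin n) (Fin n) ℂ) x) x :=
      hq2.add (hsp2 η x)
    set q₂ := q + η • hermQuad (1 : Matrix (Fin n) (Fin n) ℂ) x with hq₂
    -- At a touching point the Hessian of q₂ dominates that of a regularization, hence is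
    -- admissible; such points accumulate at x, where the Levi matrix is continuous.
    have hfreq : ∃ᶠ z in 𝓝 x, Admissible θ H (levi q₂ z) := by
      rw [Filter.frequently_iff]
      intro W hW
      obtain ⟨z, ⟨hzW, hz2⟩, δ, hδ, hzs, hmin⟩ := exists_touching_regularize hρ hO htop hbot hint hx
        hnorm hq hη (Filter.inter_mem hW (hc2.eventually (by simp)))
      have hr2 : ContDiffAt ℝ 2 (regularize ρ δ u) z :=
        (regularize_contDiffAt_and_sumSq hρ hδ hO hint hzs).1.of_le (by norm_cast)
      exact ⟨z, hzW, (hreg δ hδ z hzs).mono hθ hH (levi_isHermitian hz2)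
        (levi_le_of_touching hz2 hr2 hmin)⟩
    have : (𝓝 x ⊓ Filter.principal {z | Admissible θ H (levi q₂ z)}).NeBot :=
      Filter.frequently_mem_iff_neBot.1 hfreq
    refine admissible_of_tendsto hθ hH (levi_isHermitian hc2)
      ((continuousAt_levi hc2).mono_left inf_le_left)
      (l := 𝓝 x ⊓ Filter.principal {z | Admissible θ H (levi q₂ z)}) ?_
    exact Filter.mem_inf_of_right (Filter.mem_principal_self _)
  refine admissible_of_tendsto hθ hH (levi_isHermitian hq2) (l := 𝓝[>] (0 : ℝ))
    (B := fun η => levi (q + η • hermQuad (1 : Matrix (Fin n) (Fin n) ℂ) x) x) ?_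
    (Filter.mem_of_superset self_mem_nhdsWithin fun η hη => key η hη)
  have heq (η : ℝ) : levi (q + η • hermQuad (1 : Matrix (Fin n) (Fin n) ℂ) x) x =
      levi q x + (η : ℂ) • (1 : Matrix (Fin n) (Fin n) ℂ) := by
    rw [levi_add hq2 (hsp2 η x), levi_const_smul (hp2 x x), levi_hermQuad h1herm]
  simp_rw [heq]
  have : Filter.Tendsto (fun η : ℝ => levi q x + (η : ℂ) • (1 : Matrix (Fin n) (Fin n) ℂ)) (𝓝 0)
      (𝓝 (levi q x + ((0 : ℝ) : ℂ) • (1 : Matrix (Fin n) (Fin n) ℂ))) :=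
    (tendsto_const_nhds).add
      (((Complex.continuous_ofReal.tendsto 0)).smul tendsto_const_nhds)
  simp only [Complex.ofReal_zero, zero_smul, add_zero] at this
  exact this.mono_left nhdsWithin_le_nhds

end Recovery

/-! ### Comparison of a Kähler form with its value at a point -/

section Main

variable {n : ℕ}

lemma norm_star_dotProduct_mulVec_le (D : Matrix (Fin n) (Fin n) ℂ) (v : Fin n → ℂ) :
    ‖star v ⬝ᵥ D.mulVec v‖ ≤ (∑ j, ∑ k, ‖D j k‖) * ‖v‖ ^ 2 := by
  rw [dotProduct, Finset.sum_mul]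
  refine (norm_sum_le _ _).trans (Finset.sum_le_sum fun j _ => ?_)
  rw [Matrix.mulVec, dotProduct, Finset.mul_sum, Finset.sum_mul]
  refine (norm_sum_le _ _).trans (Finset.sum_le_sum fun k _ => ?_)
  rw [norm_mul, norm_mul, Pi.star_apply, norm_star]
  have h1 := norm_le_pi_norm v j
  have h2 := norm_le_pi_norm v k
  calc ‖v j‖ * (‖D j k‖ * ‖v k‖) = ‖D j k‖ * (‖v j‖ * ‖v k‖) := by ring
    _ ≤ ‖D j k‖ * (‖v‖ * ‖v‖) := by gcongr
    _ = _ := by ring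

lemma exists_lower_bound_posDef {G : Matrix (Fin n) (Fin n) ℂ} (hG : G.PosDef) :
    ∃ m, 0 < m ∧ ∀ v : Fin n → ℂ, m * ‖v‖ ^ 2 ≤ ‖star v ⬝ᵥ G.mulVec v‖ := by
  have hc : Continuous fun v : Fin n → ℂ => ‖star v ⬝ᵥ G.mulVec v‖ := by
    simp only [dotProduct, Matrix.mulVec, Pi.star_apply]
    fun_prop
  have hpos (v : Fin n → ℂ) (hv : v ≠ 0) : 0 < ‖star v ⬝ᵥ G.mulVec v‖ :=
    norm_pos_iff.2 (hG.dotProduct_mulVec_pos hv).ne'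
  -- The sphere is empty only for n = 0.
  rcases (Metric.sphere (0 : Fin n → ℂ) 1).eq_empty_or_nonempty with he | hne
  · refine ⟨1, one_pos, fun v => ?_⟩
    by_cases hv : v = 0
    · simp [hv]
    · have : (‖v‖⁻¹ : ℂ) • v ∈ Metric.sphere (0 : Fin n → ℂ) 1 := by
        rw [mem_sphere_zero_iff_norm, norm_smul]
        simp [hv]
      rw [he] at this
      exact this.elim
  · obtain ⟨v₀, hv₀, hmin⟩ := (isCompact_sphere (0 : Fin n → ℂ) 1).exists_isMinOn hne hc.continuousOn
    have hv₀0 : v₀ ≠ 0 := fun h => by simp [h] at hv₀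
    refine ⟨_, hpos v₀ hv₀0, fun v => ?_⟩
    by_cases hv : v = 0
    · simp [hv]
    · have hmem : (‖v‖⁻¹ : ℂ) • v ∈ Metric.sphere (0 : Fin n → ℂ) 1 := by
        rw [mem_sphere_zero_iff_norm, norm_smul]
        simp [hv]
      have h1 : ‖star v₀ ⬝ᵥ G.mulVec v₀‖ ≤ _ := hmin hmem
      have hv' : ‖v‖ ≠ 0 := norm_ne_zero_iff.2 hv
      have h2 : ‖star ((‖v‖⁻¹ : ℂ) • v) ⬝ᵥ G.mulVec ((‖v‖⁻¹ : ℂ) • v)‖ =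
          ‖star v ⬝ᵥ G.mulVec v‖ / ‖v‖ ^ 2 := by
        rw [star_smul, Matrix.mulVec_smul, smul_dotProduct, dotProduct_smul, norm_smul, norm_smul]
        simp only [norm_star, norm_inv, Complex.norm_real, norm_norm]
        field_simp
      beta_reduce at h1
      rw [h2, le_div_iff₀ (by positivity)] at h1
      exact h1

variable {X : Type*} [TopologicalSpace X] [ChartedSpace (Cn n) X]

/-- Closeness is measured by the form at y, while the lower bound m is known at x. An entrywise
difference E below r m / (1 + r) suffices, since then E ≤ r (m - E). -/
lemma KahlerForm.eventually_closeTo (κ : KahlerForm n X) {e : OpenPartialHomeomorph X (Cn n)}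
    (he : e ∈ holCharts n X) {x : Cn n} (hx : x ∈ e.target) {r : ℝ} (hr : 0 < r) :
    ∀ᶠ y in 𝓝 x, CloseTo (κ.coeff e x) (κ.coeff e y) r := by
  obtain ⟨m, hm, hG⟩ := exists_lower_bound_posDef (κ.posDef e he x hx)
  have hc (j k : Fin n) : ContinuousAt (fun y => κ.coeff e y j k) x :=
    (κ.smooth e he j k).continuousOn.continuousAt (e.open_target.mem_nhds hx)
  have hE : ContinuousAt (fun y => ∑ j, ∑ k, ‖(κ.coeff e x - κ.coeff e y) j k‖) x :=
    tendsto_finsetSum _ fun j _ => tendsto_finsetSum _ fun k _ =>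
      (continuousAt_const.sub (hc j k)).norm
  have h0 : ∑ j, ∑ k, ‖(κ.coeff e x - κ.coeff e x) j k‖ < r * m / (1 + r) := by
    simp only [sub_self, Matrix.zero_apply, norm_zero, Finset.sum_const_zero]
    positivity
  filter_upwards [hE.eventually (gt_mem_nhds h0)] with y hy v
  set E := ∑ j, ∑ k, ‖(κ.coeff e x - κ.coeff e y) j k‖ with hEdef
  have h1 : ‖star v ⬝ᵥ (κ.coeff e x - κ.coeff e y).mulVec v‖ ≤ E * ‖v‖ ^ 2 :=
    norm_star_dotProduct_mulVec_le _ v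
  have h2 : ‖star v ⬝ᵥ (κ.coeff e x).mulVec v‖ ≤
      ‖star v ⬝ᵥ (κ.coeff e x - κ.coeff e y).mulVec v‖ + ‖star v ⬝ᵥ (κ.coeff e y).mulVec v‖ := by
    refine le_trans (le_of_eq ?_) (norm_add_le _ _)
    rw [Matrix.sub_mulVec, dotProduct_sub, sub_add_cancel]
  have h3 := hG v
  rw [lt_div_iff₀ (by positivity)] at hy
  have h4 : E * (1 + r) * ‖v‖ ^ 2 ≤ r * m * ‖v‖ ^ 2 :=
    mul_le_mul_of_nonneg_right hy.le (by positivity)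
  nlinarith

/-! ### The two implications -/

/-- Adding t times the quadratic form of G centred at x to q gives another upper test, with Levi
matrix increased by t G. -/
lemma admissible_of_upperTest_ray (hn : 2 ≤ n) {θ : ℝ} (h0 : 0 < θ) (hθ : θ < Real.pi)
    {G : Matrix (Fin n) (Fin n) ℂ} (hG : G.PosDef) {φ : Cn n → EReal} {x : Cn n} {q : Cn n → ℝ}
    (hq : IsUpperTest φ x q)
    (h : ∀ p : Cn n → ℝ, IsUpperTest φ x p → opP G (levi p x) ≤ -Real.cot θ) :
    Admissible θ G (levi q x) := by
  have hq2 := hq.contDiffAt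
  refine admissible_of_ray hn h0 hθ hG (levi_isHermitian hq2) fun t ht => ?_
  have hp2 : ContDiffAt ℝ 2 (hermQuad G x) x :=
    ((hermQuad_contDiff G x).of_le (by norm_cast)).contDiffAt
  have htp2 : ContDiffAt ℝ 2 (t • hermQuad G x) x := contDiffAt_const.smul hp2
  have := h (q + t • hermQuad G x) (hq.add_nonneg htp2 (by simp [hermQuad_self])
    fun y => mul_nonneg ht (hermQuad_nonneg hG.posSemidef x y))
  rwa [levi_add hq2 htp2, levi_const_smul hp2, levi_hermQuad hG.isHermitian] at this

lemma isViscositySubsolution_regularize {ρ : Cn n → ℝ} (hρ : IsMollifier ρ) (hn : 2 ≤ n) {θ : ℝ}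
    (h0 : 0 < θ) (hθ : θ < Real.pi) {κ : KahlerForm n X} {α : Current n X}
    (hvisc : ViscosityLE κ α (-Real.cot θ)) {ε r : ℝ}
    (hr : ∀ G H A : Matrix (Fin n) (Fin n) ℂ, G.PosDef → H.PosDef → CloseTo H G r →
      Admissible θ G A → Admissible θ H (A + (ε : ℂ) • G))
    {e : OpenPartialHomeomorph X (Cn n)} (he : e ∈ holCharts n X) {O : Set (Cn n)} (hO : IsOpen O)
    (hOe : O ⊆ e.target) {H : Matrix (Fin n) (Fin n) ℂ} (hH : H.PosDef)
    (hclose : ∀ z ∈ O, CloseTo H (κ.coeff e z) r) {φ : Cn n → EReal}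
    (hφ : IsUscPotential e (addKahler α ε κ e) O φ) {δ : ℝ} (hδ : 0 < δ) :
    IsViscositySubsolution (fun _ => H) (-Real.cot θ) (fun z => (regularize ρ δ φ z : EReal))
      (shrink O δ) := by
  have hadm : ∀ x ∈ O, ∀ q : Cn n → ℝ, ContDiff ℝ 2 q → (q x : EReal) = φ x →
      (∀ᶠ y in 𝓝 x, φ y ≤ (q y : EReal)) → Admissible θ H (levi q x) := by
    intro x hx q hq hqx hqφ
    -- Near x the function φ - ε ψ is a potential of α. Its test q - ε ψ is admissible for the form
    -- at x, and stability returns the term ε ω with H in place of that form.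
    obtain ⟨ψ, hψ, R, hR, -, hlevi⟩ := κ.exists_potential he (hOe hx)
    have hpot := hφ.add_smooth (κ := κ) (O' := O ∩ Metric.ball x R) (hO.inter Metric.isOpen_ball)
      Set.inter_subset_left hψ (fun z hz => hlevi z hz.2) (-ε)
      (T' := fun j k η => α.coeff e j k η) (fun j k η => by
        rw [addKahler]; push_cast; ring)
    have hψ2 : ContDiffAt ℝ 2 ψ x := (hψ.of_le (by norm_cast)).contDiffAt
    have hsψ2 : ContDiffAt ℝ 2 ((-ε) • ψ) x := contDiffAt_const.smul hψ2
    have htest := (isUpperTest_of_eventually hqx hq.contDiffAt hqφ).add hsψ2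
    have hxR : x ∈ Metric.ball x R := Metric.mem_ball_self hR
    have hA := admissible_of_upperTest_ray hn h0 hθ (κ.posDef e he x (hOe hx)) htest
      ((hvisc e he _ _ hpot).2 x ⟨hx, hxR⟩)
    have hB := hr _ H _ (κ.posDef e he x (hOe hx)) hH (hclose x hx) hA
    rw [levi_add hq.contDiffAt hsψ2, levi_const_smul hψ2, hlevi x hxR] at hB
    simpa using hB
  have hreg (z : Cn n) (hz : z ∈ shrink O δ) :=
    (regularize_contDiffAt_and_sumSq hρ hδ hO hφ.locallyIntegrable hz).1
  refine ⟨fun z hz => ?_, fun z hz q hq => ?_⟩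
  · have hc : ContinuousAt (fun z => (regularize ρ δ φ z : EReal)) z :=
      continuous_coe_real_ereal.continuousAt.comp (hreg z hz).continuousAt
    exact hc.upperSemicontinuousAt.upperSemicontinuousWithinAt _
  · have hz2 : ContDiffAt ℝ 2 (regularize ρ δ φ) z := (hreg z hz).of_le (by norm_cast)
    have hA := admissible_regularize h0 hθ hH hρ hδ hO hφ.usc hφ.ne_top hφ.ae_ne_bot
      hφ.locallyIntegrable hadm hz
    refine (hA.mono hθ hH (levi_isHermitian hq.contDiffAt)
      (levi_le_of_touching hq.contDiffAt hz2 ?_)).opP_le hn hθ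
    filter_upwards [hq.eventually_le] with y hy
    have h1 : q z = regularize ρ δ φ z := EReal.coe_eq_coe_iff.1 hq.1
    have h2 := EReal.coe_le_coe_iff.1 hy
    simp only [Pi.sub_apply]
    linarith

/-- For fixed ε the hypothesis is used with H the value of the form at x, on a ball so small that H
is r-close to the form throughout. -/
lemma viscosityLE_of_regularize {ρ : Cn n → ℝ} (hρ : IsMollifier ρ) (hn : 2 ≤ n) {θ : ℝ}
    (h0 : 0 < θ) (hθ : θ < Real.pi) {κ : KahlerForm n X} {α : Current n X}
    (h : ∀ ε : ℝ, 0 < ε → ∃ r : ℝ, 0 < r ∧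
      ∀ e ∈ holCharts n X, ∀ O : Set (Cn n), IsOpen O → O ⊆ e.target →
        ∀ H : Matrix (Fin n) (Fin n) ℂ, H.PosDef → (∀ z ∈ O, CloseTo H (κ.coeff e z) r) →
          ∀ φ : Cn n → EReal, IsUscPotential e (addKahler α ε κ e) O φ →
            ∀ δ : ℝ, 0 < δ → IsViscositySubsolution (fun _ => H) (-Real.cot θ)
              (fun z => (regularize ρ δ φ z : EReal)) (shrink O δ)) :
    ViscosityLE κ α (-Real.cot θ) := by
  intro e he O φ hφ
  refine ⟨hφ.usc, fun x hx q hq => ?_⟩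
  have hxe : x ∈ e.target := hφ.subset hx
  have hG := κ.posDef e he x hxe
  suffices Admissible θ (κ.coeff e x) (levi q x) from this.opP_le hn hθ
  have hq2 := hq.contDiffAt
  have key (ε : ℝ) (hε : 0 < ε) :
      Admissible θ (κ.coeff e x) (levi q x + (ε : ℂ) • κ.coeff e x) := by
    obtain ⟨r, hr, hreg⟩ := h ε hε
    obtain ⟨ψ, hψ, R, hR, -, hlevi⟩ := κ.exists_potential he hxe
    have hxR : x ∈ Metric.ball x R := Metric.mem_ball_self hR
    obtain ⟨s, hs, hsub⟩ := Metric.mem_nhds_iff.1 (Filter.inter_mem (hφ.isOpen.mem_nhds hx)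
      (Filter.inter_mem (Metric.ball_mem_nhds x hR) (κ.eventually_closeTo he hxe hr)))
    have hpot := hφ.add_smooth (κ := κ) (O' := Metric.ball x s) Metric.isOpen_ball
      (fun z hz => (hsub hz).1) hψ (fun z hz => hlevi z (hsub hz).2.1) ε
      (T' := addKahler α ε κ e) (fun j k η => rfl)
    have hψ2 : ContDiffAt ℝ 2 ψ x := (hψ.of_le (by norm_cast)).contDiffAt
    have hsψ2 : ContDiffAt ℝ 2 (ε • ψ) x := contDiffAt_const.smul hψ2
    have hadm : ∀ δ > 0, ∀ z ∈ shrink (Metric.ball x s) δ, Admissible θ (κ.coeff e x)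
        (levi (regularize ρ δ fun y => φ y + ((ε • ψ) y : ℝ)) z) := by
      intro δ hδ z hz
      have hz2 : ContDiffAt ℝ 2 (regularize ρ δ fun y => φ y + ((ε • ψ) y : ℝ)) z :=
        (regularize_contDiffAt_and_sumSq hρ hδ Metric.isOpen_ball hpot.locallyIntegrable hz).1.of_le
          (by norm_cast)
      -- The regularization is smooth and hence an upper test of itself.
      exact admissible_of_upperTest_ray hn h0 hθ hG
        (isUpperTest_of_eventually rfl hz2 (Filter.Eventually.of_forall fun y => le_rfl))
        ((hreg e he _ Metric.isOpen_ball hpot.subset _ hG (fun y hy => (hsub hy).2.2) _ hpot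
          δ hδ).2 z hz)
    have hxs : x ∈ Metric.ball x s := Metric.mem_ball_self hs
    have hA := admissible_of_regularize hθ hG hρ Metric.isOpen_ball hpot.ne_top hpot.ae_ne_bot
      hpot.locallyIntegrable hadm hxs (hpot.normalized x hxs) (hq.add hsψ2)
    rwa [levi_add hq2 hsψ2, levi_const_smul hψ2, hlevi x hxR] at hA
  refine admissible_of_tendsto hθ hG (levi_isHermitian hq2) (l := 𝓝[>] (0 : ℝ))
    (B := fun ε => levi q x + (ε : ℂ) • κ.coeff e x) ?_
    (Filter.mem_of_superset self_mem_nhdsWithin fun ε hε => key ε hε)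
  have : Filter.Tendsto (fun ε : ℝ => levi q x + (ε : ℂ) • κ.coeff e x) (𝓝 0)
      (𝓝 (levi q x + ((0 : ℝ) : ℂ) • κ.coeff e x)) :=
    (tendsto_const_nhds).add
      (((Complex.continuous_ofReal.tendsto 0)).smul tendsto_const_nhds)
  simp only [Complex.ofReal_zero, zero_smul, add_zero] at this
  exact this.mono_left nhdsWithin_le_nhds

end Main

end DHYM

end

theorem mainTheorem12 {n : ℕ} (hn : 2 ≤ n) {X : Type*} [TopologicalSpace X]
    [ChartedSpace (DHYM.Cn n) X] [IsManifold 𝓘(ℂ, DHYM.Cn n) ω X]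
    (κ : DHYM.KahlerForm n X) (α : DHYM.Current n X) (hα : DHYM.HasUscPotentials α)
    (θ₀ : ℝ) (hθ₀ : 0 < θ₀) (hθ₀' : θ₀ < Real.pi)
    (ρ : DHYM.Cn n → ℝ) (hρ : DHYM.IsMollifier ρ) :
    DHYM.ViscosityLE κ α (-Real.cot θ₀) ↔
      ∀ ε : ℝ, 0 < ε → ∃ r : ℝ, 0 < r ∧
        ∀ e ∈ DHYM.holCharts n X, ∀ O : Set (DHYM.Cn n), IsOpen O → O ⊆ e.target →
          ∀ H : Matrix (Fin n) (Fin n) ℂ, H.PosDef →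
            (∀ z ∈ O, DHYM.CloseTo H (κ.coeff e z) r) →
            ∀ φ : DHYM.Cn n → EReal, DHYM.IsUscPotential e (DHYM.addKahler α ε κ e) O φ →
              ∀ δ : ℝ, 0 < δ →
                DHYM.IsViscositySubsolution (fun _ => H) (-Real.cot θ₀)
                  (fun z => (DHYM.regularize ρ δ φ z : EReal)) (DHYM.shrink O δ) := by
  refine ⟨fun h ε hε => ?_, DHYM.viscosityLE_of_regularize hρ hn hθ₀ hθ₀'⟩
  obtain ⟨r, hr, hclose⟩ := DHYM.exists_admissible_of_closeTo hn hθ₀ hθ₀' hε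
  exact ⟨r, hr, fun e he O hO hOe H hH hcl φ hφ δ hδ =>
    DHYM.isViscositySubsolution_regularize hρ hn hθ₀ hθ₀' h hclose he hO hOe hH hcl hφ hδ⟩
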